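/- Let $\mathcal G\rightrightarrows M$ be a Lie groupoid: $\mathcal G$ and $M$ are finite-dimensional smooth manifolds, Hausdorff and second countable, the structure maps are smooth, and the source $s$ and target $t$ are submersions. Write $\mathcal G^{(k)}$ for the manifold of strings $(g_1,\dots,g_k)$ with $s(g_i)=t(g_{i+1})$, $\mathcal G^{(0)}=M$; let $A=\ker(ds)|_M$ be the Lie algebroid, with anchor $\rho=dt|_A:A\to TM$, let $\bar m(p,q)=pq^{-1}$ be the division map, and let $r_g$, $l_g$ be the differentials of right and left translation by $g$. Assume that $\mathcal G$ is regular, i.e. all its orbits have the same dimension (equivalently, $\rho$ has constant rank). It then has two representations: the isotropy representation $\mathfrak i=\ker\rho$, with $g\cdot\alpha=r_{g^{-1}}l_g\alpha$, and the normal representation $\nu=TM/\operatorname{Im}\rho$, with $g\cdot[ds(X)]=[dt(X)]$ for $X\in T_g\mathcal G$. For $E=\mathfrak i,\nu$ let $H^*(\mathcal G,E)$ be the cohomology of the complex of smooth maps $u:\mathcal G^{(k)}\to E$, $u(g_1,\dots,g_k)\in E_{t(g_1)}$ ($k\ge 0$), with $$(\delta u)(g_1,\dots,g_{k+1})=g_1\cdot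 u(g_2,\dots,g_{k+1})+\sum_{i=1}^k(-1)^iu(g_1,\dots,g_ig_{i+1},\dots,g_{k+1})+(-1)^{k+1}u(g_1,\dots,g_k).$$ Let $H^*_{\mathrm{def}}(\mathcal G)$ be the cohomology of the deformation complex: $C^0_{\mathrm{def}}(\mathcal G)=\Gamma(A)$ and, for $k\ge1$, $C^k_{\mathrm{def}}(\mathcal G)$ consists of the smooth maps $c:\mathcal G^{(k)}\to T\mathcal G$ with $c(g_1,\dots,g_k)\in T_{g_1}\mathcal G$ for which $ds(c(g_1,\dots,g_k))=:s_c(g_2,\dots,g_k)$ does not depend on $g_1$; its differential is $(\delta\alpha)(g)=r_g\alpha_{t(g)}+l_g\,di(\alpha_{s(g)})$ (with $i$ the inversion) for $k=0$, and for $k\ge1$ $$(\delta c)(g_1,\dots,g_{k+1})=-d\bar m\big(c(g_1g_2,\dots,g_{k+1}),c(g_2,\dots,g_{k+1})\big)+\sum_{i=2}^k(-1)^ic(g_1,\dots,g_ig_{i+1},\dots,g_{k+1})+(-1)^{k+1}c(g_1,\dots,g_k).$$ Then these are cochain complexes, and there is a long exact sequence of vector spaces (cohomology in negative degrees being $0$)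 $$\cdots\longrightarrow H^k(\mathcal G,\mathfrak i)\xrightarrow{\ r\ }H^k_{\mathrm{def}}(\mathcal G)\xrightarrow{\ \pi\ }H^{k-1}(\mathcal G,\nu)\xrightarrow{\ K\ }H^{k+1}(\mathcal G,\mathfrak i)\longrightarrow\cdots$$ in which: - $r$ is induced by the inclusion of $\mathfrak i$-valued cochains, $u\mapsto c_u$, $c_u(g_1,\dots,g_k)=r_{g_1}(u(g_1,\dots,g_k))$ (for $k=0$, $\Gamma(\mathfrak i)\subseteq\Gamma(A)$); - $\pi$ sends the class of a cocycle $c$ to the class of $s_c$ modulo $\operatorname{Im}\rho$ (for $k\ge 1$); - $K$ is the connecting map: every cocycle in $C^{k-1}(\mathcal G,\nu)$, $k\ge1$, is of the form $[s_c]=s_c \bmod \operatorname{Im}\rho$ for some $c\in C^k_{\mathrm{def}}(\mathcal G)$ with $\delta c=c_w$ for a cocycle $w\in C^{k+1}(\mathcal G,\mathfrak i)$; and whenever $c\in C^k_{\mathrm{def}}(\mathcal G)$ and $w\in C^{k+1}(\mathcal G,\mathfrak i)$ satisfy $\delta c=c_w$, both $[s_c]$ and $w$ are cocycles and $K$ maps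 the class of $[s_c]$ to the class of $w$. -/

import Mathlib

open scoped Manifold ContDiff Topology
open Set

noncomputable section

/-! ## Generalities -/

/-- The identification of the fibres `V x` and `V y` of a family of vector spaces over two points
which are (propositionally) equal. -/
def fcast {X : Type*} (V : X → Type*) [∀ x, AddCommGroup (V x)] [∀ x, Module ℝ (V x)]
    {x y : X} (h : x = y) : V x →ₗ[ℝ] V y :=
  h ▸ LinearMap.id

@[simp] theorem fcast_rfl {X : Type*} (V : X → Type*) [∀ x, AddCommGroup (V x)]
    [∀ x, Module ℝ (V x)] {x : X} (h : x = x) (v : V x) : fcast V h v = v := rfl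

/-- A sequence of spaces of cochains `C k`, `k ≥ 0`, each sitting in an ambient real vector space
`X k` (think of all set-theoretic cochains, `C k` being the smooth ones), with differentials `d k`.
It is a cochain complex if `IsComplex` below holds. -/
structure CochainData where
  /-- the ambient spaces -/
  X : ℕ → Type*
  [grp : ∀ k, AddCommGroup (X k)]
  [mod : ∀ k, Module ℝ (X k)]
  /-- the cochains -/
  C : ∀ k, Submodule ℝ (X k)
  /-- the differential -/
  d : ∀ k, X k →ₗ[ℝ] X (k + 1)

namespace CochainData

attribute [instance] CochainData.grp CochainData.mod

variable (K : CochainData)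

/-- `d` maps cochains to cochains, and `d ∘ d = 0` on cochains. -/
def IsComplex : Prop := ∀ k, ∀ c ∈ K.C k, K.d k c ∈ K.C (k + 1) ∧ K.d (k + 1) (K.d k c) = 0

/-- The `k`-cocycles. -/
def Z (k : ℕ) : Submodule ℝ (K.X k) := K.C k ⊓ LinearMap.ker (K.d k)

/-- The `k`-coboundaries. -/
def B : ∀ k, Submodule ℝ (K.X k)
  | 0 => ⊥
  | k + 1 => (K.C k).map (K.d k)

/-- The cohomology in degree `k`: cocycles modulo coboundaries. -/
abbrev H (k : ℕ) : Type _ := K.Z k ⧸ (K.B k).comap (K.Z k).subtype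

/-- The cohomology class of a cocycle. -/
def cls {k : ℕ} (z : K.X k) (hz : z ∈ K.Z k) : K.H k := Submodule.Quotient.mk ⟨z, hz⟩

end CochainData

/-! ## Lie groupoids -/

/-- A Lie groupoid `G ⇉ M`; the manifold `G` of arrows is modelled on `E`, the manifold `M` of
objects on `F`. The product `mul g h` is meaningful only if `src g = tgt h`; no condition is put on
its other values, which play no role. -/
structure LieGroupoid (E F G M : Type*)
    [NormedAddCommGroup E] [NormedSpace ℝ E] [NormedAddCommGroup F] [NormedSpace ℝ F]
    [TopologicalSpace G] [ChartedSpace E G] [TopologicalSpace M] [ChartedSpace F M] where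
  /-- source -/
  src : G → M
  /-- target -/
  tgt : G → M
  /-- unit -/
  unit : M → G
  /-- inversion -/
  inv : G → G
  /-- multiplication -/
  mul : G → G → G
  src_unit : ∀ x, src (unit x) = x
  tgt_unit : ∀ x, tgt (unit x) = x
  src_mul : ∀ g h, src g = tgt h → src (mul g h) = src h
  tgt_mul : ∀ g h, src g = tgt h → tgt (mul g h) = tgt g
  mul_assoc : ∀ g h k, src g = tgt h → src h = tgt k → mul (mul g h) k = mul g (mul h k)
  mul_unit : ∀ g, mul g (unit (src g)) = g
  unit_mul : ∀ g, mul (unit (tgt g)) g = g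
  src_inv : ∀ g, src (inv g) = tgt g
  tgt_inv : ∀ g, tgt (inv g) = src g
  mul_inv : ∀ g, mul g (inv g) = unit (tgt g)
  inv_mul : ∀ g, mul (inv g) g = unit (src g)
  src_submersion : Manifold.IsSubmersion 𝓘(ℝ, E) 𝓘(ℝ, F) ∞ src
  tgt_submersion : Manifold.IsSubmersion 𝓘(ℝ, E) 𝓘(ℝ, F) ∞ tgt
  unit_smooth : ContMDiff 𝓘(ℝ, F) 𝓘(ℝ, E) ∞ unit
  inv_smooth : ContMDiff 𝓘(ℝ, E) 𝓘(ℝ, E) ∞ inv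
  mul_smooth : ContMDiffOn (𝓘(ℝ, E).prod 𝓘(ℝ, E)) 𝓘(ℝ, E) ∞ (fun p : G × G => mul p.1 p.2)
    {p | src p.1 = tgt p.2}

namespace LieGroupoid

section Structure

variable {E F G M : Type*}
  [NormedAddCommGroup E] [NormedSpace ℝ E] [NormedAddCommGroup F] [NormedSpace ℝ F]
  [TopologicalSpace G] [ChartedSpace E G] [TopologicalSpace M] [ChartedSpace F M]
  (Γ : LieGroupoid E F G M)

theorem inv_unit (x : M) : Γ.inv (Γ.unit x) = Γ.unit x := by
  have h1 := Γ.inv_mul (Γ.unit x)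
  have h2 := Γ.mul_unit (Γ.inv (Γ.unit x))
  rw [Γ.src_inv, Γ.tgt_unit] at h2
  rw [h2, Γ.src_unit] at h1
  exact h1

/-! ### Strings of composable arrows -/

/-- The set `G^(k)` of strings `x₀ ←g₁— x₁ ←g₂— ⋯ ←g_k— x_k` of `k` composable arrows; here
`arr i` is `g_{i+1}` and `obj i` is `x_i`. For `k = 0` this is `M`; for `k ≥ 1` the objects are
determined by the arrows, and the condition on the arrows is `s(g_i) = t(g_{i+1})`. -/
structure Str (k : ℕ) where
  /-- the objects -/
  obj : Fin (k + 1) → M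
  /-- the arrows -/
  arr : Fin k → G
  tgt_arr : ∀ i, Γ.tgt (arr i) = obj i.castSucc
  src_arr : ∀ i, Γ.src (arr i) = obj i.succ

variable {Γ}

namespace Str

/-- `(g₁, …, g_{k+1}) ↦ (g₂, …, g_{k+1})` -/
def tail {k : ℕ} (g : Γ.Str (k + 1)) : Γ.Str k where
  obj i := g.obj i.succ
  arr i := g.arr i.succ
  tgt_arr i := g.tgt_arr i.succ
  src_arr i := g.src_arr i.succ

/-- `(g₁, …, g_{k+1}) ↦ (g₁, …, g_k)` -/
def init {k : ℕ} (g : Γ.Str (k + 1)) : Γ.Str k where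
  obj i := g.obj i.castSucc
  arr i := g.arr i.castSucc
  tgt_arr i := g.tgt_arr i.castSucc
  src_arr i := g.src_arr i.castSucc

theorem composable {k : ℕ} (g : Γ.Str (k + 1)) (j : Fin k) :
    Γ.src (g.arr j.castSucc) = Γ.tgt (g.arr j.succ) := by
  rw [g.src_arr, g.tgt_arr]; rfl

/-- The string obtained by composing the two arrows `arr j` and `arr (j+1)`:
`(g₁, …, g_{k+1}) ↦ (g₁, …, g_{j+1} g_{j+2}, …, g_{k+1})`. -/
def comp {k : ℕ} (g : Γ.Str (k + 1)) (j : Fin k) : Γ.Str k where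
  obj i := if i.1 ≤ j.1 then g.obj i.castSucc else g.obj i.succ
  arr i := if i.1 < j.1 then g.arr i.castSucc
    else if i.1 = j.1 then Γ.mul (g.arr j.castSucc) (g.arr j.succ) else g.arr i.succ
  tgt_arr i := by
    have hc := g.composable j
    rcases lt_trichotomy i.1 j.1 with h | h | h
    · rw [if_pos h, g.tgt_arr, if_pos (by simpa using h.le)]
    · obtain rfl : i = j := Fin.ext h
      rw [if_neg (lt_irrefl _), if_pos rfl, Γ.tgt_mul _ _ hc, g.tgt_arr, if_pos (by simp)]
    · rw [if_neg (by omega), if_neg (by omega), g.tgt_arr, if_neg (by simpa using h)]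
      rfl
  src_arr i := by
    have hc := g.composable j
    rcases lt_trichotomy i.1 j.1 with h | h | h
    · rw [if_pos h, g.src_arr, if_pos (by simpa using h)]
      rfl
    · obtain rfl : i = j := Fin.ext h
      rw [if_neg (lt_irrefl _), if_pos rfl, Γ.src_mul _ _ hc, g.src_arr, if_neg (by simp)]
    · rw [if_neg (by omega), if_neg (by omega), g.src_arr, if_neg (by simp; omega)]

theorem obj_zero_comp {k : ℕ} (g : Γ.Str (k + 1)) (j : Fin k) : (g.comp j).obj 0 = g.obj 0 := by
  simp [comp]

theorem tgt_arr_zero {k : ℕ} (g : Γ.Str (k + 1)) : Γ.tgt (g.arr 0) = g.obj 0 := g.tgt_arr 0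

theorem obj_zero_init {k : ℕ} (g : Γ.Str (k + 1)) : g.init.obj 0 = g.obj 0 := rfl

theorem obj_zero_tail {k : ℕ} (g : Γ.Str (k + 1)) : g.tail.obj 0 = Γ.src (g.arr 0) :=
  (g.src_arr 0).symm

/-- The arrow `g₁` of a string; for `k = 0`, the unit at the object `x₀`. -/
def head : ∀ {k : ℕ}, Γ.Str k → G
  | 0, g => Γ.unit (g.obj 0)
  | _ + 1, g => g.arr 0

theorem head_zero (g : Γ.Str 0) : g.head = Γ.unit (g.obj 0) := rfl

theorem head_succ {k : ℕ} (g : Γ.Str (k + 1)) : g.head = g.arr 0 := rfl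

theorem head_init_one (g : Γ.Str 1) : g.init.head = Γ.unit (Γ.tgt (g.arr 0)) :=
  congrArg Γ.unit g.tgt_arr_zero.symm

theorem head_tail_one (g : Γ.Str 1) : g.tail.head = Γ.unit (Γ.src (g.arr 0)) :=
  congrArg Γ.unit g.obj_zero_tail

theorem head_tail {k : ℕ} (g : Γ.Str (k + 2)) : g.tail.head = g.arr 1 := rfl

theorem head_init {k : ℕ} (g : Γ.Str (k + 2)) : g.init.head = g.arr 0 := rfl

theorem head_comp_zero {k : ℕ} (g : Γ.Str (k + 2)) :
    (g.comp 0).head = Γ.mul (g.arr 0) (g.arr 1) := rfl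

theorem head_comp_succ {k : ℕ} (g : Γ.Str (k + 2)) (j : Fin k) :
    (g.comp j.succ).head = g.arr 0 := rfl

/-- A smooth parametrized family of strings, i.e. a smooth map `ℝⁿ → G^(k)`: as `G^(k)` is an
embedded submanifold of `M^(k+1) × G^k`, this is a map with smooth components. -/
def IsPlot {k n : ℕ} (γ : EuclideanSpace ℝ (Fin n) → Γ.Str k) : Prop :=
  (∀ i, ContMDiff (𝓡 n) 𝓘(ℝ, F) ∞ fun z => (γ z).obj i) ∧
  (∀ i, ContMDiff (𝓡 n) 𝓘(ℝ, E) ∞ fun z => (γ z).arr i)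

theorem IsPlot.head {k n : ℕ} {γ : EuclideanSpace ℝ (Fin n) → Γ.Str k} (h : IsPlot γ) :
    ContMDiff (𝓡 n) 𝓘(ℝ, E) ∞ fun z => (γ z).head := by
  cases k with
  | zero => exact Γ.unit_smooth.comp (h.1 0)
  | succ k => exact h.2 0

end Str

/-! ### Translations, the Lie algebroid and its anchor -/

variable (Γ)

/-- The differential at `h` of the right translation `p ↦ p g`, which is defined on the `s`-fibre
over `t(g)`; it is meaningful on `Ker (ds)`. -/
def dRight (h g : G) : TangentSpace 𝓘(ℝ, E) h →ₗ[ℝ] TangentSpace 𝓘(ℝ, E) (Γ.mul h g) :=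
  (mfderivWithin 𝓘(ℝ, E) 𝓘(ℝ, E) (fun p => Γ.mul p g) {p | Γ.src p = Γ.tgt g} h).toLinearMap

/-- The differential at `h` of the left translation `p ↦ g p`, which is defined on the `t`-fibre
over `s(g)`; it is meaningful on `Ker (dt)`. -/
def dLeft (g h : G) : TangentSpace 𝓘(ℝ, E) h →ₗ[ℝ] TangentSpace 𝓘(ℝ, E) (Γ.mul g h) :=
  (mfderivWithin 𝓘(ℝ, E) 𝓘(ℝ, E) (fun p => Γ.mul g p) {p | Γ.tgt p = Γ.src g} h).toLinearMap

/-- `r_g` from the unit at `t(g)` to `g`. -/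
def rUnit (g : G) :
    TangentSpace 𝓘(ℝ, E) (Γ.unit (Γ.tgt g)) →ₗ[ℝ] TangentSpace 𝓘(ℝ, E) g :=
  fcast (TangentSpace 𝓘(ℝ, E)) (Γ.unit_mul g) ∘ₗ Γ.dRight (Γ.unit (Γ.tgt g)) g

/-- `l_g` from the unit at `s(g)` to `g`. -/
def lUnit (g : G) :
    TangentSpace 𝓘(ℝ, E) (Γ.unit (Γ.src g)) →ₗ[ℝ] TangentSpace 𝓘(ℝ, E) g :=
  fcast (TangentSpace 𝓘(ℝ, E)) (Γ.mul_unit g) ∘ₗ Γ.dLeft g (Γ.unit (Γ.src g))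

/-- The differential of the inversion at a unit. -/
def dInvUnit (x : M) :
    TangentSpace 𝓘(ℝ, E) (Γ.unit x) →ₗ[ℝ] TangentSpace 𝓘(ℝ, E) (Γ.unit x) :=
  fcast (TangentSpace 𝓘(ℝ, E)) (Γ.inv_unit x) ∘ₗ
    (mfderiv 𝓘(ℝ, E) 𝓘(ℝ, E) Γ.inv (Γ.unit x)).toLinearMap

/-- `ds` at `g`. -/
def dSrc (g : G) : TangentSpace 𝓘(ℝ, E) g →ₗ[ℝ] TangentSpace 𝓘(ℝ, F) (Γ.src g) :=
  (mfderiv 𝓘(ℝ, E) 𝓘(ℝ, F) Γ.src g).toLinearMap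

/-- `dt` at `g`. -/
def dTgt (g : G) : TangentSpace 𝓘(ℝ, E) g →ₗ[ℝ] TangentSpace 𝓘(ℝ, F) (Γ.tgt g) :=
  (mfderiv 𝓘(ℝ, E) 𝓘(ℝ, F) Γ.tgt g).toLinearMap

/-- The fibre `A_x = Ker (ds)` (at the unit of `x`) of the Lie algebroid. -/
def algebroid (x : M) : Submodule ℝ (TangentSpace 𝓘(ℝ, E) (Γ.unit x)) :=
  LinearMap.ker (Γ.dSrc (Γ.unit x))

/-- `dt` at the unit of `x`; its restriction to `A_x` is the anchor `ρ`. -/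
def dTgtUnit (x : M) : TangentSpace 𝓘(ℝ, E) (Γ.unit x) →ₗ[ℝ] TangentSpace 𝓘(ℝ, F) x :=
  fcast (TangentSpace 𝓘(ℝ, F)) (Γ.tgt_unit x) ∘ₗ Γ.dTgt (Γ.unit x)

/-- The anchor `ρ : A_x → T_x M`. -/
def anchor (x : M) : Γ.algebroid x →ₗ[ℝ] TangentSpace 𝓘(ℝ, F) x :=
  Γ.dTgtUnit x ∘ₗ (Γ.algebroid x).subtype

/-- The image of the anchor at `x`, i.e. the tangent space at `x` of the orbit through `x`. -/
def imAnchor (x : M) : Submodule ℝ (TangentSpace 𝓘(ℝ, F) x) := LinearMap.range (Γ.anchor x)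

/-- A Lie groupoid is regular if all its orbits have the same dimension, that is, if the anchor has
constant rank. -/
def IsRegular : Prop := ∃ d : ℕ, ∀ x, Module.finrank ℝ (Γ.imAnchor x) = d

/-- The isotropy Lie algebra `𝔦_x = Ker (ρ : A_x → T_x M)`, as a subspace of `T_{1_x} G`. -/
def isotropy (x : M) : Submodule ℝ (TangentSpace 𝓘(ℝ, E) (Γ.unit x)) :=
  Γ.algebroid x ⊓ LinearMap.ker (Γ.dTgtUnit x)

/-- The fibre `ν_x = T_x M / Im ρ` of the normal bundle to the orbits. -/
abbrev Normal (x : M) : Type _ := TangentSpace 𝓘(ℝ, F) x ⧸ Γ.imAnchor x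

/-- The differential of the division map `(p, q) ↦ p q⁻¹`, which is defined if `s(p) = s(q)`; it is
meaningful on pairs `(X, Y)` with `ds X = ds Y`. -/
def dDiv (p q : G) : (TangentSpace 𝓘(ℝ, E) p × TangentSpace 𝓘(ℝ, E) q) →ₗ[ℝ]
    TangentSpace 𝓘(ℝ, E) (Γ.mul p (Γ.inv q)) :=
  (mfderivWithin (𝓘(ℝ, E).prod 𝓘(ℝ, E)) 𝓘(ℝ, E) (fun z : G × G => Γ.mul z.1 (Γ.inv z.2))
    {z | Γ.src z.1 = Γ.src z.2} (p, q) :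
      (TangentSpace 𝓘(ℝ, E) p × TangentSpace 𝓘(ℝ, E) q) →L[ℝ] _).toLinearMap

theorem div_eq (g h : G) (hc : Γ.src g = Γ.tgt h) : Γ.mul (Γ.mul g h) (Γ.inv h) = g := by
  rw [Γ.mul_assoc g h (Γ.inv h) hc (Γ.tgt_inv h).symm, Γ.mul_inv, ← hc, Γ.mul_unit]

end Structure

section Submersion

variable {E F G M : Type*}
  [NormedAddCommGroup E] [NormedSpace ℝ E] [NormedAddCommGroup F] [NormedSpace ℝ F]
  [TopologicalSpace G] [ChartedSpace E G] [TopologicalSpace M] [ChartedSpace F M]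

/-- A submersion `f` in a chart: near `p` there are charts `φ`, `ψ` with `ψ ∘ f = fst ∘ e ∘ φ`. -/
theorem submersion_charts {f : G → M}
    (hf : Manifold.IsSubmersion 𝓘(ℝ, E) 𝓘(ℝ, F) ∞ f) (p : G) :
    ∃ (φ : OpenPartialHomeomorph G E) (ψ : OpenPartialHomeomorph M F) (L : E →L[ℝ] F),
      Function.Surjective L ∧ p ∈ φ.source ∧ (∀ q ∈ φ.source, f q ∈ ψ.source) ∧
      φ.MDifferentiable 𝓘(ℝ, E) 𝓘(ℝ, E) ∧ ψ.MDifferentiable 𝓘(ℝ, F) 𝓘(ℝ, F) ∧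
      ∀ q ∈ φ.source, ψ (f q) = L (φ q) := by
  obtain ⟨C, _, _, hC⟩ := hf
  have h := hC p
  refine ⟨h.domChart, h.codChart, (ContinuousLinearMap.fst ℝ F C).comp
    (h.equiv : E →L[ℝ] F × C), ?_, h.mem_domChart_source,
    fun q hq => h.source_subset_preimage_source hq, ?_, ?_, ?_⟩
  · intro y
    exact ⟨h.equiv.symm (y, 0), by simp⟩
  · exact ⟨(contMDiffOn_of_mem_maximalAtlas h.domChart_mem_maximalAtlas).mdifferentiableOn
      (by simp), (contMDiffOn_symm_of_mem_maximalAtlas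
        h.domChart_mem_maximalAtlas).mdifferentiableOn (by simp)⟩
  · exact ⟨(contMDiffOn_of_mem_maximalAtlas h.codChart_mem_maximalAtlas).mdifferentiableOn
      (by simp), (contMDiffOn_symm_of_mem_maximalAtlas
        h.codChart_mem_maximalAtlas).mdifferentiableOn (by simp)⟩
  · intro q hq
    have hm : h.domChart.extend 𝓘(ℝ, E) q ∈ (h.domChart.extend 𝓘(ℝ, E)).target :=
      (h.domChart.extend 𝓘(ℝ, E)).map_source (by rwa [OpenPartialHomeomorph.extend_source])
    have := h.writtenInCharts hm
    simpa [h.domChart.left_inv hq] using this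

theorem submersion_mfderiv {f : G → M}
    (hf : Manifold.IsSubmersion 𝓘(ℝ, E) 𝓘(ℝ, F) ∞ f) (p : G) :
    Function.Surjective (mfderiv 𝓘(ℝ, E) 𝓘(ℝ, F) f p) ∧
    ∀ X : TangentSpace 𝓘(ℝ, E) p, mfderiv 𝓘(ℝ, E) 𝓘(ℝ, F) f p X = 0 →
      ∃ (γ : ℝ → G) (h : γ 0 = p), (∀ r, f (γ r) = f p) ∧
        MDifferentiableAt 𝓘(ℝ, ℝ) 𝓘(ℝ, E) γ 0 ∧
        fcast (TangentSpace 𝓘(ℝ, E)) h (mfderiv 𝓘(ℝ, ℝ) 𝓘(ℝ, E) γ 0 (1 : ℝ)) = X := by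
  classical
  obtain ⟨φ, ψ, L, hL, hp, hfs, hφ, hψ, hfeq⟩ := submersion_charts hf p
  have hfd : MDifferentiableAt 𝓘(ℝ, E) 𝓘(ℝ, F) f p := hf.contMDiff.mdifferentiableAt (by simp)
  have hψd := hψ.mdifferentiableAt (hfs p hp)
  have hφd := hφ.mdifferentiableAt hp
  have hLd : MDifferentiableAt 𝓘(ℝ, E) 𝓘(ℝ, F) L (φ p) :=
    L.differentiableAt.mdifferentiableAt
  have key : ∀ X : TangentSpace 𝓘(ℝ, E) p,
      mfderiv 𝓘(ℝ, F) 𝓘(ℝ, F) ψ (f p) (mfderiv 𝓘(ℝ, E) 𝓘(ℝ, F) f p X) =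
        L (mfderiv 𝓘(ℝ, E) 𝓘(ℝ, E) φ p X) := by
    intro X
    have h1 := mfderiv_comp p hψd hfd
    have h2 := mfderiv_comp p hLd hφd
    have h3 : (ψ ∘ f) =ᶠ[𝓝 p] (L ∘ φ) := by
      filter_upwards [φ.open_source.mem_nhds hp] with q hq using hfeq q hq
    have h4 := h3.mfderiv_eq (I := 𝓘(ℝ, E)) (I' := 𝓘(ℝ, F))
    have h5 := congrArg (fun T => T X) (h1.symm.trans (h4.trans h2))
    simp only [mfderiv_eq_fderiv, ContinuousLinearMap.fderiv] at h5
    exact h5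
  refine ⟨?_, ?_⟩
  · intro v
    obtain ⟨y, hy⟩ := hL (mfderiv 𝓘(ℝ, F) 𝓘(ℝ, F) ψ (f p) v)
    obtain ⟨X, rfl⟩ := (hφ.mfderiv_bijective hp).2 y
    refine ⟨X, (hψ.mfderiv_injective (hfs p hp)) ?_⟩
    rw [key]; exact hy
  · intro X hX
    have hY : L (mfderiv 𝓘(ℝ, E) 𝓘(ℝ, E) φ p X) = 0 := by
      rw [← key, hX]; exact map_zero _
    set Y : E := mfderiv 𝓘(ℝ, E) 𝓘(ℝ, E) φ p X with hYdef
    let γ : ℝ → G := fun r => if φ p + r • Y ∈ φ.target then φ.symm (φ p + r • Y) else p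
    have hcont : Continuous fun r : ℝ => φ p + r • Y := by fun_prop
    have htar : ∀ᶠ r in 𝓝 (0 : ℝ), φ p + r • Y ∈ φ.target :=
      hcont.continuousAt.eventually_mem (φ.open_target.mem_nhds (by simpa using φ.map_source hp))
    have hev : γ =ᶠ[𝓝 0] fun r => φ.symm (φ p + r • Y) := by
      filter_upwards [htar] with r hr
      simp [γ, hr]
    have h0 : γ 0 = p := by simp [γ, φ.map_source hp, φ.left_inv hp]
    have hd0 : HasFDerivAt (fun r : ℝ => φ p + r • Y)
        ((ContinuousLinearMap.toSpanSingleton ℝ Y)) 0 := by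
      have := ((ContinuousLinearMap.toSpanSingleton ℝ Y).hasFDerivAt (x := (0:ℝ))).const_add (φ p)
      simpa using this
    have hz : φ p + (0 : ℝ) • Y = φ p := by simp
    have hφs : MDifferentiableAt 𝓘(ℝ, E) 𝓘(ℝ, E) φ.symm (φ p + (0 : ℝ) • Y) := by
      rw [hz]; exact hφ.mdifferentiableAt_symm (φ.map_source hp)
    have hcomp := (hφs.hasMFDerivAt).comp (0 : ℝ) hd0.hasMFDerivAt
    have hγ := hcomp.congr_of_eventuallyEq hev
    refine ⟨γ, h0, ?_, hγ.mdifferentiableAt, ?_⟩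
    · intro r
      by_cases hr : φ p + r • Y ∈ φ.target
      · simp only [γ, hr, if_true]
        have hs := φ.map_target hr
        apply ψ.injOn (hfs _ hs) (hfs _ hp)
        rw [hfeq _ hs, hfeq _ hp, φ.right_inv hr, map_add, map_smul, hY]
        simp
      · simp [γ, hr]
    · -- inject by `dφ`
      apply hφ.mfderiv_injective hp
      have hφd' : MDifferentiableAt 𝓘(ℝ, E) 𝓘(ℝ, E) φ (γ 0) := by rw [h0]; exact hφd
      have h1 := mfderiv_comp (0 : ℝ) hφd' hγ.mdifferentiableAt
      have h2 : (φ ∘ γ) =ᶠ[𝓝 0] fun r => φ p + r • Y := by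
        filter_upwards [htar] with r hr
        simp [γ, hr, φ.right_inv hr]
      have h3 := h2.mfderiv_eq (I := 𝓘(ℝ, ℝ)) (I' := 𝓘(ℝ, E))
      have h4 := congrArg (fun T => T (1 : ℝ)) (h1.symm.trans (h3.trans hd0.hasMFDerivAt.mfderiv))
      have h5 : (ContinuousLinearMap.toSpanSingleton ℝ Y) (1 : ℝ) = Y := by simp
      have h6 : ∀ {q : G} (hq : q = p) (W : TangentSpace 𝓘(ℝ, E) q),
          (mfderiv 𝓘(ℝ, E) 𝓘(ℝ, E) φ p (fcast (TangentSpace 𝓘(ℝ, E)) hq W) : E) =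
            mfderiv 𝓘(ℝ, E) 𝓘(ℝ, E) φ q W := by
        intro q hq W; subst hq; rfl
      refine (h6 h0 _).trans ?_
      exact h4.trans h5

end Submersion

/-! ### The normal representation -/

section Normal

variable {E F G M : Type*}
  [NormedAddCommGroup E] [NormedSpace ℝ E] [NormedAddCommGroup F] [NormedSpace ℝ F]
  [TopologicalSpace G] [ChartedSpace E G] [TopologicalSpace M] [ChartedSpace F M]
  (Γ : LieGroupoid E F G M)

theorem fcast_tangent {p q : G} (h : p = q) (X : TangentSpace 𝓘(ℝ, E) p) :
    (fcast (TangentSpace 𝓘(ℝ, E)) h X : E) = X := by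
  subst h; rfl

theorem mdifferentiableAt_src (g : G) : MDifferentiableAt 𝓘(ℝ, E) 𝓘(ℝ, F) Γ.src g :=
  Γ.src_submersion.contMDiff.mdifferentiableAt (by simp)

theorem mdifferentiableAt_tgt (g : G) : MDifferentiableAt 𝓘(ℝ, E) 𝓘(ℝ, F) Γ.tgt g :=
  Γ.tgt_submersion.contMDiff.mdifferentiableAt (by simp)

theorem dSrc_surjective (g : G) : Function.Surjective (Γ.dSrc g) :=
  (submersion_mfderiv Γ.src_submersion g).1

theorem mdifferentiableAt_mul {a b : ℝ → G} (hc : ∀ r, Γ.src (a r) = Γ.tgt (b r))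
    (ha : MDifferentiableAt 𝓘(ℝ, ℝ) 𝓘(ℝ, E) a 0) (hb : MDifferentiableAt 𝓘(ℝ, ℝ) 𝓘(ℝ, E) b 0) :
    MDifferentiableAt 𝓘(ℝ, ℝ) 𝓘(ℝ, E) (fun r => Γ.mul (a r) (b r)) 0 := by
  have h1 := (Γ.mul_smooth.mdifferentiableOn (by simp)) (a 0, b 0) (hc 0)
  have h2 : MDifferentiableAt 𝓘(ℝ, ℝ) (𝓘(ℝ, E).prod 𝓘(ℝ, E)) (fun r => (a r, b r)) 0 :=
    ha.prodMk hb
  have h3 := MDifferentiableWithinAt.comp (0 : ℝ) h1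
    (h2.mdifferentiableWithinAt (s := Set.univ))
    (show Set.univ ⊆ (fun r => (a r, b r)) ⁻¹' {p : G × G | Γ.src p.1 = Γ.tgt p.2} from
      fun r _ => hc r)
  exact mdifferentiableWithinAt_univ.1 h3

/-- Velocities and chain rule along a curve through a given point. -/
theorem velocity_chain {f : G → M} {p : G} {c : ℝ → G} (h0 : c 0 = p)
    (hf : MDifferentiableAt 𝓘(ℝ, E) 𝓘(ℝ, F) f p)
    (hc : MDifferentiableAt 𝓘(ℝ, ℝ) 𝓘(ℝ, E) c 0) :
    (mfderiv 𝓘(ℝ, E) 𝓘(ℝ, F) f p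
      (fcast (TangentSpace 𝓘(ℝ, E)) h0 (mfderiv 𝓘(ℝ, ℝ) 𝓘(ℝ, E) c 0 (1 : ℝ))) : F) =
      mfderiv 𝓘(ℝ, ℝ) 𝓘(ℝ, F) (f ∘ c) 0 (1 : ℝ) := by
  subst h0
  rw [mfderiv_comp (0 : ℝ) hf hc]
  rfl

theorem velocity_const {c : ℝ → M} {x : M} (h : ∀ r, c r = x) :
    (mfderiv 𝓘(ℝ, ℝ) 𝓘(ℝ, F) c 0 (1 : ℝ) : F) = 0 := by
  obtain rfl : c = fun _ => x := funext h
  rw [mfderiv_const]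
  rfl

theorem dTgt_mem_of_dSrc_eq_zero (g : G) (X : TangentSpace 𝓘(ℝ, E) g) (hX : Γ.dSrc g X = 0) :
    Γ.dTgt g X ∈ Γ.imAnchor (Γ.tgt g) := by
  obtain ⟨γ, h0, hγs, hγd, hγX⟩ := (submersion_mfderiv Γ.src_submersion g).2 X hX
  have hcomp : ∀ r, Γ.src (γ r) = Γ.tgt (Γ.inv g) := fun r => by rw [hγs, Γ.tgt_inv]
  have hd := Γ.mdifferentiableAt_mul hcomp hγd (mdifferentiableAt_const (c := Γ.inv g))
  set c : ℝ → G := fun r => Γ.mul (γ r) (Γ.inv g) with hc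
  have hc0 : c 0 = Γ.unit (Γ.tgt g) := by rw [hc]; simp only [h0, Γ.mul_inv]
  have hcs : ∀ r, (Γ.src ∘ c) r = Γ.tgt g := fun r => by
    simp only [hc, Function.comp, Γ.src_mul _ _ (hcomp r), Γ.src_inv]
  have hct : Γ.tgt ∘ c = Γ.tgt ∘ γ := by
    funext r; simp only [hc, Function.comp, Γ.tgt_mul _ _ (hcomp r)]
  refine ⟨⟨fcast (TangentSpace 𝓘(ℝ, E)) hc0 (mfderiv 𝓘(ℝ, ℝ) 𝓘(ℝ, E) c 0 (1 : ℝ)), ?_⟩, ?_⟩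
  · exact (velocity_chain hc0 (Γ.mdifferentiableAt_src _) hd).trans (velocity_const hcs)
  · have h1 := velocity_chain hc0 (Γ.mdifferentiableAt_tgt _) hd
    have h2 := velocity_chain h0 (Γ.mdifferentiableAt_tgt _) hγd
    rw [hct] at h1
    rw [hγX] at h2
    refine (fcast_tangent (E := F) (Γ.tgt_unit _) _).trans ?_
    exact h1.trans h2.symm

/-- If `ds X` is tangent to the orbit, so is `dt X`. -/
theorem dTgt_mem_of_dSrc_mem (g : G) (X : TangentSpace 𝓘(ℝ, E) g)
    (hX : Γ.dSrc g X ∈ Γ.imAnchor (Γ.src g)) : Γ.dTgt g X ∈ Γ.imAnchor (Γ.tgt g) := by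
  obtain ⟨⟨a, ha⟩, haX⟩ := hX
  obtain ⟨η, h0, hηs, hηd, hηa⟩ :=
    (submersion_mfderiv Γ.src_submersion (Γ.unit (Γ.src g))).2 a ha
  rw [Γ.src_unit] at hηs
  have hinv : MDifferentiableAt 𝓘(ℝ, ℝ) 𝓘(ℝ, E) (Γ.inv ∘ η) 0 :=
    (Γ.inv_smooth.mdifferentiableAt (by simp)).comp (0 : ℝ) hηd
  have hcomp : ∀ r, Γ.src g = Γ.tgt ((Γ.inv ∘ η) r) := fun r => by
    simp only [Function.comp, Γ.tgt_inv, hηs]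
  have hd := Γ.mdifferentiableAt_mul hcomp (mdifferentiableAt_const (c := g)) hinv
  set c : ℝ → G := fun r => Γ.mul g ((Γ.inv ∘ η) r) with hc
  have hc0 : c 0 = g := by
    simp only [hc, Function.comp, h0, Γ.inv_unit, Γ.mul_unit]
  have hct : ∀ r, (Γ.tgt ∘ c) r = Γ.tgt g := fun r =>
    Γ.tgt_mul _ _ (hcomp r)
  have hcs : Γ.src ∘ c = Γ.tgt ∘ η := by
    funext r
    exact (Γ.src_mul _ _ (hcomp r)).trans (Γ.src_inv _)
  set Y : TangentSpace 𝓘(ℝ, E) g :=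
    fcast (TangentSpace 𝓘(ℝ, E)) hc0 (mfderiv 𝓘(ℝ, ℝ) 𝓘(ℝ, E) c 0 (1 : ℝ)) with hY
  have hYt : Γ.dTgt g Y = 0 :=
    (velocity_chain hc0 (Γ.mdifferentiableAt_tgt _) hd).trans (velocity_const hct)
  have hYs : Γ.dSrc g Y = Γ.dSrc g X := by
    have h1 := velocity_chain hc0 (Γ.mdifferentiableAt_src _) hd
    have h2 := velocity_chain h0 (Γ.mdifferentiableAt_tgt _) hηd
    rw [hcs] at h1
    rw [hηa] at h2
    rw [← haX]
    refine Eq.trans ?_ (fcast_tangent (E := F) (Γ.tgt_unit _) _).symm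
    exact h1.trans h2.symm
  have h := Γ.dTgt_mem_of_dSrc_eq_zero g (X - Y) (by rw [map_sub, hYs, sub_self])
  rwa [map_sub, hYt, sub_zero] at h

/-- The action `ν_{s(g)} → ν_{t(g)}` of an arrow `g`: it sends the class of `ds X` to the class of
`dt X`, for `X ∈ T_g G`; see `normalAct_mk`. -/
def normalAct (g : G) : Γ.Normal (Γ.src g) →ₗ[ℝ] Γ.Normal (Γ.tgt g) :=
  let τ := (LinearMap.exists_rightInverse_of_surjective (Γ.dSrc g)
    (LinearMap.range_eq_top.2 (Γ.dSrc_surjective g))).choose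
  have hτ : Γ.dSrc g ∘ₗ τ = LinearMap.id := (LinearMap.exists_rightInverse_of_surjective (Γ.dSrc g)
    (LinearMap.range_eq_top.2 (Γ.dSrc_surjective g))).choose_spec
  Submodule.mapQ _ _ (Γ.dTgt g ∘ₗ τ) fun v hv => by
    refine Γ.dTgt_mem_of_dSrc_mem g (τ v) ?_
    have : Γ.dSrc g (τ v) = v := LinearMap.congr_fun hτ v
    rwa [this]

theorem normalAct_mk (g : G) (X : TangentSpace 𝓘(ℝ, E) g) :
    Γ.normalAct g (Submodule.Quotient.mk (Γ.dSrc g X)) = Submodule.Quotient.mk (Γ.dTgt g X) := by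
  have hτ := (LinearMap.exists_rightInverse_of_surjective (Γ.dSrc g)
    (LinearMap.range_eq_top.2 (Γ.dSrc_surjective g))).choose_spec
  refine (Submodule.Quotient.eq _).2 ?_
  set τ := (LinearMap.exists_rightInverse_of_surjective (Γ.dSrc g)
    (LinearMap.range_eq_top.2 (Γ.dSrc_surjective g))).choose
  have h1 : Γ.dSrc g (τ (Γ.dSrc g X)) = Γ.dSrc g X := LinearMap.congr_fun hτ _
  have := Γ.dTgt_mem_of_dSrc_eq_zero g (τ (Γ.dSrc g X) - X) (by rw [map_sub, h1, sub_self])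
  rwa [map_sub] at this

end Normal

/-! ### Smoothness of cochains -/

section Smooth

variable {E F G M : Type*}
  [NormedAddCommGroup E] [NormedSpace ℝ E] [NormedAddCommGroup F] [NormedSpace ℝ F]
  [TopologicalSpace G] [ChartedSpace E G] [TopologicalSpace M] [ChartedSpace F M]

theorem smooth_zero_along [IsManifold 𝓘(ℝ, E) ∞ G] {n : ℕ} {U : Set (EuclideanSpace ℝ (Fin n))}
    {b : EuclideanSpace ℝ (Fin n) → G} (hb : ContMDiffOn (𝓡 n) 𝓘(ℝ, E) ∞ b U) :
    ContMDiffOn (𝓡 n) 𝓘(ℝ, E).tangent ∞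
      (fun z => (⟨b z, 0⟩ : TangentBundle 𝓘(ℝ, E) G)) U :=
  have h : ContMDiff 𝓘(ℝ, E) 𝓘(ℝ, E).tangent ∞
      (fun x => (⟨x, 0⟩ : TangentBundle 𝓘(ℝ, E) G)) :=
    Bundle.contMDiff_zeroSection ℝ (TangentSpace 𝓘(ℝ, E) : G → Type _)
  h.comp_contMDiffOn hb

theorem smooth_linear_along [IsManifold 𝓘(ℝ, E) ∞ G] {n : ℕ}
    {U : Set (EuclideanSpace ℝ (Fin n))} {b : EuclideanSpace ℝ (Fin n) → G}
    {X Y : ∀ z, TangentSpace 𝓘(ℝ, E) (b z)} (a : ℝ)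
    (hX : ContMDiffOn (𝓡 n) 𝓘(ℝ, E).tangent ∞
      (fun z => (⟨b z, X z⟩ : TangentBundle 𝓘(ℝ, E) G)) U)
    (hY : ContMDiffOn (𝓡 n) 𝓘(ℝ, E).tangent ∞
      (fun z => (⟨b z, Y z⟩ : TangentBundle 𝓘(ℝ, E) G)) U) :
    ContMDiffOn (𝓡 n) 𝓘(ℝ, E).tangent ∞
      (fun z => (⟨b z, a • X z + Y z⟩ : TangentBundle 𝓘(ℝ, E) G)) U := by
  intro z hz
  have h1 := Bundle.contMDiffWithinAt_totalSpace.1 (hX z hz)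
  have h2 := Bundle.contMDiffWithinAt_totalSpace.1 (hY z hz)
  refine Bundle.contMDiffWithinAt_totalSpace.2 ⟨h1.1, ?_⟩
  have h3 := (contMDiffWithinAt_const (I := 𝓡 n) (I' := 𝓘(ℝ, ℝ)) (n := ∞) (s := U) (x := z)
    (c := a)).smul h1.2
  have hmem : b ⁻¹' (trivializationAt E (TangentSpace 𝓘(ℝ, E)) (b z)).baseSet ∈ 𝓝[U] z :=
    h1.1.continuousWithinAt.preimage_mem_nhdsWithin
      ((trivializationAt E (TangentSpace 𝓘(ℝ, E)) (b z)).open_baseSet.mem_nhds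
        (FiberBundle.mem_baseSet_trivializationAt' _))
  have hlin : ∀ w, b w ∈ (trivializationAt E (TangentSpace 𝓘(ℝ, E)) (b z)).baseSet →
      (trivializationAt E (TangentSpace 𝓘(ℝ, E)) (b z) ⟨b w, a • X w + Y w⟩).2 =
      a • (trivializationAt E (TangentSpace 𝓘(ℝ, E)) (b z) ⟨b w, X w⟩).2 +
        (trivializationAt E (TangentSpace 𝓘(ℝ, E)) (b z) ⟨b w, Y w⟩).2 := by
    intro w hw
    have hl := (trivializationAt E (TangentSpace 𝓘(ℝ, E)) (b z)).linear ℝ hw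
    rw [hl.map_add, hl.map_smul]
  refine (h3.add h2.2).congr_of_eventuallyEq ?_ ?_
  · filter_upwards [hmem] with w hw using hlin w hw
  · exact hlin z (FiberBundle.mem_baseSet_trivializationAt' _)

variable [IsManifold 𝓘(ℝ, E) ∞ G] [IsManifold 𝓘(ℝ, F) ∞ M] (Γ : LieGroupoid E F G M)

/-- A map on `G^(k)` with values in `T_{b(g)} G` is smooth, as a map from the manifold `G^(k)` to
`T G`; as usual, this is tested by composing with all smooth maps `ℝⁿ → G^(k)`. -/
def SmoothTG {k : ℕ} (b : Γ.Str k → G) (c : ∀ g, TangentSpace 𝓘(ℝ, E) (b g)) : Prop :=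
  ∀ (n : ℕ) (γ : EuclideanSpace ℝ (Fin n) → Γ.Str k), Str.IsPlot γ →
    ContMDiff (𝓡 n) 𝓘(ℝ, E).tangent ∞
      (fun z => (⟨b (γ z), c (γ z)⟩ : TangentBundle 𝓘(ℝ, E) G))

/-- A map `u` on `G^(k)` with values `u(g₁, …, g_k) ∈ ν_{t(g₁)}` is smooth: locally it is the class
of a smooth map with values in `T M`; again this is tested on all smooth maps `ℝⁿ → G^(k)`. -/
def SmoothNormal {k : ℕ} (u : ∀ g : Γ.Str k, Γ.Normal (g.obj 0)) : Prop :=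
  ∀ (n : ℕ) (γ : EuclideanSpace ℝ (Fin n) → Γ.Str k), Str.IsPlot γ → ∀ z₀,
    ∃ (U : Set (EuclideanSpace ℝ (Fin n))) (V : ∀ z, TangentSpace 𝓘(ℝ, F) ((γ z).obj 0)),
      IsOpen U ∧ z₀ ∈ U ∧
      ContMDiffOn (𝓡 n) 𝓘(ℝ, F).tangent ∞
        (fun z => (⟨(γ z).obj 0, V z⟩ : TangentBundle 𝓘(ℝ, F) M)) U ∧
      ∀ z ∈ U, u (γ z) = Submodule.Quotient.mk (V z)

variable {Γ}

theorem SmoothTG.zero {k : ℕ} {b : Γ.Str k → G}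
    (hb : ∀ (n : ℕ) (γ : EuclideanSpace ℝ (Fin n) → Γ.Str k), Str.IsPlot γ →
      ContMDiff (𝓡 n) 𝓘(ℝ, E) ∞ fun z => b (γ z)) : Γ.SmoothTG b 0 := fun n γ hγ =>
  contMDiffOn_univ.1 (smooth_zero_along (hb n γ hγ).contMDiffOn)

theorem SmoothTG.lin {k : ℕ} {b : Γ.Str k → G}
    {c c' : ∀ g, TangentSpace 𝓘(ℝ, E) (b g)} (a : ℝ) (h : Γ.SmoothTG b c)
    (h' : Γ.SmoothTG b c') : Γ.SmoothTG b (a • c + c') := fun n γ hγ =>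
  contMDiffOn_univ.1 (smooth_linear_along a (h n γ hγ).contMDiffOn (h' n γ hγ).contMDiffOn)

theorem SmoothNormal.zero {k : ℕ} :
    Γ.SmoothNormal (0 : ∀ g : Γ.Str k, Γ.Normal (g.obj 0)) := fun _ _ hγ _ =>
  ⟨Set.univ, fun _ => 0, isOpen_univ, Set.mem_univ _, smooth_zero_along (hγ.1 0).contMDiffOn,
    fun _ _ => rfl⟩

theorem SmoothNormal.lin {k : ℕ}
    {u u' : ∀ g : Γ.Str k, Γ.Normal (g.obj 0)} (a : ℝ) (h : Γ.SmoothNormal u)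
    (h' : Γ.SmoothNormal u') : Γ.SmoothNormal (a • u + u') := by
  intro n γ hγ z₀
  obtain ⟨U, V, hU, hz, hV, huV⟩ := h n γ hγ z₀
  obtain ⟨U', V', hU', hz', hV', huV'⟩ := h' n γ hγ z₀
  refine ⟨U ∩ U', fun z => a • V z + V' z, hU.inter hU', ⟨hz, hz'⟩,
    smooth_linear_along a (hV.mono Set.inter_subset_left) (hV'.mono Set.inter_subset_right), ?_⟩
  intro z hzU
  change a • u (γ z) + u' (γ z) = _
  rw [huV z hzU.1, huV' z hzU.2]
  rfl

end Smooth

/-- The subspace of the elements satisfying a linear condition. -/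
def submoduleOfLin {X : Type*} [AddCommGroup X] [Module ℝ X] (P : X → Prop) (h0 : P 0)
    (hlin : ∀ (a : ℝ) (x y : X), P x → P y → P (a • x + y)) : Submodule ℝ X where
  carrier := {x | P x}
  zero_mem' := h0
  add_mem' {x y} hx hy := by simpa using hlin 1 x y hx hy
  smul_mem' a x hx := by simpa using hlin a x 0 hx h0

/-! ### Differentiable cohomology with coefficients in the isotropy and normal representations -/

section Complexes

variable {E F G M : Type*}
  [NormedAddCommGroup E] [NormedSpace ℝ E] [NormedAddCommGroup F] [NormedSpace ℝ F]
  [TopologicalSpace G] [ChartedSpace E G] [TopologicalSpace M] [ChartedSpace F M]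
  (Γ : LieGroupoid E F G M)

/-- The differential of differentiable cohomology with coefficients in a family `V` of vector
spaces over `M` on which the arrows act, on (set-theoretic) cochains:
`(δu)(g₁, …, g_{k+1}) = g₁ · u(g₂, …, g_{k+1}) + ∑_{i=1}^{k} (-1)^i u(g₁, …, g_i g_{i+1}, …, g_{k+1})
  + (-1)^{k+1} u(g₁, …, g_k)`; below, `i = j + 1`. -/
def diffDelta (V : M → Type*) [∀ x, AddCommGroup (V x)] [∀ x, Module ℝ (V x)]
    (act : ∀ g, V (Γ.src g) →ₗ[ℝ] V (Γ.tgt g)) (k : ℕ) :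
    (∀ g : Γ.Str k, V (g.obj 0)) →ₗ[ℝ] (∀ g : Γ.Str (k + 1), V (g.obj 0)) where
  toFun u g :=
    fcast V g.tgt_arr_zero (act (g.arr 0) (fcast V g.obj_zero_tail (u g.tail)))
      + ∑ j : Fin k, (-1 : ℝ) ^ (j.1 + 1) • fcast V (g.obj_zero_comp j) (u (g.comp j))
      + (-1 : ℝ) ^ (k + 1) • fcast V g.obj_zero_init (u g.init)
  map_add' u v := by
    funext g
    simp only [Pi.add_apply, map_add, smul_add, Finset.sum_add_distrib]
    abel
  map_smul' a u := by
    funext g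
    simp only [Pi.smul_apply, map_smul, smul_add, Finset.smul_sum, RingHom.id_apply]
    simp only [smul_comm a]

/-- The isotropy action `r_{g⁻¹} ∘ l_g` of `g` (it maps `𝔦_{s(g)}` to `𝔦_{t(g)}`, and it is only
used there). -/
def isotropyAct (g : G) : TangentSpace 𝓘(ℝ, E) (Γ.unit (Γ.src g)) →ₗ[ℝ]
    TangentSpace 𝓘(ℝ, E) (Γ.unit (Γ.tgt g)) :=
  fcast (TangentSpace 𝓘(ℝ, E)) (Γ.mul_inv g) ∘ₗ Γ.dRight g (Γ.inv g) ∘ₗ Γ.lUnit g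

variable [IsManifold 𝓘(ℝ, E) ∞ G] [IsManifold 𝓘(ℝ, F) ∞ M]

/-- The complex `C^*(G, 𝔦)`: smooth maps `(g₁, …, g_k) ↦ u(g₁, …, g_k) ∈ 𝔦_{t(g₁)}`. -/
def isotropyComplex : CochainData where
  X k := ∀ g : Γ.Str k, TangentSpace 𝓘(ℝ, E) (Γ.unit (g.obj 0))
  C _ := submoduleOfLin
    (fun u => Γ.SmoothTG (fun g => Γ.unit (g.obj 0)) u ∧ ∀ g, u g ∈ Γ.isotropy (g.obj 0))
    ⟨SmoothTG.zero fun _ _ hγ => Γ.unit_smooth.comp (hγ.1 0), fun _ => Submodule.zero_mem _⟩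
    fun a _ _ h h' => ⟨SmoothTG.lin a h.1 h'.1, fun g =>
      Submodule.add_mem _ (Submodule.smul_mem _ a (h.2 g)) (h'.2 g)⟩
  d k := Γ.diffDelta (fun x => TangentSpace 𝓘(ℝ, E) (Γ.unit x)) Γ.isotropyAct k

/-- The complex `C^*(G, ν)`: smooth maps `(g₁, …, g_k) ↦ u(g₁, …, g_k) ∈ ν_{t(g₁)}`. -/
def normalComplex : CochainData where
  X k := ∀ g : Γ.Str k, Γ.Normal (g.obj 0)
  C _ := submoduleOfLin Γ.SmoothNormal SmoothNormal.zero fun a _ _ h h' => SmoothNormal.lin a h h'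
  d k := Γ.diffDelta Γ.Normal Γ.normalAct k

/-! ### The deformation complex -/

/-- `σ` is the `s`-projection of the cochain `c`:
`ds (c(g₁, g₂, …, g_{k+1})) = σ(g₂, …, g_{k+1})`. -/
def IsSProjection {k : ℕ} (c : ∀ g : Γ.Str (k + 1), TangentSpace 𝓘(ℝ, E) g.head)
    (σ : ∀ g : Γ.Str k, TangentSpace 𝓘(ℝ, F) (g.obj 0)) : Prop :=
  ∀ g : Γ.Str (k + 1),
    Γ.dSrc (g.arr 0) (fcast (TangentSpace 𝓘(ℝ, E)) g.head_succ (c g)) =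
      fcast (TangentSpace 𝓘(ℝ, F)) g.obj_zero_tail (σ g.tail)

/-- The condition on `ds ∘ c` for a deformation cochain `c`: for `k ≥ 1`, `c` is `s`-projectable,
and for `k = 0`, `c` takes values in `A = Ker (ds)`. -/
def SProjectable : ∀ {k : ℕ}, (∀ g : Γ.Str k, TangentSpace 𝓘(ℝ, E) g.head) → Prop
  | 0, c => ∀ g : Γ.Str 0,
      fcast (TangentSpace 𝓘(ℝ, E)) g.head_zero (c g) ∈ Γ.algebroid (g.obj 0)
  | _ + 1, c => ∃ σ, Γ.IsSProjection c σ

theorem SProjectable.zero : ∀ {k : ℕ},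
    Γ.SProjectable (0 : ∀ g : Γ.Str k, TangentSpace 𝓘(ℝ, E) g.head)
  | 0 => fun _ => by simp only [Pi.zero_apply, map_zero, Submodule.zero_mem]
  | _ + 1 => ⟨0, fun _ => by simp only [Pi.zero_apply, map_zero]⟩

theorem SProjectable.lin (a : ℝ) : ∀ {k : ℕ}
    (c c' : ∀ g : Γ.Str k, TangentSpace 𝓘(ℝ, E) g.head), Γ.SProjectable c → Γ.SProjectable c' →
    Γ.SProjectable (a • c + c')
  | 0, _, _, h, h' => fun g => by
      simp only [Pi.add_apply, Pi.smul_apply, map_add, map_smul]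
      exact Submodule.add_mem _ (Submodule.smul_mem _ a (h g)) (h' g)
  | _ + 1, c, c', ⟨σ, h⟩, ⟨σ', h'⟩ => ⟨a • σ + σ', fun g => by
      simp only [Pi.add_apply, Pi.smul_apply, map_add, map_smul, h g, h' g]⟩

/-- The differential of `α ∈ Γ(A)`: `(δα)(g) = r_g α_{t(g)} + l_g (di (α_{s(g)}))`. -/
def defDeltaZero : (∀ g : Γ.Str 0, TangentSpace 𝓘(ℝ, E) g.head) →ₗ[ℝ]
    (∀ g : Γ.Str 1, TangentSpace 𝓘(ℝ, E) g.head) where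
  toFun α g := fcast (TangentSpace 𝓘(ℝ, E)) g.head_succ.symm
    (Γ.rUnit (g.arr 0) (fcast (TangentSpace 𝓘(ℝ, E)) (g.head_init_one) (α g.init)) +
      Γ.lUnit (g.arr 0) (Γ.dInvUnit (Γ.src (g.arr 0))
        (fcast (TangentSpace 𝓘(ℝ, E)) (g.head_tail_one) (α g.tail))))
  map_add' α β := by
    funext g
    simp only [Pi.add_apply, map_add]
    abel
  map_smul' a α := by
    funext g
    simp only [Pi.smul_apply, map_add, map_smul, RingHom.id_apply, smul_add]

/-- The differential in degree `k + 1 ≥ 1`: with `dm̄` the differential of `(p, q) ↦ p q⁻¹`,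
`(δc)(g₁, …, g_{k+2}) = - dm̄ (c(g₁g₂, g₃, …, g_{k+2}), c(g₂, …, g_{k+2}))
  + ∑_{i=2}^{k+1} (-1)^i c(g₁, …, g_i g_{i+1}, …, g_{k+2}) + (-1)^{k+2} c(g₁, …, g_{k+1})`;
below, `i = j + 2`. -/
def defDeltaSucc (k : ℕ) : (∀ g : Γ.Str (k + 1), TangentSpace 𝓘(ℝ, E) g.head) →ₗ[ℝ]
    (∀ g : Γ.Str (k + 2), TangentSpace 𝓘(ℝ, E) g.head) where
  toFun c g := fcast (TangentSpace 𝓘(ℝ, E)) g.head_succ.symm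
    (-fcast (TangentSpace 𝓘(ℝ, E)) (Γ.div_eq (g.arr 0) (g.arr 1) (g.composable 0))
        (Γ.dDiv (Γ.mul (g.arr 0) (g.arr 1)) (g.arr 1)
          (fcast (TangentSpace 𝓘(ℝ, E)) g.head_comp_zero (c (g.comp 0)),
            fcast (TangentSpace 𝓘(ℝ, E)) g.head_tail (c g.tail)))
      + ∑ j : Fin k, (-1 : ℝ) ^ (j.1 + 2) •
          fcast (TangentSpace 𝓘(ℝ, E)) (g.head_comp_succ j) (c (g.comp j.succ))
      + (-1 : ℝ) ^ (k + 2) • fcast (TangentSpace 𝓘(ℝ, E)) g.head_init (c g.init))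
  map_add' c c' := by
    funext g
    simp only [Pi.add_apply, map_add, smul_add, Finset.sum_add_distrib, ← Prod.mk_add_mk]
    simp only [map_add, map_neg]
    abel
  map_smul' a c := by
    funext g
    simp only [Pi.smul_apply, map_smul, ← Prod.smul_mk, RingHom.id_apply]
    simp only [map_add, map_smul, map_neg, map_sum, smul_add, smul_neg, Finset.smul_sum]
    simp only [smul_comm a]

/-- The deformation complex `C^*_def(G)`. In degree `k ≥ 1` its cochains are the smooth maps
`(g₁, …, g_k) ↦ c(g₁, …, g_k) ∈ T_{g₁} G` which are `s`-projectable; in degree `0` they are the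
smooth sections of `A`. -/
def defComplex : CochainData where
  X k := ∀ g : Γ.Str k, TangentSpace 𝓘(ℝ, E) g.head
  C _ := submoduleOfLin (fun c => Γ.SmoothTG Str.head c ∧ Γ.SProjectable c)
    ⟨SmoothTG.zero fun _ _ hγ => hγ.head, SProjectable.zero Γ⟩
    fun a c c' h h' => ⟨SmoothTG.lin a h.1 h'.1, SProjectable.lin Γ a c c' h.2 h'.2⟩
  d
    | 0 => Γ.defDeltaZero
    | k + 1 => Γ.defDeltaSucc k

/-! ### The maps in the long exact sequence, on cochains -/

/-- The inclusion `u ↦ c_u` of isotropy-valued cochains into deformation cochains,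
`c_u(g₁, …, g_k) = r_{g₁} (u(g₁, …, g_k))`; for `k = 0`, it is `Γ(𝔦) ⊆ Γ(A)`. -/
def inclusion : ∀ {k : ℕ}, (∀ g : Γ.Str k, TangentSpace 𝓘(ℝ, E) (Γ.unit (g.obj 0))) →
    ∀ g : Γ.Str k, TangentSpace 𝓘(ℝ, E) g.head
  | 0, u => fun g => fcast (TangentSpace 𝓘(ℝ, E)) g.head_zero.symm (u g)
  | _ + 1, u => fun g => fcast (TangentSpace 𝓘(ℝ, E)) g.head_succ.symm (Γ.rUnit (g.arr 0)
      (fcast (fun x => TangentSpace 𝓘(ℝ, E) (Γ.unit x)) g.tgt_arr_zero.symm (u g)))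

/-- The class modulo `Im ρ` of a cochain with values in `T M`. -/
def normalClass {k : ℕ} (σ : ∀ g : Γ.Str k, TangentSpace 𝓘(ℝ, F) (g.obj 0)) :
    ∀ g : Γ.Str k, Γ.Normal (g.obj 0) :=
  fun g => Submodule.Quotient.mk (σ g)

end Complexes

end LieGroupoid

end

noncomputable section

/-! ### Homological algebra of the triple isotropy, deformation, normal -/

namespace CochainData

section Classes

variable {K : CochainData}

/-! Write I, D, N for the isotropy, deformation and normal complexes. The map c ↦ [s_c] anticommutes
with the differentials and maps D onto N shifted by one degree. Its kernel contains I, and modulo I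
this kernel is acyclic, so its cohomology is that of I and the sequence is the long exact sequence
of the kernel, D and N. The quotient complex is never formed.
`CochainData.exists_long_exact_sequence` needs only two facts about cochains c with δc in I: every
cocycle of N is the projection of such a c (`exists_lift_isotropic`), and such a c with zero
projection is a coboundary plus an element of I (`exists_sub_d_eq_inclusion`).

Both facts come from two formulas. Let σ = s_c, and let ∂ be the alternating sum over all faces of a
string except the tail, so that ∂∂ = 0. Then ds(δc) is minus the value of dt c + ∂σ on the tail
(`ts_defDeltaSucc`), and dt(δc) = ∂(dt c) (`tt_defDeltaSucc`). A cochain lies in I exactly when ds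
and dt kill it. Hence δc in I forces dt c = -∂σ, and modulo I such a c is determined by σ. If σ has
values in Im ρ, lift it along the anchor and right-translate, with the sign suited to the degree, to
get e such that δe has s-projection σ and dt(δe) = -∂σ. Then c - δe lies in I. If only [σ] is a
cocycle, take any c₀ with s-projection σ. The defect dt c₀ + ∂σ lies in Im ρ, and subtracting the
right translate of its lift along the anchor gives c with dt c = -∂σ, so δc is killed by ds and dt.

To stay within smooth cochains one needs a smooth right inverse of ds and a smooth family of maps TM
→ A inverting ρ on Im ρ. Both are built locally and glued by a partition of unity, the conditions
being convex in each fibre. Regularity enters only in the second: the rank of ρ cannot jump, so a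
frame of Im ρ at one point extends to a frame of Im ρ nearby.

The identities between differentials of structure maps are those of the tangent groupoid. Composable
tangent vectors are velocities of curves composable for all small times, because s is a submersion,
and an identity in the groupoid is differentiated along such curves. For the deformation complex δδ
= 0 is a simplicial identity in degrees ≥ 1 and multiplicativity of δα in degree 0. The other two
complexes inherit it, one by injectivity of the inclusion and one by surjectivity of the projection.
-/

theorem cls_eq_cls {k : ℕ} {z z' : K.X k} {hz : z ∈ K.Z k} {hz' : z' ∈ K.Z k} :
    K.cls z hz = K.cls z' hz' ↔ z - z' ∈ K.B k := by
  unfold cls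
  rw [Submodule.Quotient.eq]
  rfl

theorem cls_eq_zero {k : ℕ} {z : K.X k} {hz : z ∈ K.Z k} : K.cls z hz = 0 ↔ z ∈ K.B k := by
  unfold cls
  rw [Submodule.Quotient.mk_eq_zero]
  rfl

theorem exists_cls {k : ℕ} (a : K.H k) : ∃ z, ∃ hz : z ∈ K.Z k, a = K.cls z hz := by
  obtain ⟨⟨z, hz⟩, rfl⟩ := Submodule.Quotient.mk_surjective _ a
  exact ⟨z, hz, rfl⟩

/-- A linear map between cohomology spaces given by a well defined additive and homogeneous
relation between cocycles. -/
theorem exists_linearMap_of_rel {K K' : CochainData} {k l : ℕ} (R : K.X k → K'.X l → Prop)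
    (hex : ∀ z ∈ K.Z k, ∃ z', R z z') (hZ : ∀ z ∈ K.Z k, ∀ z', R z z' → z' ∈ K'.Z l)
    (hlin : ∀ (a : ℝ) x x' y y', R x x' → R y y' → R (a • x + y) (a • x' + y'))
    (hB : ∀ z ∈ K.B k, ∀ z', R z z' → z' ∈ K'.B l) :
    ∃ f : K.H k →ₗ[ℝ] K'.H l, ∀ z (hz : z ∈ K.Z k) z' (hz' : R z z'),
      f (K.cls z hz) = K'.cls z' (hZ z hz z' hz') := by
  choose! φ hφ using hex
  have key : ∀ z (hz : z ∈ K.Z k) z' (hz' : R z z'),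
      K'.cls (φ z) (hZ z hz _ (hφ z hz)) = K'.cls z' (hZ z hz z' hz') := by
    intro z hz z' hz'
    rw [cls_eq_cls]
    -- Two elements related to the same z differ by an element related to 0. As 0 is a coboundary,
    -- so is the difference, and the chosen value does not matter.
    have h := hlin (-1) _ _ _ _ hz' (hφ z hz)
    have h0 : (-1 : ℝ) • z + z = 0 := by simp
    have := hB _ (h0 ▸ Submodule.zero_mem _) _ h
    simpa [sub_eq_neg_add] using this
  have R0 : R 0 0 := by
    have h := hlin (-1) _ _ _ _ (hφ 0 (Submodule.zero_mem _)) (hφ 0 (Submodule.zero_mem _))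
    simpa using h
  let g : K.Z k →ₗ[ℝ] K'.H l :=
    { toFun := fun z => K'.cls (φ z.1) (hZ z.1 z.2 _ (hφ z.1 z.2))
      map_add' := fun x y => by
        have h := hlin 1 _ _ _ _ (hφ x.1 x.2) (hφ y.1 y.2)
        rw [one_smul, one_smul] at h
        exact key _ (x + y).2 _ h
      map_smul' := fun a x => by
        have h := hlin a _ _ _ _ (hφ x.1 x.2) R0
        rw [add_zero, add_zero] at h
        exact key _ (a • x).2 _ h }
  refine ⟨Submodule.liftQ _ g ?_, ?_⟩
  · intro z hz
    exact cls_eq_zero.2 (hB _ hz _ (hφ z.1 z.2))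
  · intro z hz z' hz'
    exact key z hz z' hz'

end Classes

/-- Up to sign ι (d d u) is d d (ι u) = 0, and ι is injective on cochains. This avoids checking that
the isotropy action is multiplicative. The signs ε are there because the inclusion commutes with the
differentials only up to sign in degree 0. -/
theorem isComplex_of_injective {I D : CochainData} (hD : D.IsComplex)
    (ι : ∀ k, I.X k →ₗ[ℝ] D.X k) (ε : ℕ → ℝ) (hι : ∀ k, Set.InjOn (ι k) (I.C k : Set (I.X k)))
    (hε : ∀ k, ε k * ε k = 1) (hιC : ∀ k, ∀ u ∈ I.C k, ι k u ∈ D.C k)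
    (hIC : ∀ k, ∀ u ∈ I.C k, I.d k u ∈ I.C (k + 1))
    (hd : ∀ k, ∀ u ∈ I.C k, D.d k (ι k u) = ε k • ι (k + 1) (I.d k u)) : I.IsComplex := by
  refine fun k u hu => ⟨hIC k u hu,
    hι (k + 2) (hIC _ _ (hIC k u hu)) (Submodule.zero_mem _) ?_⟩
  have h1 := hd (k + 1) _ (hIC k u hu)
  have h2 : ι (k + 1) (I.d k u) = ε k • D.d k (ι k u) := by
    rw [hd k u hu, smul_smul, hε, one_smul]
  rw [h2, map_smul, (hD k _ (hιC k u hu)).2, smul_zero] at h1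
  have h3 := congrArg (ε (k + 1) • ·) h1
  simpa [smul_smul, hε] using h3.symm

/-- Every cochain is some p c, and d d (p c) = p (d d c) since the two signs cancel. -/
theorem isComplex_of_surjective {D N : CochainData} (hD : D.IsComplex)
    (p : ∀ k, D.X (k + 1) →ₗ[ℝ] N.X k)
    (hpC : ∀ k, ∀ c ∈ D.C (k + 1), p k c ∈ N.C k)
    (hpd : ∀ k, ∀ c ∈ D.C (k + 1), p (k + 1) (D.d (k + 1) c) = -N.d k (p k c))
    (hsurj : ∀ k, ∀ v ∈ N.C k, ∃ c ∈ D.C (k + 1), p k c = v) : N.IsComplex := by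
  intro k v hv
  obtain ⟨c, hc, rfl⟩ := hsurj k v hv
  have h1 : N.d k (p k c) = -p (k + 1) (D.d (k + 1) c) := by rw [hpd k c hc, neg_neg]
  have h2 := hD (k + 1) c hc
  refine ⟨by rw [h1]; exact Submodule.neg_mem _ (hpC _ _ h2.1), ?_⟩
  rw [h1, map_neg, ← hpd (k + 1) _ h2.1, h2.2, map_zero]

/-- The long exact sequence of a triple of cochain complexes `I → D → N[-1]` where the kernel of
`D → N[-1]` is an extension of `I` by an acyclic complex. -/
theorem exists_long_exact_sequence {I D N : CochainData}
    (hD : D.IsComplex)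
    (ι : ∀ k, I.X k →ₗ[ℝ] D.X k) (p : ∀ k, D.X (k + 1) →ₗ[ℝ] N.X k) (ε : ℕ → ℝ)
    (hι : ∀ k, Set.InjOn (ι k) (I.C k : Set (I.X k))) (hε : ∀ k, ε k * ε k = 1)
    (hιC : ∀ k, ∀ u ∈ I.C k, ι k u ∈ D.C k)
    (hIC : ∀ k, ∀ u ∈ I.C k, I.d k u ∈ I.C (k + 1))
    (hd : ∀ k, ∀ u ∈ I.C k, D.d k (ι k u) = ε k • ι (k + 1) (I.d k u))
    (hpC : ∀ k, ∀ c ∈ D.C (k + 1), p k c ∈ N.C k)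
    (hpd : ∀ k, ∀ c ∈ D.C (k + 1), p (k + 1) (D.d (k + 1) c) = -N.d k (p k c))
    (hpd0 : ∀ c ∈ D.C 0, p 0 (D.d 0 c) = 0)
    (hpι : ∀ k, ∀ u ∈ I.C (k + 1), p k (ι (k + 1) u) = 0)
    (hsurj : ∀ k, ∀ v ∈ N.C k, ∃ c ∈ D.C (k + 1), p k c = v)
    (hlift : ∀ k, ∀ v ∈ N.Z k, ∃ c ∈ D.C (k + 1), p k c = v ∧
      ∃ w ∈ I.C (k + 2), D.d (k + 1) c = ι (k + 2) w)
    (hker0 : ∀ c ∈ D.C 0, ∀ u ∈ I.C 1, D.d 0 c = ι 1 u → ∃ u' ∈ I.C 0, c = ι 0 u')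
    (hker : ∀ k, ∀ c ∈ D.C (k + 1), p k c = 0 → ∀ w ∈ I.C (k + 2), D.d (k + 1) c = ι (k + 2) w →
      ∃ e ∈ D.C k, ∃ u ∈ I.C (k + 1), c - D.d k e = ι (k + 1) u) :
    ∃ (r : ∀ k, I.H k →ₗ[ℝ] D.H k) (π : ∀ k, D.H (k + 1) →ₗ[ℝ] N.H k)
      (K : ∀ k, N.H k →ₗ[ℝ] I.H (k + 2)),
      (∀ k, ∀ u (hu : u ∈ I.Z k), ∃ hc : ι k u ∈ D.Z k, r k (I.cls u hu) = D.cls (ι k u) hc) ∧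
      (∀ k, ∀ c (hc : c ∈ D.Z (k + 1)), ∃ hv : p k c ∈ N.Z k,
        π k (D.cls c hc) = N.cls (p k c) hv) ∧
      (∀ k, ∀ c ∈ D.C (k + 1), ∀ w ∈ I.C (k + 2), D.d (k + 1) c = ι (k + 2) w →
        ∃ (hv : p k c ∈ N.Z k) (hw : w ∈ I.Z (k + 2)), K k (N.cls (p k c) hv) = I.cls w hw) ∧
      Function.Bijective (r 0) ∧ Function.Injective (r 1) ∧
      ∀ k, Function.Exact (r (k + 1)) (π k) ∧ Function.Exact (π k) (K k) ∧
        Function.Exact (K k) (r (k + 2)) := by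
  have hιB : ∀ k, ∀ u ∈ I.C k, ι (k + 1) (I.d k u) = D.d k (ε k • ι k u) := fun k u hu => by
    rw [map_smul, hd k u hu, smul_smul, hε, one_smul]
  have hιZ : ∀ k, ∀ u ∈ I.Z k, ι k u ∈ D.Z k := fun k u hu =>
    ⟨hιC k u hu.1, by
      have h : I.d k u = 0 := hu.2
      change D.d k (ι k u) = 0
      rw [hd k u hu.1, h, map_zero, smul_zero]⟩
  have hZι : ∀ k, ∀ u ∈ I.C k, D.d k (ι k u) = 0 → u ∈ I.Z k := fun k u hu h => by
    refine ⟨hu, hι (k + 1) (hIC k u hu) (Submodule.zero_mem _) ?_⟩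
    rw [hιB k u hu, map_smul, h, smul_zero, map_zero]
  have hpZ : ∀ k, ∀ c ∈ D.C (k + 1), p (k + 1) (D.d (k + 1) c) = 0 → p k c ∈ N.Z k :=
    fun k c hc h => ⟨hpC k c hc, by rw [hpd k c hc] at h; exact neg_eq_zero.1 h⟩
  -- a cochain whose projection is a coboundary can be changed by a coboundary into a cochain in `I`
  have hfix : ∀ k, ∀ c ∈ D.C (k + 1), p k c ∈ N.B k → ∀ w ∈ I.C (k + 2),
      D.d (k + 1) c = ι (k + 2) w → ∃ e ∈ D.C k, ∃ u ∈ I.C (k + 1), c - D.d k e = ι (k + 1) u := by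
    intro k c hc hpc w hw hcw
    cases k with
    | zero => exact hker 0 c hc hpc w hw hcw
    | succ k =>
      obtain ⟨v, hv, hvc⟩ := hpc
      -- If p c = d v with v = p c', then c + d c' has zero projection, because p anticommutes with
      -- d, and it has the same differential as c.
      obtain ⟨c', hc', rfl⟩ := hsurj k v hv
      have h2 := hD (k + 1) c' hc'
      obtain ⟨e, he, u, hu, h⟩ := hker (k + 1) (c + D.d (k + 1) c') (Submodule.add_mem _ hc h2.1)
        (by rw [map_add, hpd k c' hc', hvc, add_neg_cancel]) w hw
        (by rw [map_add, h2.2, add_zero, hcw])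
      refine ⟨e - c', Submodule.sub_mem _ he hc', u, hu, ?_⟩
      rw [← h, map_sub]; abel
  have hr : ∀ k, ∃ f : I.H k →ₗ[ℝ] D.H k, ∀ z (hz : z ∈ I.Z k) z' (hz' : ι k z = z' ∧ z' ∈ D.Z k),
      f (I.cls z hz) = D.cls z' hz'.2 := fun k =>
    exists_linearMap_of_rel (fun u c => ι k u = c ∧ c ∈ D.Z k) (fun u hu => ⟨_, rfl, hιZ k u hu⟩)
      (fun _ _ _ h => h.2)
      (by
        rintro a x _ y _ ⟨rfl, h⟩ ⟨rfl, h'⟩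
        exact ⟨by simp, Submodule.add_mem _ (Submodule.smul_mem _ a h) h'⟩)
      (by
        rintro z hz _ ⟨rfl, -⟩
        cases k with
        | zero =>
          obtain rfl : z = 0 := hz
          rw [map_zero]; exact Submodule.zero_mem _
        | succ k =>
          obtain ⟨u, hu, rfl⟩ := hz
          exact ⟨_, Submodule.smul_mem _ _ (hιC k u hu), (hιB k u hu).symm⟩)
  have hπ : ∀ k, ∃ f : D.H (k + 1) →ₗ[ℝ] N.H k, ∀ z (hz : z ∈ D.Z (k + 1)) z'
      (hz' : p k z = z' ∧ z' ∈ N.Z k), f (D.cls z hz) = N.cls z' hz'.2 := fun k =>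
    exists_linearMap_of_rel (fun c v => p k c = v ∧ v ∈ N.Z k)
      (fun c hc => ⟨_, rfl, hpZ k c hc.1 (by rw [hc.2, map_zero])⟩)
      (fun _ _ _ h => h.2)
      (by
        rintro a x _ y _ ⟨rfl, h⟩ ⟨rfl, h'⟩
        exact ⟨by simp, Submodule.add_mem _ (Submodule.smul_mem _ a h) h'⟩)
      (by
        rintro z ⟨c, hc, rfl⟩ _ ⟨rfl, -⟩
        cases k with
        | zero => rw [hpd0 c hc]; exact Submodule.zero_mem _
        | succ k =>
          rw [hpd k c hc]
          exact Submodule.neg_mem _ ⟨_, hpC k c hc, rfl⟩)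
  have hw' : ∀ k, ∀ c ∈ D.C (k + 1), ∀ w ∈ I.C (k + 2), D.d (k + 1) c = ι (k + 2) w →
      w ∈ I.Z (k + 2) := fun k c hc w hw h =>
    hZι _ w hw (by rw [← h, (hD _ c hc).2])
  -- The connecting map as a relation: w corresponds to v when some c has p c = v and d c = ι w. If
  -- v is a coboundary, `hfix` gives c - d e = ι u. Applying d gives ι w = d (ι u), hence w = ± d u.
  have hK : ∀ k, ∃ f : N.H k →ₗ[ℝ] I.H (k + 2), ∀ z (hz : z ∈ N.Z k) z'
      (hz' : (∃ c ∈ D.C (k + 1), p k c = z ∧ D.d (k + 1) c = ι (k + 2) z') ∧ z' ∈ I.Z (k + 2)),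
      f (N.cls z hz) = I.cls z' hz'.2 := fun k =>
    exists_linearMap_of_rel
      (fun z z' => (∃ c ∈ D.C (k + 1), p k c = z ∧ D.d (k + 1) c = ι (k + 2) z') ∧ z' ∈ I.Z (k + 2))
      (fun v hv => by
        obtain ⟨c, hc, hcv, w, hw, h⟩ := hlift k v hv
        exact ⟨w, ⟨c, hc, hcv, h⟩, hw' k c hc w hw h⟩)
      (fun _ _ _ h => h.2)
      (by
        rintro a x x' y y' ⟨⟨c, hc, rfl, h⟩, h1⟩ ⟨⟨c', hc', rfl, h'⟩, h1'⟩
        exact ⟨⟨a • c + c', Submodule.add_mem _ (Submodule.smul_mem _ a hc) hc', by simp,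
          by simp [h, h']⟩, Submodule.add_mem _ (Submodule.smul_mem _ a h1) h1'⟩)
      (by
        rintro z hz w ⟨⟨c, hc, rfl, h⟩, h1⟩
        obtain ⟨e, he, u, hu, heu⟩ := hfix k c hc hz w h1.1 h
        refine ⟨ε (k + 1) • u, Submodule.smul_mem _ _ hu,
          hι _ (hIC _ _ (Submodule.smul_mem _ _ hu)) h1.1 ?_⟩
        have h2 := congrArg (D.d (k + 1)) heu
        rw [map_sub, (hD k e he).2, sub_zero, h, hd _ u hu] at h2
        rw [h2, map_smul, map_smul])
  choose r hr using hr
  choose π hπ using hπ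
  choose K hK using hK
  have hr' : ∀ k, ∀ u (hu : u ∈ I.Z k), r k (I.cls u hu) = D.cls (ι k u) (hιZ k u hu) :=
    fun k u hu => hr k u hu _ ⟨rfl, hιZ k u hu⟩
  have hπ' : ∀ k, ∀ c (hc : c ∈ D.Z (k + 1)),
      π k (D.cls c hc) = N.cls (p k c) (hpZ k c hc.1 (by rw [hc.2, map_zero])) :=
    fun k c hc => hπ k c hc _ ⟨rfl, hpZ k c hc.1 (by rw [hc.2, map_zero])⟩
  have hK' : ∀ k, ∀ c (hc : c ∈ D.C (k + 1)), ∀ w (hw : w ∈ I.C (k + 2)),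
      D.d (k + 1) c = ι (k + 2) w → ∃ (hv : p k c ∈ N.Z k) (hw : w ∈ I.Z (k + 2)),
        K k (N.cls (p k c) hv) = I.cls w hw := by
    intro k c hc w hw h
    have h1 : p k c ∈ N.Z k := hpZ k c hc (by rw [h, hpι _ w hw])
    exact ⟨h1, hw' k c hc w hw h, hK k _ h1 w ⟨⟨c, hc, rfl, h⟩, hw' k c hc w hw h⟩⟩
  refine ⟨r, π, K, fun k u hu => ⟨_, hr' k u hu⟩, fun k c hc => ⟨_, hπ' k c hc⟩, hK', ⟨?_, ?_⟩, ?_,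
    fun k => ⟨?_, ?_, ?_⟩⟩
  · rw [injective_iff_map_eq_zero]
    intro a ha
    obtain ⟨u, hu, rfl⟩ := exists_cls a
    rw [hr', cls_eq_zero] at ha
    exact cls_eq_zero.2 (hι 0 hu.1 (Submodule.zero_mem _) (ha.trans (map_zero _).symm))
  · intro a
    obtain ⟨c, hc, rfl⟩ := exists_cls a
    -- A degree 0 cocycle of D has differential ι 0, so it already lies in I.
    obtain ⟨u, hu, rfl⟩ := hker0 c hc.1 0 (Submodule.zero_mem _) (by rw [map_zero]; exact hc.2)
    exact ⟨I.cls u (hZι 0 u hu hc.2), hr' _ _ _⟩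
  · rw [injective_iff_map_eq_zero]
    intro a ha
    obtain ⟨u, hu, rfl⟩ := exists_cls a
    rw [hr', cls_eq_zero] at ha
    obtain ⟨c, hc, hcu⟩ := ha
    -- The primitive of ι u has degree 0, where an element with differential in I is itself in I. So
    -- u is a coboundary in I.
    obtain ⟨u', hu', rfl⟩ := hker0 c hc u hu.1 hcu
    refine cls_eq_zero.2 ⟨ε 0 • u', Submodule.smul_mem _ _ hu',
      hι 1 (hIC _ _ (Submodule.smul_mem _ _ hu')) hu.1 ?_⟩
    rw [← hcu, hd 0 u' hu', map_smul, map_smul]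
  · intro a
    obtain ⟨c, hc, rfl⟩ := exists_cls a
    constructor
    · intro h
      rw [hπ', cls_eq_zero] at h
      obtain ⟨e, he, u, hu, heu⟩ := hfix k c hc.1 h 0 (Submodule.zero_mem _)
        (by rw [map_zero]; exact hc.2)
      have huZ : u ∈ I.Z (k + 1) := hZι _ u hu (by
        rw [← heu, map_sub, (hD k e he).2, sub_zero]; exact hc.2)
      refine ⟨I.cls u huZ, ?_⟩
      rw [hr', cls_eq_cls, ← heu]
      refine ⟨-e, Submodule.neg_mem _ he, ?_⟩
      rw [map_neg]; abel
    · rintro ⟨b, hb⟩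
      obtain ⟨u, hu, rfl⟩ := exists_cls b
      rw [← hb, hr', hπ', cls_eq_zero, hpι k u hu.1]
      exact Submodule.zero_mem _
  · intro a
    obtain ⟨v, hv, rfl⟩ := exists_cls a
    constructor
    · intro h
      obtain ⟨c, hc, rfl, w, hw, hcw⟩ := hlift k v hv
      obtain ⟨_, hw2, h2⟩ := hK' k c hc w hw hcw
      rw [h2, cls_eq_zero] at h
      obtain ⟨u, hu, rfl⟩ := h
      -- Since d c = ι (d u), this correction makes c a cocycle without changing its projection.
      have hZ : c - ε (k + 1) • ι (k + 1) u ∈ D.Z (k + 1) :=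
        ⟨Submodule.sub_mem _ hc (Submodule.smul_mem _ _ (hιC _ u hu)), by
          change D.d (k + 1) _ = 0
          rw [map_sub, hcw, hιB _ u hu, sub_self]⟩
      refine ⟨D.cls _ hZ, ?_⟩
      rw [hπ', cls_eq_cls, map_sub, map_smul, hpι k u hu, smul_zero, sub_zero, sub_self]
      exact Submodule.zero_mem _
    · rintro ⟨b, hb⟩
      obtain ⟨c, hc, rfl⟩ := exists_cls b
      rw [hπ'] at hb
      obtain ⟨_, _, h2⟩ := hK' k c hc.1 0 (Submodule.zero_mem _) (by rw [map_zero]; exact hc.2)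
      rw [← hb, h2, cls_eq_zero]
      exact Submodule.zero_mem _
  · intro a
    obtain ⟨w, hw, rfl⟩ := exists_cls a
    constructor
    · intro h
      rw [hr', cls_eq_zero] at h
      obtain ⟨c, hc, hcw⟩ := h
      obtain ⟨hv, _, h2⟩ := hK' k c hc w hw.1 hcw
      exact ⟨_, h2⟩
    · rintro ⟨b, hb⟩
      obtain ⟨v, hv, rfl⟩ := exists_cls b
      obtain ⟨c, hc, rfl, w', hw', hcw⟩ := hlift k v hv
      obtain ⟨_, hw2, h2⟩ := hK' k c hc w' hw' hcw
      rw [← hb, h2, hr', cls_eq_zero]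
      exact ⟨c, hc, hcw⟩

end CochainData

/-! ### Local lifts along submersions -/

section Lift

variable {E F G M : Type*}
  [NormedAddCommGroup E] [NormedSpace ℝ E] [NormedAddCommGroup F] [NormedSpace ℝ F]
  [TopologicalSpace G] [ChartedSpace E G] [TopologicalSpace M] [ChartedSpace F M]

/-- A submersion `f` has local smooth lifts: a map `l`, defined near `(p, f p)`, with
`f (l (a, y)) = y` and `l (a, f a) = a`. -/
theorem Manifold.IsSubmersion.exists_local_lift {f : G → M}
    (hf : Manifold.IsSubmersion 𝓘(ℝ, E) 𝓘(ℝ, F) ∞ f) (p : G) :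
    ∃ (U : Set (G × M)) (l : G × M → G), IsOpen U ∧ (p, f p) ∈ U ∧
      ContMDiffOn (𝓘(ℝ, E).prod 𝓘(ℝ, F)) 𝓘(ℝ, E) ∞ l U ∧
      (∀ z ∈ U, f (l z) = z.2) ∧ ∀ a, l (a, f a) = a := by
  classical
  have hfs := hf.contMDiff
  obtain ⟨C, _, _, hC⟩ := hf
  have h := hC p
  set φ := h.domChart with hφdef
  set ψ := h.codChart with hψdef
  let R : F → E := fun y => h.equiv.symm (y, 0)
  have hp : p ∈ φ.source := h.mem_domChart_source
  have hfψ : ∀ q ∈ φ.source, f q ∈ ψ.source := fun q hq => h.source_subset_preimage_source hq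
  have hφ := contMDiffOn_of_mem_maximalAtlas h.domChart_mem_maximalAtlas
  have hφs := contMDiffOn_symm_of_mem_maximalAtlas h.domChart_mem_maximalAtlas
  have hψ := contMDiffOn_of_mem_maximalAtlas h.codChart_mem_maximalAtlas
  have hfeq : ∀ q ∈ φ.source, ψ (f q) = (h.equiv (φ q)).1 := by
    intro q hq
    have hm : h.domChart.extend 𝓘(ℝ, E) q ∈ (h.domChart.extend 𝓘(ℝ, E)).target :=
      (h.domChart.extend 𝓘(ℝ, E)).map_source (by rwa [OpenPartialHomeomorph.extend_source])
    have := h.writtenInCharts hm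
    simpa [h.domChart.left_inv hq, hφdef, hψdef] using this
  let W : Set (G × M) := φ.source ×ˢ ψ.source
  have hW : IsOpen W := φ.open_source.prod ψ.open_source
  -- In the charts f is a linear projection and R a section of it. Moving the coordinates of a by R
  -- applied to the difference of the coordinates of y and f a gives a point over y.
  let k : G × M → E := fun z => φ z.1 + R (ψ z.2 - ψ (f z.1))
  have hR : ContDiff ℝ ∞ R := h.equiv.symm.contDiff.comp (contDiff_id.prodMk contDiff_const)
  have hk : ContMDiffOn (𝓘(ℝ, E).prod 𝓘(ℝ, F)) 𝓘(ℝ, E) ∞ k W := by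
    have h1 : ContMDiffOn (𝓘(ℝ, E).prod 𝓘(ℝ, F)) 𝓘(ℝ, E) ∞ (fun z : G × M => φ z.1) W :=
      hφ.comp contMDiffOn_fst fun z hz => hz.1
    have h2 : ContMDiffOn (𝓘(ℝ, E).prod 𝓘(ℝ, F)) 𝓘(ℝ, F) ∞ (fun z : G × M => ψ z.2) W :=
      hψ.comp contMDiffOn_snd fun z hz => hz.2
    have h3 : ContMDiffOn (𝓘(ℝ, E).prod 𝓘(ℝ, F)) 𝓘(ℝ, F) ∞ (fun z : G × M => ψ (f z.1)) W :=
      hψ.comp (hfs.comp_contMDiffOn contMDiffOn_fst) fun z hz => hfψ _ hz.1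
    exact h1.add (hR.contMDiff.comp_contMDiffOn (h2.sub h3))
  have hkf : ∀ a, k (a, f a) = φ a := fun a => by simp [k, R]
  -- The case distinction makes l (a, f a) = a hold for every a, even outside the charts. On `W` it
  -- does not change the smooth formula.
  let l : G × M → G := fun z => if z.2 = f z.1 then z.1 else φ.symm (k z)
  have hl : ∀ z ∈ W, l z = φ.symm (k z) := by
    rintro ⟨a, y⟩ hz
    by_cases hy : y = f a
    · subst hy
      simp [l, hkf, φ.left_inv hz.1]
    · simp [l, hy]
  refine ⟨W ∩ k ⁻¹' φ.target, l, hk.continuousOn.isOpen_inter_preimage hW φ.open_target,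
    ⟨⟨hp, hfψ p hp⟩, ?_⟩, ?_, ?_, fun a => by simp [l]⟩
  · rw [mem_preimage, hkf]; exact φ.map_source hp
  · exact (hφs.comp (hk.mono inter_subset_left) fun z hz => hz.2).congr fun z hz => hl z hz.1
  · rintro z ⟨hz, hzt⟩
    have hs := φ.map_target hzt
    rw [hl z hz]
    apply ψ.injOn (hfψ _ hs) hz.2
    rw [hfeq _ hs, φ.right_inv hzt, map_add, Prod.fst_add, ← hfeq _ hz.1]
    simp [R]

end Lift

/-! ### Velocities of curves -/

section Velocity

variable {E F G M : Type*}
  [NormedAddCommGroup E] [NormedSpace ℝ E] [NormedAddCommGroup F] [NormedSpace ℝ F]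
  [TopologicalSpace G] [ChartedSpace E G] [TopologicalSpace M] [ChartedSpace F M]
  {E' F' H K : Type*} [NormedAddCommGroup E'] [NormedSpace ℝ E']
  [NormedAddCommGroup F'] [NormedSpace ℝ F'] [TopologicalSpace H] [ChartedSpace E' H]
  [TopologicalSpace K] [ChartedSpace F' K]

/-- The derivative of a map of manifolds, as a map between the model spaces. -/
def tderiv (f : G → M) (p : G) : E →L[ℝ] F := mfderiv 𝓘(ℝ, E) 𝓘(ℝ, F) f p

/-- The derivative within a set of a map of manifolds, as a map between the model spaces. -/
def tderivWithin (f : G → M) (S : Set G) (p : G) : E →L[ℝ] F :=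
  mfderivWithin 𝓘(ℝ, E) 𝓘(ℝ, F) f S p

/-- The derivative within a set of a map on a product of manifolds, as a map between the model
spaces. -/
def tderivWithin₂ (f : G × H → K) (S : Set (G × H)) (p : G) (q : H) : E × E' →L[ℝ] F' :=
  mfderivWithin (𝓘(ℝ, E).prod 𝓘(ℝ, E')) 𝓘(ℝ, F') f S (p, q)

/-- The curve `γ` starts at `p` with velocity `X`. -/
def HasVelocity (γ : ℝ → G) (p : G) (X : E) : Prop :=
  γ 0 = p ∧ HasMFDerivAt 𝓘(ℝ, ℝ) 𝓘(ℝ, E) γ 0 (ContinuousLinearMap.toSpanSingleton ℝ X : ℝ →L[ℝ] E)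

namespace HasVelocity

theorem unique {γ γ' : ℝ → G} {p q : G} {X Y : E} (h : HasVelocity γ p X)
    (h' : HasVelocity γ' q Y) (he : γ =ᶠ[𝓝 0] γ') : X = Y := by
  have h2 := h'.2.congr_of_eventuallyEq he
  have h3 := hasMFDerivAt_unique h.2 h2
  have h4 := congrArg (fun T : ℝ →L[ℝ] E => T 1) h3
  simpa using h4

theorem const (p : G) : HasVelocity (fun _ => p) p (0 : E) := by
  refine ⟨rfl, (hasMFDerivAt_const (I := 𝓘(ℝ, ℝ)) (I' := 𝓘(ℝ, E)) p (0 : ℝ)).congr_mfderiv ?_⟩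
  exact ContinuousLinearMap.ext fun (r : ℝ) => (smul_zero (A := E) r).symm

theorem comp {f : G → M} {p : G} (hf : MDifferentiableAt 𝓘(ℝ, E) 𝓘(ℝ, F) f p)
    {γ : ℝ → G} {X : E} (h : HasVelocity γ p X) :
    HasVelocity (fun r => f (γ r)) (f p) (tderiv (E := E) (F := F) f p X) := by
  obtain ⟨rfl, h⟩ := h
  refine ⟨rfl, (HasMFDerivAt.comp (0 : ℝ) hf.hasMFDerivAt h).congr_mfderiv ?_⟩
  exact ContinuousLinearMap.ext fun (r : ℝ) =>
    map_smul (tderiv (E := E) (F := F) f (γ 0)) r X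

theorem continuousAt {γ : ℝ → G} {p : G} {X : E} (h : HasVelocity γ p X) : ContinuousAt γ 0 :=
  h.2.continuousAt

theorem tendsto {γ : ℝ → G} {p : G} {X : E} (h : HasVelocity γ p X) :
    Filter.Tendsto γ (𝓝 0) (𝓝 p) := h.1 ▸ h.continuousAt

/-- `S` need not have unique derivatives, so the derivative within `S` may be an arbitrary choice.
On velocities of curves that stay in `S` every choice gives the velocity of the image curve. This is
what makes the differentials of multiplication and division meaningful. -/
theorem compWithin₂ {f : G × H → K} {S : Set (G × H)} {p : G} {q : H}
    (hf : MDifferentiableWithinAt (𝓘(ℝ, E).prod 𝓘(ℝ, E')) 𝓘(ℝ, F') f S (p, q))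
    {a : ℝ → G} {b : ℝ → H} {X : E} {Y : E'} (ha : HasVelocity a p X) (hb : HasVelocity b q Y)
    (hS : ∀ᶠ r in 𝓝 0, (a r, b r) ∈ S) :
    HasVelocity (fun r => f (a r, b r)) (f (p, q))
      (tderivWithin₂ (E := E) (E' := E') (F' := F') f S p q (X, Y)) := by
  obtain ⟨rfl, ha⟩ := ha
  obtain ⟨rfl, hb⟩ := hb
  have h2 : HasMFDerivWithinAt 𝓘(ℝ, ℝ) (𝓘(ℝ, E).prod 𝓘(ℝ, E')) (fun r => (a r, b r))
    {r | (a r, b r) ∈ S} 0 _ := (ha.prodMk hb).hasMFDerivWithinAt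
  have h3 := HasMFDerivWithinAt.comp (0 : ℝ) hf.hasMFDerivWithinAt h2 (fun r hr => hr)
  refine ⟨rfl, (h3.hasMFDerivAt hS).congr_mfderiv ?_⟩
  exact ContinuousLinearMap.ext fun (r : ℝ) =>
    map_smul (tderivWithin₂ (E := E) (E' := E') (F' := F') f S (a 0) (b 0)) r (X, Y)

theorem compWithin {f : G → M} {S : Set G} {p : G}
    (hf : MDifferentiableWithinAt 𝓘(ℝ, E) 𝓘(ℝ, F) f S p)
    {a : ℝ → G} {X : E} (ha : HasVelocity a p X) (hS : ∀ᶠ r in 𝓝 0, a r ∈ S) :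
    HasVelocity (fun r => f (a r)) (f p) (tderivWithin (E := E) (F := F) f S p X) := by
  obtain ⟨rfl, ha⟩ := ha
  have h2 : HasMFDerivWithinAt 𝓘(ℝ, ℝ) 𝓘(ℝ, E) a {r | a r ∈ S} 0 _ := ha.hasMFDerivWithinAt
  have h3 := HasMFDerivWithinAt.comp (0 : ℝ) hf.hasMFDerivWithinAt h2 (fun r hr => hr)
  refine ⟨rfl, (h3.hasMFDerivAt hS).congr_mfderiv ?_⟩
  exact ContinuousLinearMap.ext fun (r : ℝ) =>
    map_smul (tderivWithin (E := E) (F := F) f S (a 0)) r X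

end HasVelocity

theorem exists_hasVelocity [IsManifold 𝓘(ℝ, E) ∞ G] (p : G) (X : E) :
    ∃ γ : ℝ → G, HasVelocity γ p X := by
  set φ := chartAt E p with hφ
  have hps : p ∈ φ.source := mem_chart_source E p
  have hm : MDifferentiableAt 𝓘(ℝ, E) 𝓘(ℝ, E) φ.symm (φ p) :=
    ((contMDiffOn_chart_symm (I := 𝓘(ℝ, E)) (n := ∞)).contMDiffAt
      (φ.open_target.mem_nhds (mem_chart_target E p))).mdifferentiableAt (by simp)
  have hm' : MDifferentiableAt 𝓘(ℝ, E) 𝓘(ℝ, E) φ p :=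
    ((contMDiffOn_chart (I := 𝓘(ℝ, E)) (n := ∞)).contMDiffAt
      (φ.open_source.mem_nhds hps)).mdifferentiableAt (by simp)
  set T : E →L[ℝ] E := tderiv φ p with hT
  have hline : HasVelocity (fun r : ℝ => φ p + r • T X) (φ p) (T X) :=
    ⟨by simp, HasFDerivAt.hasMFDerivAt
      (((ContinuousLinearMap.toSpanSingleton ℝ (T X)).hasFDerivAt (x := (0:ℝ))).const_add (φ p))⟩
  have hv := hline.comp hm
  rw [φ.left_inv hps] at hv
  have key : (tderiv φ.symm (φ p) : E →L[ℝ] E) (T X) = X := by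
    have h6 : (φ.symm ∘ φ) =ᶠ[𝓝 p] id := by
      filter_upwards [φ.open_source.mem_nhds hps] with q hq
      exact φ.left_inv hq
    have h7 := h6.mfderiv_eq (I := 𝓘(ℝ, E)) (I' := 𝓘(ℝ, E))
    rw [mfderiv_comp p hm hm', mfderiv_id] at h7
    exact congrArg (fun S : E →L[ℝ] E => S X) h7
  exact ⟨_, key ▸ hv⟩

/-- Take any curve a with velocity X and a local lift l of f. The curve l (a, x) lies over x, and
its velocity equals that of l (a, f a) = a, because x and f a have the same velocity. -/
theorem Manifold.IsSubmersion.exists_hasVelocity [IsManifold 𝓘(ℝ, E) ∞ G] {f : G → M}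
    (hf : Manifold.IsSubmersion 𝓘(ℝ, E) 𝓘(ℝ, F) ∞ f) {p : G} {X : E} {x : ℝ → M}
    (hx : HasVelocity x (f p) (tderiv (E := E) (F := F) f p X)) :
    ∃ γ : ℝ → G, HasVelocity γ p X ∧ ∀ᶠ r in 𝓝 0, f (γ r) = x r := by
  obtain ⟨U, l, hU, hpU, hl, hfl, hlf⟩ := hf.exists_local_lift p
  obtain ⟨a, ha⟩ := _root_.exists_hasVelocity p X
  have hld : MDifferentiableWithinAt (𝓘(ℝ, E).prod 𝓘(ℝ, F)) 𝓘(ℝ, E) l U (p, f p) :=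
    (hl _ hpU).mdifferentiableWithinAt (by simp)
  have hfa := ha.comp (hf.contMDiff.mdifferentiableAt (x := p) (by simp))
  have ev : ∀ {y : ℝ → M} {v : F}, HasVelocity y (f p) v → ∀ᶠ r in 𝓝 0, (a r, y r) ∈ U := by
    intro y v hy
    exact (ha.tendsto.prodMk_nhds hy.tendsto).eventually_mem (hU.mem_nhds hpU)
  have h1 := ha.compWithin₂ hld hx (ev hx)
  have h2 := ha.compWithin₂ hld hfa (ev hfa)
  rw [hlf p] at h1 h2
  have h3 := h2.unique ha (Filter.Eventually.of_forall fun r => hlf (a r))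
  rw [h3] at h1
  refine ⟨_, h1, ?_⟩
  filter_upwards [ev hx] with r hr using hfl _ hr

end Velocity

namespace LieGroupoid

/-! ### The tangent groupoid -/

section Tangent

variable {E F G M : Type*}
  [NormedAddCommGroup E] [NormedSpace ℝ E] [NormedAddCommGroup F] [NormedSpace ℝ F]
  [TopologicalSpace G] [ChartedSpace E G] [TopologicalSpace M] [ChartedSpace F M]
  (Γ : LieGroupoid E F G M)

theorem eq_div {x y z : G} (hc : Γ.src z = Γ.tgt y) (h : x = Γ.mul z y) :
    Γ.mul x (Γ.inv y) = z := by
  rw [h, Γ.div_eq z y hc]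

/-- The identity (a g h b⁻¹)(m h b⁻¹)⁻¹ = a g m⁻¹. Its derivative is the multiplicativity of δα for
α a section of the Lie algebroid. -/
theorem mul_div_div {a g h m b : G} (hag : Γ.src a = Γ.tgt g) (hgh : Γ.src g = Γ.tgt h)
    (hmh : Γ.src m = Γ.tgt h) (hbh : Γ.src b = Γ.src h) :
    Γ.mul (Γ.mul (Γ.mul a (Γ.mul g h)) (Γ.inv b)) (Γ.inv (Γ.mul (Γ.mul m h) (Γ.inv b))) =
      Γ.mul (Γ.mul a g) (Γ.inv m) := by
  have e1 : Γ.src h = Γ.tgt (Γ.inv b) := by rw [Γ.tgt_inv, hbh]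
  have e2 : Γ.src (Γ.mul m h) = Γ.tgt (Γ.inv b) := by rw [Γ.src_mul _ _ hmh, e1]
  have e3 : Γ.src (Γ.mul a g) = Γ.tgt (Γ.inv m) := by
    rw [Γ.src_mul _ _ hag, hgh, Γ.tgt_inv, hmh]
  have e4 : Γ.src (Γ.mul a g) = Γ.tgt h := by rw [Γ.src_mul _ _ hag, hgh]
  refine Γ.eq_div ?_ ?_
  · rw [Γ.src_mul _ _ e3, Γ.src_inv, Γ.tgt_mul _ _ e2, Γ.tgt_mul _ _ hmh]
  · rw [← Γ.mul_assoc _ _ _ (by rw [Γ.src_mul _ _ e3, Γ.src_inv, Γ.tgt_mul _ _ hmh]) e2,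
      Γ.mul_assoc (Γ.mul a g) _ _ e3 (by rw [Γ.src_inv, Γ.tgt_mul _ _ hmh]),
      ← Γ.mul_assoc (Γ.inv m) m h (Γ.src_inv m) hmh, Γ.inv_mul, hmh, Γ.unit_mul,
      Γ.mul_assoc a g h hag hgh]

/-- `ds`, as a map between the model spaces -/
def ts (g : G) : E →L[ℝ] F := tderiv Γ.src g

/-- `dt`, as a map between the model spaces -/
def tt (g : G) : E →L[ℝ] F := tderiv Γ.tgt g

/-- the differential of the inversion, as a map between the model spaces -/
def ti (g : G) : E →L[ℝ] E := tderiv Γ.inv g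

/-- the differential of the unit map, as a map between the model spaces -/
def tu (x : M) : F →L[ℝ] E := tderiv Γ.unit x

/-- The differential of the multiplication, as a map between the model spaces; it is meaningful on
pairs `(X, Y)` with `ds X = dt Y`. -/
def tm (g h : G) : E × E →L[ℝ] E :=
  tderivWithin₂ (fun p : G × G => Γ.mul p.1 p.2) {p | Γ.src p.1 = Γ.tgt p.2} g h

/-- The differential of the division map `(p, q) ↦ p q⁻¹`, on pairs `(X, Y)` with `ds X = ds Y`. -/
def td (p q : G) : E × E →L[ℝ] E :=
  (Γ.tm p (Γ.inv q)).comp ((ContinuousLinearMap.id ℝ E).prodMap (Γ.ti q))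

theorem td_apply (p q : G) (X Y : E) : Γ.td p q (X, Y) = Γ.tm p (Γ.inv q) (X, Γ.ti q Y) := rfl

variable {Γ}

theorem velocity_src {γ : ℝ → G} {g : G} {X : E} (h : HasVelocity γ g X) :
    HasVelocity (fun r => Γ.src (γ r)) (Γ.src g) (Γ.ts g X) :=
  h.comp (Γ.mdifferentiableAt_src g)

theorem velocity_tgt {γ : ℝ → G} {g : G} {X : E} (h : HasVelocity γ g X) :
    HasVelocity (fun r => Γ.tgt (γ r)) (Γ.tgt g) (Γ.tt g X) :=
  h.comp (Γ.mdifferentiableAt_tgt g)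

theorem velocity_inv {γ : ℝ → G} {g : G} {X : E} (h : HasVelocity γ g X) :
    HasVelocity (fun r => Γ.inv (γ r)) (Γ.inv g) (Γ.ti g X) :=
  h.comp (Γ.inv_smooth.mdifferentiableAt (by simp))

theorem velocity_unit {γ : ℝ → M} {x : M} {X : F} (h : HasVelocity γ x X) :
    HasVelocity (fun r => Γ.unit (γ r)) (Γ.unit x) (Γ.tu x X) :=
  h.comp (Γ.unit_smooth.mdifferentiableAt (by simp))

theorem velocity_mul {a b : ℝ → G} {g h : G} {X Y : E} (ha : HasVelocity a g X)
    (hb : HasVelocity b h Y) (hc : Γ.src g = Γ.tgt h) (hab : ∀ᶠ r in 𝓝 0, Γ.src (a r) = Γ.tgt (b r)) :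
    HasVelocity (fun r => Γ.mul (a r) (b r)) (Γ.mul g h) (Γ.tm g h (X, Y)) :=
  ha.compWithin₂ (f := fun p : G × G => Γ.mul p.1 p.2)
    (Γ.mul_smooth.mdifferentiableOn (by simp) (g, h) hc) hb hab

theorem velocity_div {a b : ℝ → G} {p q : G} {X Y : E} (ha : HasVelocity a p X)
    (hb : HasVelocity b q Y) (hc : Γ.src p = Γ.src q) (hab : ∀ᶠ r in 𝓝 0, Γ.src (a r) = Γ.src (b r)) :
    HasVelocity (fun r => Γ.mul (a r) (Γ.inv (b r))) (Γ.mul p (Γ.inv q)) (Γ.td p q (X, Y)) :=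
  velocity_mul ha (velocity_inv hb) (hc.trans (Γ.tgt_inv q).symm)
    (hab.mono fun _ hr => hr.trans (Γ.tgt_inv _).symm)

variable [IsManifold 𝓘(ℝ, E) ∞ G]

theorem exists_velocity_src {x : ℝ → M} {y : M} {v : F} (hx : HasVelocity x y v) {g : G} {X : E}
    (hg : Γ.src g = y) (hX : Γ.ts g X = v) :
    ∃ a, HasVelocity a g X ∧ ∀ᶠ r in 𝓝 0, Γ.src (a r) = x r := by
  subst hg hX
  exact Γ.src_submersion.exists_hasVelocity hx

theorem exists_velocity_tgt {x : ℝ → M} {y : M} {v : F} (hx : HasVelocity x y v) {g : G} {X : E}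
    (hg : Γ.tgt g = y) (hX : Γ.tt g X = v) :
    ∃ a, HasVelocity a g X ∧ ∀ᶠ r in 𝓝 0, Γ.tgt (a r) = x r := by
  subst hg hX
  exact Γ.tgt_submersion.exists_hasVelocity hx

/-- As s is a submersion, the curve through g can be chosen over the target of any curve through h.
Identities of the tangent groupoid are then derivatives of identities between honest products. -/
theorem exists_velocity_mul {g h : G} {X Y : E} (hc : Γ.src g = Γ.tgt h)
    (hXY : Γ.ts g X = Γ.tt h Y) : ∃ a b, HasVelocity a g X ∧ HasVelocity b h Y ∧
      ∀ᶠ r in 𝓝 0, Γ.src (a r) = Γ.tgt (b r) := by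
  obtain ⟨b, hb⟩ := exists_hasVelocity h Y
  obtain ⟨a, ha, hab⟩ := exists_velocity_src (velocity_tgt hb) hc hXY
  exact ⟨a, b, ha, hb, hab⟩

theorem ts_tm {g h : G} {X Y : E} (hc : Γ.src g = Γ.tgt h) (hXY : Γ.ts g X = Γ.tt h Y) :
    Γ.ts (Γ.mul g h) (Γ.tm g h (X, Y)) = Γ.ts h Y := by
  obtain ⟨a, b, ha, hb, hab⟩ := exists_velocity_mul hc hXY
  exact (velocity_src (velocity_mul ha hb hc hab)).unique (velocity_src hb)
    (hab.mono fun r hr => Γ.src_mul _ _ hr)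

theorem tt_tm {g h : G} {X Y : E} (hc : Γ.src g = Γ.tgt h) (hXY : Γ.ts g X = Γ.tt h Y) :
    Γ.tt (Γ.mul g h) (Γ.tm g h (X, Y)) = Γ.tt g X := by
  obtain ⟨a, b, ha, hb, hab⟩ := exists_velocity_mul hc hXY
  exact (velocity_tgt (velocity_mul ha hb hc hab)).unique (velocity_tgt ha)
    (hab.mono fun r hr => Γ.tgt_mul _ _ hr)

theorem ts_ti (g : G) (X : E) : Γ.ts (Γ.inv g) (Γ.ti g X) = Γ.tt g X := by
  obtain ⟨a, ha⟩ := exists_hasVelocity g X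
  exact (velocity_src (velocity_inv ha)).unique (velocity_tgt ha)
    (Filter.Eventually.of_forall fun r => Γ.src_inv _)

theorem tt_ti (g : G) (X : E) : Γ.tt (Γ.inv g) (Γ.ti g X) = Γ.ts g X := by
  obtain ⟨a, ha⟩ := exists_hasVelocity g X
  exact (velocity_tgt (velocity_inv ha)).unique (velocity_src ha)
    (Filter.Eventually.of_forall fun r => Γ.tgt_inv _)

theorem tm_tu (g : G) (X : E) : Γ.tm g (Γ.unit (Γ.src g)) (X, Γ.tu (Γ.src g) (Γ.ts g X)) = X := by
  obtain ⟨a, ha⟩ := exists_hasVelocity g X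
  exact (velocity_mul ha (velocity_unit (velocity_src ha)) (Γ.tgt_unit _).symm
    (Filter.Eventually.of_forall fun r => (Γ.tgt_unit _).symm)).unique ha
    (Filter.Eventually.of_forall fun r => Γ.mul_unit _)

theorem tm_zero_right (g : G) {X : E} (hX : Γ.ts g X = 0) :
    Γ.tm g (Γ.unit (Γ.src g)) (X, 0) = X := by
  simpa [hX] using tm_tu (Γ := Γ) g X

theorem ts_td {p q : G} {X Y : E} (hc : Γ.src p = Γ.src q) (hXY : Γ.ts p X = Γ.ts q Y) :
    Γ.ts (Γ.mul p (Γ.inv q)) (Γ.td p q (X, Y)) = Γ.tt q Y := by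
  rw [td_apply, ts_tm (hc.trans (Γ.tgt_inv q).symm) (hXY.trans (tt_ti q Y).symm), ts_ti]

theorem tt_td {p q : G} {X Y : E} (hc : Γ.src p = Γ.src q) (hXY : Γ.ts p X = Γ.ts q Y) :
    Γ.tt (Γ.mul p (Γ.inv q)) (Γ.td p q (X, Y)) = Γ.tt p X := by
  rw [td_apply, tt_tm (hc.trans (Γ.tgt_inv q).symm) (hXY.trans (tt_ti q Y).symm)]

/-- The identity `(X Z⁻¹) (Y Z⁻¹)⁻¹ = X Y⁻¹` in the tangent groupoid. -/
theorem td_td {g h k : G} {X Y Z : E} (hgh : Γ.src g = Γ.tgt h) (hhk : Γ.src h = Γ.tgt k)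
    (hX : Γ.ts (Γ.mul g (Γ.mul h k)) X = Γ.ts k Z) (hY : Γ.ts (Γ.mul h k) Y = Γ.ts k Z) :
    Γ.td (Γ.mul g h) h (Γ.td (Γ.mul g (Γ.mul h k)) k (X, Z), Γ.td (Γ.mul h k) k (Y, Z)) =
      Γ.td (Γ.mul g (Γ.mul h k)) (Γ.mul h k) (X, Y) := by
  have e1 : Γ.src g = Γ.tgt (Γ.mul h k) := by rw [hgh, Γ.tgt_mul _ _ hhk]
  have e2 : Γ.src (Γ.mul h k) = Γ.src k := Γ.src_mul _ _ hhk
  have e3 : Γ.src (Γ.mul g (Γ.mul h k)) = Γ.src k := by rw [Γ.src_mul _ _ e1, e2]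
  have e4 : Γ.src (Γ.mul g h) = Γ.src h := Γ.src_mul _ _ hgh
  obtain ⟨z, hz⟩ := exists_hasVelocity k Z
  obtain ⟨y, hy, hyz⟩ := exists_velocity_src (velocity_src hz) e2 hY
  obtain ⟨x, hx, hxz⟩ := exists_velocity_src (velocity_src hz) e3 hX
  have h1 := velocity_div hx hz e3 hxz
  have h2 := velocity_div hy hz e2 hyz
  rw [Γ.div_eq h k hhk] at h2
  rw [← Γ.mul_assoc g h k hgh hhk, Γ.div_eq _ _ (e4.trans hhk)] at h1
  rw [← Γ.mul_assoc g h k hgh hhk]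
  rw [← Γ.mul_assoc g h k hgh hhk] at hx e3
  refine (velocity_div h1 h2 e4 ?_).unique
    (velocity_div hx hy (e3.trans e2.symm) (by filter_upwards [hyz, hxz] with r h h'; rw [h, h'])) ?_
  · filter_upwards [hyz, hxz] with r h h'
    rw [Γ.src_mul _ _ (by rw [h', Γ.tgt_inv]), Γ.src_mul _ _ (by rw [h, Γ.tgt_inv])]
  · filter_upwards [hyz, hxz] with r h h'
    have f1 : Γ.src (y r) = Γ.tgt (Γ.inv (z r)) := by rw [h, Γ.tgt_inv]
    have f2 : Γ.src (x r) = Γ.tgt (Γ.inv (y r)) := by rw [h', ← h, Γ.tgt_inv]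
    refine Γ.eq_div ?_ ?_
    · rw [Γ.src_mul _ _ f2, Γ.src_inv, Γ.tgt_mul _ _ f1]
    · rw [← Γ.mul_assoc _ _ _ (by rw [Γ.src_mul _ _ f2, Γ.src_inv]) f1,
        Γ.mul_assoc (x r) _ _ f2 (Γ.src_inv _), Γ.inv_mul, h, ← h', Γ.mul_unit]

/-- Right translation by `0_{g}` and then by `0_{g⁻¹}` is the identity. -/
theorem tm_tm_inv {p g : G} {X : E} (hc : Γ.src p = Γ.tgt g) (hX : Γ.ts p X = 0) :
    Γ.tm (Γ.mul p g) (Γ.inv g) (Γ.tm p g (X, 0), 0) = X := by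
  obtain ⟨a, ha, has⟩ := exists_velocity_src (HasVelocity.const (E := F) (Γ.src p)) rfl hX
  have hcg := HasVelocity.const (E := E) g
  have hci := HasVelocity.const (E := E) (Γ.inv g)
  have has' : ∀ᶠ r in 𝓝 0, Γ.src (a r) = Γ.tgt g := has.mono fun _ h => by rw [h, hc]
  refine (velocity_mul (velocity_mul ha hcg hc has') hci ?_ ?_).unique ha ?_
  · rw [Γ.src_mul _ _ hc, Γ.tgt_inv]
  · filter_upwards [has'] with r h
    rw [Γ.src_mul _ _ h, Γ.tgt_inv]
  · filter_upwards [has'] with r h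
    exact Γ.div_eq _ _ h

theorem tm_inv_tm {p g : G} {X : E} (hc : Γ.src p = Γ.src g) (hX : Γ.ts p X = 0) :
    Γ.tm (Γ.mul p (Γ.inv g)) g (Γ.tm p (Γ.inv g) (X, 0), 0) = X := by
  obtain ⟨a, ha, has⟩ := exists_velocity_src (HasVelocity.const (E := F) (Γ.src p)) rfl hX
  have hcg := HasVelocity.const (E := E) g
  have hci := HasVelocity.const (E := E) (Γ.inv g)
  have hc' : Γ.src p = Γ.tgt (Γ.inv g) := by rw [hc, Γ.tgt_inv]
  have has' : ∀ᶠ r in 𝓝 0, Γ.src (a r) = Γ.tgt (Γ.inv g) := has.mono fun r h => by rw [h, hc']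
  refine (velocity_mul (velocity_mul ha hci hc' has') hcg ?_ ?_).unique ha ?_
  · rw [Γ.src_mul _ _ hc', Γ.src_inv]
  · filter_upwards [has'] with r h
    rw [Γ.src_mul _ _ h, Γ.src_inv]
  · filter_upwards [has'] with r h
    rw [Γ.mul_assoc _ _ _ h (Γ.src_inv g), Γ.inv_mul, ← Γ.tgt_inv g, ← h, Γ.mul_unit]

/-- Differentiate a a⁻¹ = 1 along a curve a with velocity X: dm (X, di X) is the derivative of the
unit map at dt X = 0, hence zero. By linearity it also equals dm (X, 0) + dm (0, di X) = X + di X.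
-/
theorem ti_of_ts_eq_zero (x : M) {X : E} (hX : Γ.ts (Γ.unit x) X = 0)
    (hX' : Γ.tt (Γ.unit x) X = 0) : Γ.ti (Γ.unit x) X = -X := by
  obtain ⟨a, ha⟩ := exists_hasVelocity (Γ.unit x) X
  have hxx : Γ.src (Γ.unit x) = Γ.tgt (Γ.unit x) := by rw [Γ.src_unit, Γ.tgt_unit]
  have h1 : Γ.tm (Γ.unit x) (Γ.unit x) (X, Γ.ti (Γ.unit x) X) = 0 := by
    have h := velocity_mul ha (velocity_inv ha) (Γ.tgt_inv _).symm
      (Filter.Eventually.of_forall fun r => (Γ.tgt_inv _).symm)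
    rw [Γ.inv_unit] at h
    rw [h.unique (velocity_unit (velocity_tgt ha)) (Filter.Eventually.of_forall fun r => Γ.mul_inv _),
      hX', map_zero]
  have h2 : Γ.tm (Γ.unit x) (Γ.unit x) (X, 0) = X := by
    have := tm_zero_right (Γ.unit x) hX
    rwa [Γ.src_unit] at this
  have h3 : Γ.tm (Γ.unit x) (Γ.unit x) (0, Γ.ti (Γ.unit x) X) = Γ.ti (Γ.unit x) X := by
    have h0 : Γ.tt (Γ.unit x) (Γ.ti (Γ.unit x) X) = 0 := by
      have := tt_ti (Γ := Γ) (Γ.unit x) X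
      rwa [Γ.inv_unit, hX] at this
    obtain ⟨b, hb, hbt⟩ := exists_velocity_tgt (HasVelocity.const (E := F) (Γ.tgt (Γ.unit x))) rfl h0
    refine (velocity_mul (HasVelocity.const (Γ.unit x)) hb hxx ?_).unique hb ?_
    · filter_upwards [hbt] with r h
      rw [h, hxx]
    · filter_upwards [hbt] with r h
      rw [Γ.tgt_unit] at h
      rw [← h, Γ.unit_mul]
  have h4 : Γ.tm (Γ.unit x) (Γ.unit x) (X, Γ.ti (Γ.unit x) X) = X + Γ.ti (Γ.unit x) X := by
    have h5 : (X, Γ.ti (Γ.unit x) X) = (X, 0) + (0, Γ.ti (Γ.unit x) X) := by simp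
    rw [h5, map_add, h2, h3]
  rw [h1] at h4
  exact (neg_eq_of_add_eq_zero_right h4.symm).symm

/-- `dm̄ (r_{gh} X, 0_h) = r_g X` -/
theorem td_rTranslate_left {g h : G} {X : E} (hc : Γ.src g = Γ.tgt h)
    (hX : Γ.ts (Γ.unit (Γ.tgt g)) X = 0) :
    Γ.td (Γ.mul g h) h (Γ.tm (Γ.unit (Γ.tgt g)) (Γ.mul g h) (X, 0), 0) =
      Γ.tm (Γ.unit (Γ.tgt g)) g (X, 0) := by
  obtain ⟨a, ha, has⟩ := exists_velocity_src (HasVelocity.const (E := F) (Γ.tgt g)) (Γ.src_unit _) hX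
  have e1 : Γ.tgt (Γ.mul g h) = Γ.tgt g := Γ.tgt_mul _ _ hc
  have e2 : Γ.src (Γ.mul g h) = Γ.src h := Γ.src_mul _ _ hc
  have has' : ∀ᶠ r in 𝓝 0, Γ.src (a r) = Γ.tgt (Γ.mul g h) := has.mono fun r h => by rw [h, e1]
  have h1 := velocity_mul ha (HasVelocity.const (Γ.mul g h)) (by rw [Γ.src_unit, e1]) has'
  rw [← e1, Γ.unit_mul, e1] at h1
  refine (velocity_div h1 (HasVelocity.const h) e2 ?_).unique
    (velocity_mul ha (HasVelocity.const g) (Γ.src_unit _) has) ?_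
  · filter_upwards [has'] with r h
    rw [Γ.src_mul _ _ h, e2]
  · filter_upwards [has] with r h
    rw [← Γ.mul_assoc _ _ _ h hc, Γ.div_eq _ _ (by rw [Γ.src_mul _ _ h, hc])]

/-- `dm̄ (0_{gh}, r_h X) = l_g (di X)` -/
theorem td_rTranslate_right {g h : G} {X : E} (hc : Γ.src g = Γ.tgt h)
    (hX : Γ.ts (Γ.unit (Γ.tgt h)) X = 0) :
    Γ.td (Γ.mul g h) h (0, Γ.tm (Γ.unit (Γ.tgt h)) h (X, 0)) =
      Γ.tm g (Γ.unit (Γ.src g)) (0, Γ.ti (Γ.unit (Γ.src g)) X) := by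
  obtain ⟨a, ha, has⟩ := exists_velocity_src (HasVelocity.const (E := F) (Γ.tgt h)) (Γ.src_unit _) hX
  have e2 : Γ.src (Γ.mul g h) = Γ.src h := Γ.src_mul _ _ hc
  have h1 := velocity_mul ha (HasVelocity.const h) (Γ.src_unit _) has
  rw [Γ.unit_mul] at h1
  have h2 := velocity_inv (Γ := Γ) ha
  rw [← hc, Γ.inv_unit] at h2
  refine (velocity_div (HasVelocity.const (Γ.mul g h)) h1 e2 ?_).unique
    (velocity_mul (HasVelocity.const g) h2 (Γ.tgt_unit _).symm ?_) ?_
  · filter_upwards [has] with r hr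
    rw [Γ.src_mul _ _ hr, e2]
  · filter_upwards [has] with r hr
    rw [Γ.tgt_inv, hr, hc]
  · filter_upwards [has] with r hr
    have e3 : Γ.src g = Γ.tgt (Γ.inv (a r)) := by rw [hc, Γ.tgt_inv, hr]
    refine Γ.eq_div ?_ ?_
    · rw [Γ.src_mul _ _ e3, Γ.src_inv, Γ.tgt_mul _ _ hr]
    · rw [← Γ.mul_assoc _ _ _ (by rw [Γ.src_mul _ _ e3, Γ.src_inv]) hr,
        Γ.mul_assoc g _ _ e3 (Γ.src_inv _), Γ.inv_mul, hr, ← hc, Γ.mul_unit]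

/-- `r_g X + l_g (di Y)` is the velocity of a curve of the form `a g b⁻¹`. -/
theorem velocity_mul_mul_inv {g : G} {X Y : E} {a b : ℝ → G} (ha : HasVelocity a (Γ.unit (Γ.tgt g)) X)
    (hb : HasVelocity b (Γ.unit (Γ.src g)) Y) (has : ∀ᶠ r in 𝓝 0, Γ.src (a r) = Γ.tgt g)
    (hbs : ∀ᶠ r in 𝓝 0, Γ.src (b r) = Γ.src g) (hX : Γ.ts (Γ.unit (Γ.tgt g)) X = 0) :
    HasVelocity (fun r => Γ.mul (Γ.mul (a r) g) (Γ.inv (b r))) g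
      (Γ.tm (Γ.unit (Γ.tgt g)) g (X, 0) +
        Γ.tm g (Γ.unit (Γ.src g)) (0, Γ.ti (Γ.unit (Γ.src g)) Y)) := by
  have h1 := velocity_mul ha (HasVelocity.const g) (Γ.src_unit _) has
  have hts : Γ.ts g (Γ.tm (Γ.unit (Γ.tgt g)) g (X, 0)) = 0 := by
    have := ts_tm (Γ := Γ) (X := X) (Y := 0) (Γ.src_unit (Γ.tgt g)) (by rw [hX, map_zero])
    rwa [Γ.unit_mul, map_zero] at this
  rw [Γ.unit_mul] at h1
  have h2 := velocity_inv (Γ := Γ) hb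
  rw [Γ.inv_unit] at h2
  have h3 := velocity_mul h1 h2 (Γ.tgt_unit _).symm (by
    filter_upwards [has, hbs] with r h h'
    rw [Γ.src_mul _ _ h, Γ.tgt_inv, h'])
  rw [Γ.mul_unit] at h3
  convert h3 using 1
  -- By linearity dm (X', Y') = dm (X', 0) + dm (0, Y'), and right multiplication by the zero vector
  -- at a unit fixes X' when ds X' = 0.
  conv_lhs => rw [← tm_zero_right g hts]
  rw [← map_add, Prod.mk_add_mk, add_zero, zero_add]

/-- The expression `r_g X + l_g (di Y)` is multiplicative. -/
theorem td_mul_mul_inv {g h : G} {X Y Z : E} (hc : Γ.src g = Γ.tgt h)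
    (hX : Γ.ts (Γ.unit (Γ.tgt g)) X = 0) (hY : Γ.ts (Γ.unit (Γ.src g)) Y = 0)
    (hZ : Γ.ts (Γ.unit (Γ.src h)) Z = 0) :
    Γ.td (Γ.mul g h) h
      (Γ.tm (Γ.unit (Γ.tgt g)) (Γ.mul g h) (X, 0) +
        Γ.tm (Γ.mul g h) (Γ.unit (Γ.src h)) (0, Γ.ti (Γ.unit (Γ.src h)) Z),
      Γ.tm (Γ.unit (Γ.src g)) h (Y, 0) +
        Γ.tm h (Γ.unit (Γ.src h)) (0, Γ.ti (Γ.unit (Γ.src h)) Z)) =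
      Γ.tm (Γ.unit (Γ.tgt g)) g (X, 0) +
        Γ.tm g (Γ.unit (Γ.src g)) (0, Γ.ti (Γ.unit (Γ.src g)) Y) := by
  have e1 : Γ.tgt (Γ.mul g h) = Γ.tgt g := Γ.tgt_mul _ _ hc
  have e2 : Γ.src (Γ.mul g h) = Γ.src h := Γ.src_mul _ _ hc
  obtain ⟨a, ha, has⟩ := exists_velocity_src (HasVelocity.const (E := F) (Γ.tgt g)) (Γ.src_unit _) hX
  obtain ⟨m, hm, hms⟩ := exists_velocity_src (HasVelocity.const (E := F) (Γ.src g)) (Γ.src_unit _) hY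
  obtain ⟨b, hb, hbs⟩ := exists_velocity_src (HasVelocity.const (E := F) (Γ.src h)) (Γ.src_unit _) hZ
  have h1 := velocity_mul_mul_inv (Γ := Γ) (g := Γ.mul g h) (a := a) (b := b) (X := X) (Y := Z)
    (by rwa [e1]) (by rwa [e2]) (by rwa [e1]) (by rwa [e2]) (by rwa [e1])
  have h2 := velocity_mul_mul_inv (Γ := Γ) (g := h) (a := m) (b := b) (X := Y) (Y := Z)
    (by rwa [← hc]) hb (by rwa [← hc]) hbs (by rwa [← hc])
  rw [e1, e2] at h1
  rw [← hc] at h2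
  refine (velocity_div h1 h2 e2 ?_).unique (velocity_mul_mul_inv ha hm has hms hX) ?_
  · filter_upwards [has, hms, hbs] with r h3 h4 h5
    rw [Γ.src_mul, Γ.src_mul] <;> rw [Γ.tgt_inv, h5, Γ.src_mul]
    · rw [h4, hc]
    · rw [e2]
    · rw [h3, e1]
  · filter_upwards [has, hms, hbs] with r h3 h4 h5
    exact Γ.mul_div_div h3 hc (by rw [h4, hc]) h5

/-! ### Translations and division in terms of the tangent groupoid -/

/-- Both sides are the velocity of a(r) g, where a is a curve in the s-fibre with velocity X. The
same argument, with the appropriate curves, serves for left translation and division. -/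
theorem dRight_eq {h g : G} {X : E} (hc : Γ.src h = Γ.tgt g) (hX : Γ.ts h X = 0) :
    (Γ.dRight h g X : E) = Γ.tm h g (X, 0) := by
  obtain ⟨a, ha, has⟩ := exists_velocity_src (HasVelocity.const (E := F) (Γ.tgt g)) hc hX
  have hd : MDifferentiableWithinAt 𝓘(ℝ, E) 𝓘(ℝ, E) (fun p => Γ.mul p g)
      {p | Γ.src p = Γ.tgt g} h := by
    refine MDifferentiableWithinAt.comp h (Γ.mul_smooth.mdifferentiableOn (by simp) (h, g) hc)
      ((mdifferentiableAt_id.prodMk mdifferentiableAt_const).mdifferentiableWithinAt)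
      fun p hp => hp
  exact (ha.compWithin hd has).unique (velocity_mul ha (HasVelocity.const g) hc has)
    (Filter.EventuallyEq.rfl)

theorem dLeft_eq {g h : G} {X : E} (hc : Γ.src g = Γ.tgt h) (hX : Γ.tt h X = 0) :
    (Γ.dLeft g h X : E) = Γ.tm g h (0, X) := by
  obtain ⟨a, ha, hat⟩ := exists_velocity_tgt (HasVelocity.const (E := F) (Γ.src g)) hc.symm hX
  have hd : MDifferentiableWithinAt 𝓘(ℝ, E) 𝓘(ℝ, E) (fun p => Γ.mul g p)
      {p | Γ.tgt p = Γ.src g} h := by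
    refine MDifferentiableWithinAt.comp h (g := fun z : G × G => Γ.mul z.1 z.2)
      (f := fun p => (g, p)) (Γ.mul_smooth.mdifferentiableOn (by simp) (g, h) hc)
      ((mdifferentiableAt_const.prodMk mdifferentiableAt_id).mdifferentiableWithinAt)
      fun p hp => Eq.symm hp
  exact (ha.compWithin hd hat).unique (velocity_mul (HasVelocity.const g) ha hc
    (hat.mono fun r h => h.symm)) (Filter.EventuallyEq.rfl)

theorem dDiv_eq {p q : G} {X Y : E} (hc : Γ.src p = Γ.src q) (hXY : Γ.ts p X = Γ.ts q Y) :
    (Γ.dDiv p q (X, Y) : E) = Γ.td p q (X, Y) := by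
  obtain ⟨b, hb⟩ := exists_hasVelocity q Y
  obtain ⟨a, ha, hab⟩ := exists_velocity_src (velocity_src hb) hc hXY
  have hd : MDifferentiableWithinAt (𝓘(ℝ, E).prod 𝓘(ℝ, E)) 𝓘(ℝ, E)
      (fun z : G × G => Γ.mul z.1 (Γ.inv z.2)) {z | Γ.src z.1 = Γ.src z.2} (p, q) := by
    refine MDifferentiableWithinAt.comp (p, q)
      (g := fun z : G × G => Γ.mul z.1 z.2) (f := fun z : G × G => (z.1, Γ.inv z.2))
      (Γ.mul_smooth.mdifferentiableOn (by simp) (p, Γ.inv q) (hc.trans (Γ.tgt_inv q).symm))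
      ((mdifferentiableAt_fst.prodMk ((Γ.inv_smooth.mdifferentiableAt (by simp)).comp (p, q)
        mdifferentiableAt_snd)).mdifferentiableWithinAt)
      fun z hz => Eq.trans hz (Γ.tgt_inv _).symm
  exact (ha.compWithin₂ hd hb hab).unique (velocity_div ha hb hc hab) (Filter.EventuallyEq.rfl)

end Tangent

end LieGroupoid

/-! ### Smooth families of tangent vectors -/

section SmoothVec

variable {E F G M : Type*}
  [NormedAddCommGroup E] [NormedSpace ℝ E] [NormedAddCommGroup F] [NormedSpace ℝ F]
  [TopologicalSpace G] [ChartedSpace E G] [TopologicalSpace M] [ChartedSpace F M]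
  [IsManifold 𝓘(ℝ, E) ∞ G] [IsManifold 𝓘(ℝ, F) ∞ M]
  {E' H : Type*} [NormedAddCommGroup E'] [NormedSpace ℝ E'] [TopologicalSpace H] [ChartedSpace E' H]
  [IsManifold 𝓘(ℝ, E') ∞ H]
  {D N : Type*} [NormedAddCommGroup D] [NormedSpace ℝ D] [TopologicalSpace N] [ChartedSpace D N]

/-- The family of tangent vectors `X z` at the points `b z` depends smoothly on `z` at `z₀`. -/
def SmoothVecAt (b : N → G) (X : N → E) (z₀ : N) : Prop :=
  ContMDiffAt 𝓘(ℝ, D) 𝓘(ℝ, E).tangent ∞ (fun z => (⟨b z, X z⟩ : TangentBundle 𝓘(ℝ, E) G)) z₀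

namespace SmoothVecAt

variable {b : N → G} {X Y : N → E} {z₀ : N}

theorem base (h : SmoothVecAt (D := D) b X z₀) : ContMDiffAt 𝓘(ℝ, D) 𝓘(ℝ, E) ∞ b z₀ :=
  (Bundle.contMDiffAt_totalSpace.1 h).1

theorem congr {b' : N → G} {X' : N → E} (h : SmoothVecAt (D := D) b X z₀)
    (hX : ∀ᶠ z in 𝓝 z₀, b' z = b z ∧ X' z = X z) : SmoothVecAt (D := D) b' X' z₀ := by
  refine ContMDiffAt.congr_of_eventuallyEq h ?_
  filter_upwards [hX] with z hz
  obtain ⟨h1, h2⟩ := hz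
  have : ∀ {p q : G} {Z W : E}, p = q → Z = W →
      (⟨p, Z⟩ : TangentBundle 𝓘(ℝ, E) G) = ⟨q, W⟩ := by
    rintro p q Z W rfl rfl
    rfl
  exact this h1 h2

theorem zero (hb : ContMDiffAt 𝓘(ℝ, D) 𝓘(ℝ, E) ∞ b z₀) :
    SmoothVecAt (D := D) b (fun _ => (0 : E)) z₀ :=
  have h : ContMDiff 𝓘(ℝ, E) 𝓘(ℝ, E).tangent ∞
      (fun x => (⟨x, 0⟩ : TangentBundle 𝓘(ℝ, E) G)) :=
    Bundle.contMDiff_zeroSection ℝ (TangentSpace 𝓘(ℝ, E) : G → Type _)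
  h.contMDiffAt.comp z₀ hb

theorem smul_add {f : N → ℝ} (hf : ContMDiffAt 𝓘(ℝ, D) 𝓘(ℝ, ℝ) ∞ f z₀)
    (hX : SmoothVecAt (D := D) b X z₀) (hY : SmoothVecAt (D := D) b Y z₀) :
    SmoothVecAt (D := D) b (fun z => f z • X z + Y z) z₀ := by
  have h1 := Bundle.contMDiffAt_totalSpace.1 hX
  have h2 := Bundle.contMDiffAt_totalSpace.1 hY
  refine Bundle.contMDiffAt_totalSpace.2 ⟨h1.1, ?_⟩
  have h3 := hf.smul h1.2
  refine (h3.add h2.2).congr_of_eventuallyEq ?_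
  have hmem : b ⁻¹' (trivializationAt E (TangentSpace 𝓘(ℝ, E)) (b z₀)).baseSet ∈ 𝓝 z₀ :=
    h1.1.continuousAt.preimage_mem_nhds
      ((trivializationAt E (TangentSpace 𝓘(ℝ, E)) (b z₀)).open_baseSet.mem_nhds
        (FiberBundle.mem_baseSet_trivializationAt' _))
  filter_upwards [hmem] with w hw
  have hl := (trivializationAt E (TangentSpace 𝓘(ℝ, E)) (b z₀)).linear ℝ hw
  exact (hl.map_add _ _).trans (congrArg₂ (· + ·) (hl.map_smul _ _) rfl)

theorem add (hX : SmoothVecAt (D := D) b X z₀) (hY : SmoothVecAt (D := D) b Y z₀) :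
    SmoothVecAt (D := D) b (fun z => X z + Y z) z₀ := by
  simpa using smul_add (contMDiffAt_const (c := (1 : ℝ))) hX hY

theorem smul {f : N → ℝ} (hf : ContMDiffAt 𝓘(ℝ, D) 𝓘(ℝ, ℝ) ∞ f z₀)
    (hX : SmoothVecAt (D := D) b X z₀) : SmoothVecAt (D := D) b (fun z => f z • X z) z₀ := by
  simpa using smul_add hf hX (zero hX.base)

theorem const_smul (a : ℝ) (hX : SmoothVecAt (D := D) b X z₀) :
    SmoothVecAt (D := D) b (fun z => a • X z) z₀ :=
  smul contMDiffAt_const hX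

theorem neg (hX : SmoothVecAt (D := D) b X z₀) : SmoothVecAt (D := D) b (fun z => -X z) z₀ := by
  simpa using const_smul (-1) hX

theorem sub (hX : SmoothVecAt (D := D) b X z₀) (hY : SmoothVecAt (D := D) b Y z₀) :
    SmoothVecAt (D := D) b (fun z => X z - Y z) z₀ := by
  simpa [sub_eq_add_neg] using add hX (neg hY)

theorem sum {ι : Type*} (s : Finset ι) {Z : ι → N → E} (hb : ContMDiffAt 𝓘(ℝ, D) 𝓘(ℝ, E) ∞ b z₀)
    (h : ∀ i ∈ s, SmoothVecAt (D := D) b (Z i) z₀) :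
    SmoothVecAt (D := D) b (fun z => ∑ i ∈ s, Z i z) z₀ := by
  classical
  induction s using Finset.induction_on with
  | empty => simpa using zero hb
  | insert i s hi ih =>
    simp only [Finset.sum_insert hi]
    exact add (h i (Finset.mem_insert_self _ _))
      (ih fun j hj => h j (Finset.mem_insert_of_mem hj))

theorem map {f : G → M} (hf : ContMDiff 𝓘(ℝ, E) 𝓘(ℝ, F) ∞ f) (hX : SmoothVecAt (D := D) b X z₀) :
    SmoothVecAt (D := D) (fun z => f (b z)) (fun z => tderiv (E := E) (F := F) f (b z) (X z)) z₀ := by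
  have : IsManifold 𝓘(ℝ, E) 1 G := IsManifold.of_le (n := ∞) (by simp)
  have : IsManifold 𝓘(ℝ, F) 1 M := IsManifold.of_le (n := ∞) (by simp)
  exact (hf.contMDiff_tangentMap (m := ∞) (by simp)).contMDiffAt.comp z₀ hX

theorem map₂ {f : G × H → M} {U : Set (G × H)} (hU : IsOpen U)
    (hf : ContMDiffOn (𝓘(ℝ, E).prod 𝓘(ℝ, E')) 𝓘(ℝ, F) ∞ f U) {c : N → H} {Z : N → E'}
    (hX : SmoothVecAt (D := D) b X z₀) (hZ : SmoothVecAt (D := D) c Z z₀) (h₀ : (b z₀, c z₀) ∈ U) :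
    SmoothVecAt (D := D) (fun z => f (b z, c z))
      (fun z => tderivWithin₂ (E := E) (E' := E') (F' := F) f U (b z) (c z) (X z, Z z)) z₀ := by
  have : IsManifold 𝓘(ℝ, E) 1 G := IsManifold.of_le (n := ∞) (by simp)
  have : IsManifold 𝓘(ℝ, E') 1 H := IsManifold.of_le (n := ∞) (by simp)
  have : IsManifold 𝓘(ℝ, F) 1 M := IsManifold.of_le (n := ∞) (by simp)
  have h1 := hf.contMDiffOn_tangentMapWithin (m := ∞) (by simp) hU.uniqueMDiffOn
  have h2 : ContMDiffAt 𝓘(ℝ, D) (𝓘(ℝ, E).prod 𝓘(ℝ, E')).tangent ∞ (fun z =>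
      (equivTangentBundleProd 𝓘(ℝ, E) G 𝓘(ℝ, E') H).symm
        ((⟨b z, X z⟩ : TangentBundle 𝓘(ℝ, E) G), (⟨c z, Z z⟩ : TangentBundle 𝓘(ℝ, E') H))) z₀ :=
    contMDiff_equivTangentBundleProd_symm.contMDiffAt.comp z₀ (hX.prodMk hZ)
  have hopen : IsOpen ((Bundle.TotalSpace.proj :
      TangentBundle (𝓘(ℝ, E).prod 𝓘(ℝ, E')) (G × H) → G × H) ⁻¹' U) :=
    hU.preimage (FiberBundle.continuous_proj (E × E') (TangentSpace (𝓘(ℝ, E).prod 𝓘(ℝ, E'))))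
  exact (h1.contMDiffAt (hopen.mem_nhds h₀)).comp z₀ h2

end SmoothVecAt

end SmoothVec

/-! ### Smooth dependence of the operations of the tangent groupoid -/

namespace LieGroupoid

section SmoothTangent

variable {E F G M : Type*}
  [NormedAddCommGroup E] [NormedSpace ℝ E] [NormedAddCommGroup F] [NormedSpace ℝ F]
  [TopologicalSpace G] [ChartedSpace E G] [TopologicalSpace M] [ChartedSpace F M]
  [IsManifold 𝓘(ℝ, E) ∞ G] [IsManifold 𝓘(ℝ, F) ∞ M]
  {Γ : LieGroupoid E F G M}
  {D N : Type*} [NormedAddCommGroup D] [NormedSpace ℝ D] [TopologicalSpace N] [ChartedSpace D N]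
  {a b : N → G} {X Y : N → E} {z₀ : N}

theorem smoothVecAt_ts (h : SmoothVecAt (D := D) a X z₀) :
    SmoothVecAt (D := D) (fun z => Γ.src (a z)) (fun z => Γ.ts (a z) (X z)) z₀ :=
  h.map Γ.src_submersion.contMDiff

theorem smoothVecAt_tt (h : SmoothVecAt (D := D) a X z₀) :
    SmoothVecAt (D := D) (fun z => Γ.tgt (a z)) (fun z => Γ.tt (a z) (X z)) z₀ :=
  h.map Γ.tgt_submersion.contMDiff

theorem smoothVecAt_ti (h : SmoothVecAt (D := D) a X z₀) :
    SmoothVecAt (D := D) (fun z => Γ.inv (a z)) (fun z => Γ.ti (a z) (X z)) z₀ :=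
  h.map Γ.inv_smooth

/-- Multiplication is smooth only on the set of composable pairs, which need not be open, so
smoothness of tangent maps does not apply to it directly. With a local lift l of s, the map (p, q) ↦
l (p, t q) q is smooth on an open set and agrees with multiplication on composable pairs. Its
differential therefore agrees with dm on composable vectors. -/
theorem smoothVecAt_tm (hX : SmoothVecAt (D := D) a X z₀) (hY : SmoothVecAt (D := D) b Y z₀)
    (hc : ∀ z, Γ.src (a z) = Γ.tgt (b z)) (hXY : ∀ z, Γ.ts (a z) (X z) = Γ.tt (b z) (Y z)) :
    SmoothVecAt (D := D) (fun z => Γ.mul (a z) (b z)) (fun z => Γ.tm (a z) (b z) (X z, Y z)) z₀ := by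
  obtain ⟨U, l, hU, hpU, hl, hsl, hls⟩ := Γ.src_submersion.exists_local_lift (a z₀)
  let k : G × G → G × M := fun p => (p.1, Γ.tgt p.2)
  have hk : ContMDiff (𝓘(ℝ, E).prod 𝓘(ℝ, E)) (𝓘(ℝ, E).prod 𝓘(ℝ, F)) ∞ k :=
    contMDiff_fst.prodMk (Γ.tgt_submersion.contMDiff.comp contMDiff_snd)
  have hW : IsOpen (k ⁻¹' U) := hU.preimage hk.continuous
  let f : G × G → G := fun p => Γ.mul (l (k p)) p.2
  have hf : ContMDiffOn (𝓘(ℝ, E).prod 𝓘(ℝ, E)) 𝓘(ℝ, E) ∞ f (k ⁻¹' U) :=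
    Γ.mul_smooth.comp ((hl.comp hk.contMDiffOn fun _ h => h).prodMk contMDiffOn_snd)
      fun p hp => hsl _ hp
  have h₀ : (a z₀, b z₀) ∈ k ⁻¹' U := by
    change (a z₀, Γ.tgt (b z₀)) ∈ U
    rwa [← hc z₀]
  refine (hX.map₂ hW hf hY h₀).congr ?_
  have hev : ∀ᶠ z in 𝓝 z₀, (a z, b z) ∈ k ⁻¹' U :=
    (hX.base.continuousAt.prodMk hY.base.continuousAt).eventually_mem (hW.mem_nhds h₀)
  filter_upwards [hev] with z hz
  have hlz : ∀ p q, Γ.src p = Γ.tgt q → f (p, q) = Γ.mul p q := fun p q h => by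
    change Γ.mul (l (p, Γ.tgt q)) q = _
    rw [← h, hls]
  refine ⟨(hlz _ _ (hc z)).symm, ?_⟩
  obtain ⟨c, d, hcv, hdv, hcd⟩ := exists_velocity_mul (hc z) (hXY z)
  refine (velocity_mul hcv hdv (hc z) hcd).unique
    (hcv.compWithin₂ ((hf _ hz).mdifferentiableWithinAt (by simp)) hdv ?_) ?_
  · exact (hcv.tendsto.prodMk_nhds hdv.tendsto).eventually_mem (hW.mem_nhds hz)
  · filter_upwards [hcd] with r hr using (hlz _ _ hr).symm

theorem smoothVecAt_td (hX : SmoothVecAt (D := D) a X z₀) (hY : SmoothVecAt (D := D) b Y z₀)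
    (hc : ∀ z, Γ.src (a z) = Γ.src (b z)) (hXY : ∀ z, Γ.ts (a z) (X z) = Γ.ts (b z) (Y z)) :
    SmoothVecAt (D := D) (fun z => Γ.mul (a z) (Γ.inv (b z)))
      (fun z => Γ.td (a z) (b z) (X z, Y z)) z₀ :=
  smoothVecAt_tm hX (smoothVecAt_ti hY) (fun z => (hc z).trans (Γ.tgt_inv _).symm)
    fun z => (hXY z).trans (tt_ti _ _).symm

variable (Γ) in
/-- The linear right inverse of `ds` at `g` given by a local lift `l` of points along `s`. -/
def splittingOfLift (U : Set (G × M)) (l : G × M → G) (g : G) : F →L[ℝ] E :=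
  (tderivWithin₂ (E := E) (E' := F) (F' := E) l U g (Γ.src g)).comp (ContinuousLinearMap.inr ℝ E F)

/-- Differentiate s (l (g, y)) = y along a curve y starting at s g. -/
theorem ts_splittingOfLift {U : Set (G × M)} {l : G × M → G} (hU : IsOpen U)
    (hl : ContMDiffOn (𝓘(ℝ, E).prod 𝓘(ℝ, F)) 𝓘(ℝ, E) ∞ l U) (hls : ∀ a, l (a, Γ.src a) = a)
    (hsl : ∀ z ∈ U, Γ.src (l z) = z.2) {g : G} (hg : (g, Γ.src g) ∈ U)
    (v : F) : Γ.ts g (Γ.splittingOfLift U l g v) = v := by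
  obtain ⟨y, hy⟩ := exists_hasVelocity (Γ.src g) v
  have hev : ∀ᶠ r in 𝓝 0, (g, y r) ∈ U :=
    ((HasVelocity.const (E := E) g).tendsto.prodMk_nhds hy.tendsto).eventually_mem
      (hU.mem_nhds hg)
  have h1 := (HasVelocity.const (E := E) g).compWithin₂
    ((hl _ hg).mdifferentiableWithinAt (by simp)) hy hev
  rw [hls g] at h1
  exact (velocity_src h1).unique hy (hev.mono fun r hr => hsl _ hr)

theorem smoothVecAt_splittingOfLift {U : Set (G × M)} {l : G × M → G} (hU : IsOpen U)
    (hl : ContMDiffOn (𝓘(ℝ, E).prod 𝓘(ℝ, F)) 𝓘(ℝ, E) ∞ l U) (hls : ∀ a, l (a, Γ.src a) = a)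
    {V : N → F} (h₀ : (a z₀, Γ.src (a z₀)) ∈ U)
    (ha : ContMDiffAt 𝓘(ℝ, D) 𝓘(ℝ, E) ∞ a z₀)
    (hV : SmoothVecAt (D := D) (fun z => Γ.src (a z)) V z₀) :
    SmoothVecAt (D := D) a (fun z => Γ.splittingOfLift U l (a z) (V z)) z₀ :=
  ((SmoothVecAt.zero ha).map₂ hU hl hV h₀).congr (Filter.Eventually.of_forall fun _ =>
    ⟨(hls _).symm, rfl⟩)

end SmoothTangent

end LieGroupoid

/-! ### Local frames of the tangent bundle -/

section Frame

variable {E G : Type*} [NormedAddCommGroup E] [NormedSpace ℝ E] [TopologicalSpace G]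
  [ChartedSpace E G] [IsManifold 𝓘(ℝ, E) ∞ G]
  {D N : Type*} [NormedAddCommGroup D] [NormedSpace ℝ D] [TopologicalSpace N] [ChartedSpace D N]

/-- The tangent bundle is trivial over this neighbourhood of `g₀`. -/
def frameDomain (g₀ : G) : Set G :=
  (trivializationAt E (TangentSpace 𝓘(ℝ, E) : G → Type _) g₀).baseSet

/-- The local frame of the tangent bundle near `g₀`. -/
def tframe (g₀ g : G) : E →L[ℝ] E :=
  (trivializationAt E (TangentSpace 𝓘(ℝ, E) : G → Type _) g₀).symmL ℝ g

/-- The coordinates of tangent vectors in the local frame near `g₀`. -/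
def tcoframe (g₀ g : G) : E →L[ℝ] E :=
  (trivializationAt E (TangentSpace 𝓘(ℝ, E) : G → Type _) g₀).continuousLinearMapAt ℝ g

theorem isOpen_frameDomain (g₀ : G) : IsOpen (frameDomain (E := E) g₀) :=
  (trivializationAt E (TangentSpace 𝓘(ℝ, E) : G → Type _) g₀).open_baseSet

theorem mem_frameDomain (g₀ : G) : g₀ ∈ frameDomain (E := E) g₀ :=
  FiberBundle.mem_baseSet_trivializationAt' _

theorem tframe_tcoframe {g₀ g : G} (hg : g ∈ frameDomain (E := E) g₀) (v : E) :
    tframe g₀ g (tcoframe g₀ g v) = v :=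
  (trivializationAt E (TangentSpace 𝓘(ℝ, E) : G → Type _) g₀).symmL_continuousLinearMapAt hg v

theorem smoothVecAt_tframe {g₀ : G} {b : N → G} {w : N → E} {z₀ : N}
    (h₀ : b z₀ ∈ frameDomain (E := E) g₀) (hb : ContMDiffAt 𝓘(ℝ, D) 𝓘(ℝ, E) ∞ b z₀)
    (hw : ContMDiffAt 𝓘(ℝ, D) 𝓘(ℝ, E) ∞ w z₀) :
    SmoothVecAt (D := D) b (fun z => tframe g₀ (b z) (w z)) z₀ := by
  set e := trivializationAt E (TangentSpace 𝓘(ℝ, E) : G → Type _) g₀ with he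
  let X : N → E := fun z => tframe g₀ (b z) (w z)
  refine (e.contMDiffAt_iff (f := fun z => (⟨b z, X z⟩ : TangentBundle 𝓘(ℝ, E) G))
    (e.mem_source.2 h₀)).2 ⟨hb, ?_⟩
  refine hw.congr_of_eventuallyEq ?_
  filter_upwards [hb.continuousAt.eventually_mem (e.open_baseSet.mem_nhds h₀)] with z hz
  have h1 := e.continuousLinearMapAt_symmL (R := ℝ) hz (w z)
  exact (congrFun (e.coe_linearMapAt_of_mem (R := ℝ) hz) _).symm.trans h1

theorem contMDiffAt_tcoframe {g₀ : G} {b : N → G} {X : N → E} {z₀ : N}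
    (h₀ : b z₀ ∈ frameDomain (E := E) g₀) (hX : SmoothVecAt (D := D) b X z₀) :
    ContMDiffAt 𝓘(ℝ, D) 𝓘(ℝ, E) ∞ (fun z => tcoframe g₀ (b z) (X z)) z₀ := by
  set e := trivializationAt E (TangentSpace 𝓘(ℝ, E) : G → Type _) g₀ with he
  have h1 := ((e.contMDiffAt_iff (f := fun z => (⟨b z, X z⟩ : TangentBundle 𝓘(ℝ, E) G))
    (e.mem_source.2 h₀)).1 hX).2
  refine h1.congr_of_eventuallyEq ?_
  filter_upwards [hX.base.continuousAt.eventually_mem (e.open_baseSet.mem_nhds h₀)] with z hz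
  exact congrFun (e.coe_linearMapAt_of_mem (R := ℝ) hz) (X z)

end Frame

/-- In finite dimension the operator is the sum over a basis of the coordinate functionals times its
values on basis vectors. -/
theorem contMDiffAt_clm_of_apply {D N V W : Type*} [NormedAddCommGroup D] [NormedSpace ℝ D]
    [TopologicalSpace N] [ChartedSpace D N] [NormedAddCommGroup V] [NormedSpace ℝ V]
    [FiniteDimensional ℝ V] [NormedAddCommGroup W] [NormedSpace ℝ W] {f : N → V →L[ℝ] W} {z₀ : N}
    (h : ∀ v, ContMDiffAt 𝓘(ℝ, D) 𝓘(ℝ, W) ∞ (fun z => f z v) z₀) :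
    ContMDiffAt 𝓘(ℝ, D) 𝓘(ℝ, V →L[ℝ] W) ∞ f z₀ := by
  let B := Module.finBasis ℝ V
  let c : Fin (Module.finrank ℝ V) → V →L[ℝ] ℝ := fun i => LinearMap.toContinuousLinearMap (B.coord i)
  have hf : f = fun z => ∑ i, ContinuousLinearMap.smulRightL ℝ V W (c i) (f z (B i)) := by
    funext z
    ext v
    conv_lhs => rw [← B.sum_repr v, map_sum]
    simp [c]
  rw [hf]
  refine ContMDiffAt.sum fun i _ => ?_
  exact ((ContinuousLinearMap.smulRightL ℝ V W (c i)).contMDiff.contMDiffAt).comp z₀ (h (B i))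

/-! ### Gluing fibrewise linear maps -/

section Glue

variable {E F G M : Type*}
  [NormedAddCommGroup E] [NormedSpace ℝ E] [NormedAddCommGroup F] [NormedSpace ℝ F]
  [TopologicalSpace G] [ChartedSpace E G] [TopologicalSpace M] [ChartedSpace F M]
  [IsManifold 𝓘(ℝ, E) ∞ G] [IsManifold 𝓘(ℝ, F) ∞ M]
  {C B : Type*} [NormedAddCommGroup C] [NormedSpace ℝ C] [TopologicalSpace B] [ChartedSpace C B]

/-- The linear maps `L b : T_{p b} M → T_{q b} G` depend smoothly on `b ∈ U`; this is tested on
smooth families of vectors. -/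
def SmoothHomOn (p : B → M) (q : B → G) (L : B → F →L[ℝ] E) (U : Set B) : Prop :=
  ∀ (n : ℕ) (β : EuclideanSpace ℝ (Fin n) → B) (V : EuclideanSpace ℝ (Fin n) → F)
    (z₀ : EuclideanSpace ℝ (Fin n)), β z₀ ∈ U → ContMDiffAt (𝓡 n) 𝓘(ℝ, C) ∞ β z₀ →
    SmoothVecAt (D := EuclideanSpace ℝ (Fin n)) (fun z => p (β z)) V z₀ →
    SmoothVecAt (D := EuclideanSpace ℝ (Fin n)) (fun z => q (β z)) (fun z => L (β z) (V z)) z₀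

/-- A partition of unity averages the local families, and fibrewise convexity keeps the average
inside `S b`. It applies to splittings because being a right inverse is an affine condition. -/
theorem exists_smoothHomOn_univ [FiniteDimensional ℝ C] [IsManifold 𝓘(ℝ, C) ∞ B] [T2Space B]
    [SecondCountableTopology B] {p : B → M} {q : B → G} (hq : ContMDiff 𝓘(ℝ, C) 𝓘(ℝ, E) ∞ q)
    (S : ∀ _ : B, Set (F →L[ℝ] E)) (hS : ∀ b, Convex ℝ (S b))
    (hloc : ∀ b₀, ∃ U, IsOpen U ∧ b₀ ∈ U ∧ ∃ L : B → F →L[ℝ] E,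
      (∀ b ∈ U, L b ∈ S b) ∧ SmoothHomOn (C := C) p q L U) :
    ∃ L : B → F →L[ℝ] E, (∀ b, L b ∈ S b) ∧ SmoothHomOn (C := C) p q L univ := by
  have : LocallyCompactSpace B := Manifold.locallyCompact_of_finiteDimensional 𝓘(ℝ, C)
  choose U hU hmem L hLS hL using hloc
  obtain ⟨f, hf⟩ := SmoothPartitionOfUnity.exists_isSubordinate 𝓘(ℝ, C) isClosed_univ U hU
    fun b _ => mem_iUnion.2 ⟨b, hmem b⟩
  refine ⟨fun b => ∑ᶠ i, f i b • L i b, fun b => ?_, ?_⟩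
  · refine f.finsum_smul_mem_convex (mem_univ b) (fun i hi => hLS i b ?_) (hS b)
    exact hf i (subset_tsupport _ hi)
  · intro n β V z₀ _ hβ hV
    obtain ⟨T, hT⟩ := f.toPartitionOfUnity.locallyFinite.exists_finset_support (β z₀)
    have hsum : SmoothVecAt (D := EuclideanSpace ℝ (Fin n)) (fun z => q (β z))
        (fun z => ∑ i ∈ T, f i (β z) • L i (β z) (V z)) z₀ := by
      have hqb : ContMDiffAt (𝓡 n) 𝓘(ℝ, E) ∞ (fun z => q (β z)) z₀ := hq.contMDiffAt.comp z₀ hβ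
      refine SmoothVecAt.sum T hqb fun i _ => ?_
      -- The family `L i` is known to be smooth only on `U i`. Off the support of `f i` the summand
      -- vanishes near z₀, so nothing is asked of `L i` there.
      by_cases hi : β z₀ ∈ tsupport (f i)
      · exact SmoothVecAt.smul ((f i).contMDiff.contMDiffAt.comp z₀ hβ) (hL i n β V z₀ (hf i hi) hβ hV)
      · refine (SmoothVecAt.zero hqb).congr ?_
        filter_upwards [hβ.continuousAt.eventually_mem
          ((isClosed_tsupport (f i)).isOpen_compl.mem_nhds hi)] with z hz
        refine ⟨rfl, ?_⟩
        have h0 : f i (β z) = 0 := image_eq_zero_of_notMem_tsupport hz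
        rw [h0, zero_smul]
    refine hsum.congr ?_
    filter_upwards [hβ.continuousAt.eventually hT] with z hz
    refine ⟨rfl, ?_⟩
    have : ∑ᶠ i, f i (β z) • L i (β z) = ∑ i ∈ T, f i (β z) • L i (β z) :=
      finsum_eq_sum_of_support_subset _ fun i hi => hz fun h0 => hi (by
        have h0' : f i (β z) = 0 := h0
        simp only [h0', zero_smul])
    rw [this, sum_apply]
    rfl

end Glue

/-! ### Smooth splittings of the source map and of the anchor -/

namespace LieGroupoid

section Anchor

variable {E F G M : Type*}
  [NormedAddCommGroup E] [NormedSpace ℝ E] [NormedAddCommGroup F] [NormedSpace ℝ F]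
  [TopologicalSpace G] [ChartedSpace E G] [TopologicalSpace M] [ChartedSpace F M]
  (Γ : LieGroupoid E F G M)

theorem mem_imAnchor {x : M} {v : F} : (v : TangentSpace 𝓘(ℝ, F) x) ∈ Γ.imAnchor x ↔
    ∃ a : E, Γ.ts (Γ.unit x) a = 0 ∧ Γ.tt (Γ.unit x) a = v := by
  constructor
  · rintro ⟨⟨a, ha⟩, hav⟩
    exact ⟨a, ha, (fcast_tangent (E := F) (Γ.tgt_unit x) _).symm.trans hav⟩
  · rintro ⟨a, ha, hav⟩
    exact ⟨⟨a, ha⟩, (fcast_tangent (E := F) (Γ.tgt_unit x) _).trans hav⟩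

end Anchor

section Splittings

variable {E F G M : Type*}
  [NormedAddCommGroup E] [NormedSpace ℝ E] [FiniteDimensional ℝ E]
  [NormedAddCommGroup F] [NormedSpace ℝ F] [FiniteDimensional ℝ F]
  [TopologicalSpace G] [ChartedSpace E G] [IsManifold 𝓘(ℝ, E) ∞ G]
  [T2Space G] [SecondCountableTopology G]
  [TopologicalSpace M] [ChartedSpace F M] [IsManifold 𝓘(ℝ, F) ∞ M]
  [T2Space M] [SecondCountableTopology M]
  (Γ : LieGroupoid E F G M)

/-- `ds` has a smooth linear right inverse. -/
theorem exists_splitting_src : ∃ τ : G → F →L[ℝ] E, (∀ g v, Γ.ts g (τ g v) = v) ∧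
    SmoothHomOn (C := E) Γ.src id τ univ := by
  refine exists_smoothHomOn_univ contMDiff_id (fun g => {L | ∀ v, Γ.ts g (L v) = v}) ?_ ?_
  · intro g L hL L' hL' a b _ _ hab v
    simp only [add_apply, smul_apply, map_add, map_smul,
      hL v, hL' v, ← add_smul, hab, one_smul]
  · intro g₀
    obtain ⟨U, l, hU, hpU, hl, hsl, hls⟩ := Γ.src_submersion.exists_local_lift g₀
    have hc : Continuous fun g : G => (g, Γ.src g) :=
      continuous_id.prodMk Γ.src_submersion.contMDiff.continuous
    exact ⟨_, hU.preimage hc, hpU, Γ.splittingOfLift U l,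
      fun g hg v => ts_splittingOfLift hU hl hls hsl hg v,
      fun n β V z₀ h₀ hβ hV => smoothVecAt_splittingOfLift hU hl hls h₀ hβ hV⟩

variable {Γ}

section AnchorFrame

variable {V R : Type*} [NormedAddCommGroup V] [NormedSpace ℝ V] [FiniteDimensional ℝ V]
  [NormedAddCommGroup R] [NormedSpace ℝ R]
  {D N : Type*} [NormedAddCommGroup D] [NormedSpace ℝ D] [TopologicalSpace N] [ChartedSpace D N]

variable (Γ) in
/-- An extension of `J : V → A_{x₀}` to a smooth family of linear maps `V → A_x`. -/
def algebroidFrame (U : Set (G × M)) (l : G × M → G) (x₀ : M) (J : V →L[ℝ] E) (x : M) : V →L[ℝ] E :=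
  (ContinuousLinearMap.id ℝ E - (Γ.splittingOfLift U l (Γ.unit x)).comp (Γ.ts (Γ.unit x))).comp
    ((tframe (Γ.unit x₀) (Γ.unit x)).comp
      ((tcoframe (Γ.unit x₀) (Γ.unit x₀)).comp J))

theorem smoothVecAt_algebroidFrame {U : Set (G × M)} {l : G × M → G} (hU : IsOpen U)
    (hl : ContMDiffOn (𝓘(ℝ, E).prod 𝓘(ℝ, F)) 𝓘(ℝ, E) ∞ l U) (hls : ∀ a, l (a, Γ.src a) = a)
    {x₀ : M} (J : V →L[ℝ] E) {β : N → M} {w : N → V} {z₀ : N} (h₁ : (Γ.unit (β z₀), β z₀) ∈ U)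
    (h₂ : Γ.unit (β z₀) ∈ frameDomain (E := E) (Γ.unit x₀))
    (hβ : ContMDiffAt 𝓘(ℝ, D) 𝓘(ℝ, F) ∞ β z₀) (hw : ContMDiffAt 𝓘(ℝ, D) 𝓘(ℝ, V) ∞ w z₀) :
    SmoothVecAt (D := D) (fun z => Γ.unit (β z))
      (fun z => Γ.algebroidFrame U l x₀ J (β z) (w z)) z₀ := by
  have hu : ContMDiffAt 𝓘(ℝ, D) 𝓘(ℝ, E) ∞ (fun z => Γ.unit (β z)) z₀ :=
    Γ.unit_smooth.contMDiffAt.comp z₀ hβ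
  have h3 := smoothVecAt_tframe (b := fun z => Γ.unit (β z)) h₂ hu
    (((tcoframe (Γ.unit x₀) (Γ.unit x₀)).comp J).contMDiff.contMDiffAt.comp z₀ hw)
  exact h3.sub (smoothVecAt_splittingOfLift hU hl hls (by rwa [Γ.src_unit]) hu
    (smoothVecAt_ts h3))

theorem contMDiffAt_algebroidFrame {U : Set (G × M)} {l : G × M → G} (hU : IsOpen U)
    (hl : ContMDiffOn (𝓘(ℝ, E).prod 𝓘(ℝ, F)) 𝓘(ℝ, E) ∞ l U) (hls : ∀ a, l (a, Γ.src a) = a)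
    {x₀ : M} (J : V →L[ℝ] E) (P : F →L[ℝ] R) {β : N → M} {z₀ : N} (h₁ : (Γ.unit (β z₀), β z₀) ∈ U)
    (h₂ : Γ.unit (β z₀) ∈ frameDomain (E := E) (Γ.unit x₀)) (h₃ : β z₀ ∈ frameDomain (E := F) x₀)
    (hβ : ContMDiffAt 𝓘(ℝ, D) 𝓘(ℝ, F) ∞ β z₀) :
    ContMDiffAt 𝓘(ℝ, D) 𝓘(ℝ, V →L[ℝ] R) ∞ (fun z => (P.comp (tcoframe x₀ (β z))).comp
      ((Γ.tt (Γ.unit (β z))).comp (Γ.algebroidFrame U l x₀ J (β z)))) z₀ := by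
  refine contMDiffAt_clm_of_apply fun v => ?_
  have h4 := smoothVecAt_tt (Γ := Γ) (a := fun z => Γ.unit (β z)) (smoothVecAt_algebroidFrame hU hl hls J h₁ h₂ hβ
    (contMDiffAt_const (c := v)))
  simp only [Γ.tgt_unit] at h4
  exact P.contMDiff.contMDiffAt.comp z₀ (contMDiffAt_tcoframe (b := β) h₃ h4)

end AnchorFrame

variable (Γ)

/-- A regular groupoid has a smooth linear right inverse of the anchor on its image. -/
theorem exists_splitting_anchor (hΓ : Γ.IsRegular) : ∃ κ : M → F →L[ℝ] E,
    (∀ x v, Γ.ts (Γ.unit x) (κ x v) = 0) ∧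
    (∀ x (v : F), (v : TangentSpace 𝓘(ℝ, F) x) ∈ Γ.imAnchor x → Γ.tt (Γ.unit x) (κ x v) = v) ∧
    SmoothHomOn (C := F) id Γ.unit κ univ := by
  suffices h : ∃ κ : M → F →L[ℝ] E, (∀ x, κ x ∈ {L : F →L[ℝ] E | (∀ v, Γ.ts (Γ.unit x) (L v) = 0) ∧
      ∀ v : F, (v : TangentSpace 𝓘(ℝ, F) x) ∈ Γ.imAnchor x → Γ.tt (Γ.unit x) (L v) = v}) ∧
      SmoothHomOn (C := F) id Γ.unit κ univ by
    obtain ⟨κ, h1, h2⟩ := h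
    exact ⟨κ, fun x => (h1 x).1, fun x => (h1 x).2, h2⟩
  refine exists_smoothHomOn_univ Γ.unit_smooth _ ?_ ?_
  · rintro x L ⟨hL1, hL2⟩ L' ⟨hL1', hL2'⟩ a b _ _ hab
    refine ⟨fun v => ?_, fun v hv => ?_⟩
    · simp only [add_apply, smul_apply, map_add, map_smul,
        hL1 v, hL1' v, smul_zero, add_zero]
    · simp only [add_apply, smul_apply, map_add, map_smul,
        hL2 v hv, hL2' v hv, ← add_smul, hab, one_smul]
  intro x₀
  obtain ⟨d, hd⟩ := hΓ
  obtain ⟨U, l, hU, hpU, hl, hsl, hls⟩ := Γ.src_submersion.exists_local_lift (Γ.unit x₀)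
  let R : Submodule ℝ F := Γ.imAnchor x₀
  -- a section of the anchor at `x₀` and a projection onto its image
  obtain ⟨j, hj1, hj2⟩ : ∃ j : R →ₗ[ℝ] E, (∀ v, Γ.ts (Γ.unit x₀) (j v) = 0) ∧
      ∀ v, Γ.tt (Γ.unit x₀) (j v) = (v : F) := by
    obtain ⟨σ, hσ⟩ := (Γ.anchor x₀).rangeRestrict.exists_rightInverse_of_surjective
      (LinearMap.range_rangeRestrict _)
    refine ⟨(Γ.algebroid x₀).subtype ∘ₗ σ, fun v => (σ v).2, fun v => ?_⟩
    have h := congrArg Subtype.val (LinearMap.congr_fun hσ v)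
    exact (fcast_tangent (E := F) (Γ.tgt_unit x₀) _).symm.trans h
  obtain ⟨pr, hpr⟩ : ∃ pr : F →ₗ[ℝ] R, ∀ v : R, pr v = v := by
    obtain ⟨pr, h⟩ := R.subtype.exists_leftInverse_of_injective (Submodule.ker_subtype R)
    exact ⟨pr, fun v => LinearMap.congr_fun h v⟩
  -- The frame at x₀ undoes the coordinates taken at x₀ in π below, so π x₀ is the projection `pr`.
  let P : F →L[ℝ] R := (LinearMap.toContinuousLinearMap pr).comp (tframe x₀ x₀)
  let ε : M → R →L[ℝ] E := Γ.algebroidFrame U l x₀ (LinearMap.toContinuousLinearMap j)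
  let π : M → F →L[ℝ] R := fun x => P.comp (tcoframe x₀ x)
  -- `B x` pushes the family ε x of elements of A_x forward by the anchor and projects back to `R`.
  -- It is the identity at x₀, hence invertible near x₀.
  let B : M → R →L[ℝ] R := fun x => (π x).comp ((Γ.tt (Γ.unit x)).comp (ε x))
  let W : Set M := (fun x => (Γ.unit x, x)) ⁻¹' U ∩ Γ.unit ⁻¹' (frameDomain (E := E) (Γ.unit x₀)) ∩
    frameDomain (E := F) x₀
  have hW : IsOpen W := ((hU.preimage (Γ.unit_smooth.continuous.prodMk continuous_id)).inter
    ((isOpen_frameDomain _).preimage Γ.unit_smooth.continuous)).inter (isOpen_frameDomain _)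
  have hx₀ : x₀ ∈ W := by
    refine ⟨⟨?_, mem_frameDomain _⟩, mem_frameDomain _⟩
    have h := hpU
    rw [Γ.src_unit] at h
    exact h
  have hεs : ∀ x ∈ W, ∀ w, Γ.ts (Γ.unit x) (ε x w) = 0 := by
    intro x hx w
    have hxU : (Γ.unit x, Γ.src (Γ.unit x)) ∈ U := by rw [Γ.src_unit]; exact hx.1.1
    simp only [ε, algebroidFrame, ContinuousLinearMap.comp_apply, sub_apply,
      ContinuousLinearMap.id_apply, map_sub]
    rw [ts_splittingOfLift hU hl hls hsl hxU, sub_self]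
  have hB₀ : B x₀ = 1 := by
    ext w
    have h1 : ε x₀ w = j w := by
      simp only [ε, algebroidFrame, ContinuousLinearMap.comp_apply, sub_apply,
        ContinuousLinearMap.id_apply, LinearMap.coe_toContinuousLinearMap']
      rw [tframe_tcoframe (mem_frameDomain _), hj1, map_zero, sub_zero]
    simp only [B, π, P, ContinuousLinearMap.comp_apply, h1, hj2]
    rw [tframe_tcoframe (mem_frameDomain _), LinearMap.coe_toContinuousLinearMap', hpr]
    rfl
  have hBc : ContinuousAt B x₀ :=
    (contMDiffAt_algebroidFrame (D := F) (β := id) hU hl hls _ P hx₀.1.1 hx₀.1.2 hx₀.2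
      contMDiffAt_id).continuousAt
  have hunit : ∀ᶠ x in 𝓝 x₀, IsUnit (B x) :=
    hBc.eventually ((Units.isOpen (R := R →L[ℝ] R)).mem_nhds (show IsUnit (B x₀) by
      rw [hB₀]; exact isUnit_one))
  obtain ⟨O, hO, hOo, hxO⟩ := mem_nhds_iff.1 hunit
  refine ⟨W ∩ O, hW.inter hOo, ⟨hx₀, hxO⟩,
    -- The local splitting is ε B⁻¹ π. If v = ρ (ε w), then π v = B w and the formula returns ε w,
    -- so it inverts ρ on everything that ρ ∘ ε reaches.
    fun x => (ε x).comp ((Ring.inverse (B x)).comp (π x)), ?_, ?_⟩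
  · rintro x ⟨hxW, hxO⟩
    refine ⟨fun v => hεs x hxW _, fun v hv => ?_⟩
    have hBu : IsUnit (B x) := hO hxO
    let T : R →ₗ[ℝ] Γ.imAnchor x := LinearMap.codRestrict (Γ.imAnchor x)
      ((Γ.tt (Γ.unit x)).comp (ε x)).toLinearMap
      fun w => Γ.mem_imAnchor.2 ⟨ε x w, hεs x hxW w, rfl⟩
    have hTB : ∀ w, π x (T w).1 = B x w := fun w => rfl
    have hinv : ∀ w, Ring.inverse (B x) (B x w) = w := fun w =>
      congrArg (fun S : R →L[ℝ] R => S w) (Ring.inverse_mul_cancel _ hBu)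
    have hTi : Function.Injective T := fun w w' h => by
      rw [← hinv w, ← hinv w', ← hTB, ← hTB, h]
    -- Here regularity enters. `T` = ρ ∘ ε is injective because π ∘ T = B is invertible, and
    -- equality of dimensions makes it onto Im ρ at x. Without it Im ρ could be larger near x₀ than
    -- at x₀.
    have hfin : Module.finrank ℝ R = Module.finrank ℝ (Γ.imAnchor x) := (hd x₀).trans (hd x).symm
    have : FiniteDimensional ℝ (TangentSpace 𝓘(ℝ, F) x) := ‹FiniteDimensional ℝ F›
    obtain ⟨w, hw⟩ := (LinearMap.injective_iff_surjective_of_finrank_eq_finrank hfin).1 hTi ⟨v, hv⟩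
    have hwv : (T w).1 = v := congrArg Subtype.val hw
    change Γ.tt (Γ.unit x) (ε x (Ring.inverse (B x) (π x v))) = v
    rw [← hwv, hTB, hinv]
    rfl
  · rintro n β v z₀ ⟨hzW, hzO⟩ hβ hv
    refine smoothVecAt_algebroidFrame hU hl hls _ hzW.1.1 hzW.1.2 hβ ?_
    have h1 := contMDiffAt_algebroidFrame hU hl hls (LinearMap.toContinuousLinearMap j) P
      hzW.1.1 hzW.1.2 hzW.2 hβ
    obtain ⟨b, hb⟩ : IsUnit (B (β z₀)) := hO hzO
    have h2 : ContMDiffAt (𝓡 n) 𝓘(ℝ, R →L[ℝ] R) ∞ (fun z => Ring.inverse (B (β z))) z₀ := by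
      have h3 : ContMDiffAt 𝓘(ℝ, R →L[ℝ] R) 𝓘(ℝ, R →L[ℝ] R) ∞ Ring.inverse (B (β z₀)) := by
        rw [← hb]
        exact (contDiffAt_ringInverse ℝ (R := R →L[ℝ] R) b).contMDiffAt
      exact h3.comp z₀ h1
    exact h2.clm_apply (P.contMDiff.contMDiffAt.comp z₀ (contMDiffAt_tcoframe hzW.2 hv))

end Splittings

end LieGroupoid

/-! ### Alternating sums -/

/-- The upper half is reindexed by one, so that both halves run over the same range and can be
paired termwise. -/
theorem Finset.sum_range_succ_split {W : Type*} [AddCommGroup W] (h : ℕ → W) {N i : ℕ} (hi : i < N) :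
    ∑ j ∈ Finset.range (N + 1), h j = ∑ j ∈ Finset.range N, (if j ≤ i then h j else 0) +
      ∑ j ∈ Finset.range N, (if i ≤ j then h (j + 1) else 0) := by
  have h1 : ∀ j, h j = (if j ≤ i then h j else 0) + (if i < j then h j else 0) := fun j => by
    rcases le_or_gt j i with hj | hj
    · simp [hj, not_lt.2 hj]
    · simp [hj, not_le.2 hj]
  rw [Finset.sum_congr rfl fun j _ => h1 j, Finset.sum_add_distrib]
  congr 1
  · rw [Finset.sum_range_succ, if_neg (by omega), add_zero]
  · rw [Finset.sum_range_succ', if_neg (by omega), add_zero]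
    exact Finset.sum_congr rfl fun j _ => by simp only [Nat.lt_succ_iff]

/-- The usual cancellation in δδ = 0: the terms at (j + 1, i) and (i, j) with i ≤ j are equal and
carry opposite signs. -/
theorem Finset.sum_alternating_eq_zero {W : Type*} [AddCommGroup W] [Module ℝ W] (A : ℕ → ℕ → W)
    (N : ℕ) (hA : ∀ i j, i ≤ j → j < N → A (j + 1) i = A i j) :
    ∑ j ∈ Finset.range (N + 1), (-1 : ℝ) ^ (j + 1) •
      ∑ i ∈ Finset.range N, (-1 : ℝ) ^ (i + 1) • A j i = 0 := by
  simp only [Finset.smul_sum, smul_smul, ← pow_add]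
  rw [Finset.sum_comm]
  rw [Finset.sum_congr rfl fun i hi => Finset.sum_range_succ_split _ (Finset.mem_range.1 hi),
    Finset.sum_add_distrib]
  -- Exchanging the indices in the first half only gives both halves the condition i ≤ j.
  nth_rewrite 1 [Finset.sum_comm]
  rw [← Finset.sum_add_distrib]
  refine Finset.sum_eq_zero fun i _ => ?_
  rw [← Finset.sum_add_distrib]
  refine Finset.sum_eq_zero fun j hj => ?_
  split_ifs with h
  · rw [hA i j h (Finset.mem_range.1 hj), ← add_smul]
    have : (-1 : ℝ) ^ (i + 1 + (j + 1)) + (-1 : ℝ) ^ (j + 1 + 1 + (i + 1)) = 0 := by ring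
    rw [this, zero_smul]
  · simp

/-! ### Faces of strings and the simplicial identities -/

namespace LieGroupoid

section Strings

variable {E F G M : Type*}
  [NormedAddCommGroup E] [NormedSpace ℝ E] [NormedAddCommGroup F] [NormedSpace ℝ F]
  [TopologicalSpace G] [ChartedSpace E G] [TopologicalSpace M] [ChartedSpace F M]
  {Γ : LieGroupoid E F G M}

namespace Str

theorem ext_iff' {k : ℕ} {g h : Γ.Str k} (h1 : ∀ i, g.obj i = h.obj i)
    (h2 : ∀ i, g.arr i = h.arr i) : g = h := by
  cases g; cases h
  congr
  · exact funext h1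
  · exact funext h2

/-- The faces of a string other than the tail: `g.face j` is `g.comp j` for `j < k` and `g.init` for
`j ≥ k`. -/
def face {k : ℕ} (g : Γ.Str (k + 1)) (j : ℕ) : Γ.Str k where
  obj i := if i.1 ≤ j then g.obj i.castSucc else g.obj i.succ
  arr i := if i.1 < j then g.arr i.castSucc
    else if i.1 = j then Γ.mul (g.arr i.castSucc) (g.arr i.succ) else g.arr i.succ
  tgt_arr i := by
    rcases lt_trichotomy i.1 j with h | h | h
    · rw [if_pos h, g.tgt_arr, if_pos (by simpa using h.le)]
    · rw [if_neg (by omega), if_pos h, Γ.tgt_mul _ _ (g.composable i), g.tgt_arr,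
        if_pos (by simp [h])]
    · rw [if_neg (by omega), if_neg (by omega), g.tgt_arr, if_neg (by simpa using h)]
      rfl
  src_arr i := by
    rcases lt_trichotomy i.1 j with h | h | h
    · rw [if_pos h, g.src_arr, if_pos (by simpa using h)]
      rfl
    · rw [if_neg (by omega), if_pos h, Γ.src_mul _ _ (g.composable i), g.src_arr,
        if_neg (by simp [h])]
    · rw [if_neg (by omega), if_neg (by omega), g.src_arr, if_neg (by simp; omega)]

theorem face_fin {k : ℕ} (g : Γ.Str (k + 1)) (j : Fin k) : g.face j.1 = g.comp j := by
  refine ext_iff' (fun i => rfl) fun i => ?_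
  simp only [face, comp]
  split_ifs with h1 h2
  · rfl
  · obtain rfl : i = j := Fin.ext h2
    rfl
  · rfl

theorem face_self {k : ℕ} (g : Γ.Str (k + 1)) : g.face k = g.init := by
  refine ext_iff' (fun i => ?_) fun i => ?_
  · simp only [face, init]
    rw [if_pos (by omega)]
  · simp only [face, init]
    rw [if_pos (by omega)]

theorem face_zero {k : ℕ} (g : Γ.Str (k + 2)) : g.face 0 = g.comp 0 := g.face_fin 0

theorem tail_face_zero {k : ℕ} (g : Γ.Str (k + 2)) : (g.face 0).tail = g.tail.tail := by
  refine ext_iff' (fun i => ?_) fun i => ?_ <;> simp [face, tail]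

theorem tail_face_succ {k : ℕ} (g : Γ.Str (k + 2)) (j : ℕ) :
    (g.face (j + 1)).tail = g.tail.face j := by
  refine ext_iff' (fun i => ?_) fun i => ?_ <;>
    simp only [face, tail, Fin.val_succ, Nat.add_le_add_iff_right, Nat.add_lt_add_iff_right,
      Nat.add_right_cancel_iff] <;> rfl

theorem arr_face_zero {k : ℕ} (g : Γ.Str (k + 2)) :
    (g.face 0).arr 0 = Γ.mul (g.arr 0) (g.arr 1) := rfl

theorem arr_face_succ {k : ℕ} (g : Γ.Str (k + 2)) (j : ℕ) : (g.face (j + 1)).arr 0 = g.arr 0 := rfl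

theorem obj_face {k : ℕ} (g : Γ.Str (k + 1)) (j : ℕ) : (g.face j).obj 0 = g.obj 0 := by
  simp [face]

theorem arr_tail {k : ℕ} (g : Γ.Str (k + 2)) : g.tail.arr 0 = g.arr 1 := rfl

theorem composable_zero {k : ℕ} (g : Γ.Str (k + 2)) : Γ.src (g.arr 0) = Γ.tgt (g.arr 1) :=
  g.composable 0

theorem arr_face_of_lt {k j : ℕ} (g : Γ.Str (k + 1)) {i : Fin k} (h : i.1 < j) :
    (g.face j).arr i = g.arr i.castSucc := if_pos h

theorem arr_face_of_eq {k j : ℕ} (g : Γ.Str (k + 1)) {i : Fin k} (h : i.1 = j) :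
    (g.face j).arr i = Γ.mul (g.arr i.castSucc) (g.arr i.succ) :=
  (if_neg h.not_lt).trans (if_pos h)

theorem arr_face_of_gt {k j : ℕ} (g : Γ.Str (k + 1)) {i : Fin k} (h : j < i.1) :
    (g.face j).arr i = g.arr i.succ := (if_neg h.not_gt).trans (if_neg h.ne')

/-- Entry by entry this is bookkeeping. Associativity is needed only at the entry m = i = j, where
three arrows are multiplied. -/
theorem face_face {k : ℕ} (g : Γ.Str (k + 2)) {i j : ℕ} (hij : i ≤ j) :
    (g.face (j + 1)).face i = (g.face i).face j := by
  refine ext_iff' (fun m => ?_) fun m => ?_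
  · simp only [face, Fin.val_castSucc, Fin.val_succ]
    split_ifs <;> first | rfl | omega
  · have v1 : m.castSucc.1 = m.1 := rfl
    have v2 : m.succ.1 = m.1 + 1 := rfl
    rcases lt_trichotomy m.1 i with h | h | h
    · rw [arr_face_of_lt _ h, arr_face_of_lt _ (by omega), arr_face_of_lt _ (by omega),
        arr_face_of_lt _ (by omega)]
    · rcases hij.lt_or_eq with h' | h'
      · rw [arr_face_of_eq _ h, arr_face_of_lt _ (by omega), arr_face_of_lt _ (by omega),
          arr_face_of_lt _ (by omega), arr_face_of_eq _ (by omega)]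
        rfl
      · rw [arr_face_of_eq _ h, arr_face_of_lt _ (by omega), arr_face_of_eq _ (by omega),
          arr_face_of_eq _ (by omega), arr_face_of_eq _ (by omega), arr_face_of_gt _ (by omega)]
        exact (Γ.mul_assoc _ _ _ (g.composable m.castSucc) (g.composable m.succ)).symm
    · rw [arr_face_of_gt _ h]
      rcases lt_trichotomy m.1 j with h' | h' | h'
      · rw [arr_face_of_lt _ (by omega), arr_face_of_lt _ (by omega), arr_face_of_gt _ (by omega)]
        rfl
      · rw [arr_face_of_eq _ (by omega), arr_face_of_eq _ (by omega), arr_face_of_gt _ (by omega),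
          arr_face_of_gt _ (by omega)]
        rfl
      · rw [arr_face_of_gt _ (by omega), arr_face_of_gt _ (by omega), arr_face_of_gt _ (by omega)]

theorem IsPlot.tail {k n : ℕ} {γ : EuclideanSpace ℝ (Fin n) → Γ.Str (k + 1)} (h : IsPlot γ) :
    IsPlot fun z => (γ z).tail :=
  ⟨fun i => h.1 i.succ, fun i => h.2 i.succ⟩

theorem IsPlot.face {k n : ℕ} {γ : EuclideanSpace ℝ (Fin n) → Γ.Str (k + 1)} (h : IsPlot γ)
    (j : ℕ) : IsPlot fun z => (γ z).face j := by
  refine ⟨fun i => ?_, fun i => ?_⟩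
  · simp only [Str.face]
    split_ifs
    exacts [h.1 _, h.1 _]
  · simp only [Str.face]
    split_ifs
    · exact h.2 _
    · exact Γ.mul_smooth.comp_contMDiff ((h.2 i.castSucc).prodMk (h.2 i.succ))
        fun z => (γ z).composable i
    · exact h.2 _

/-- `(g₁, …, g_k) ↦ (1, g₁, …, g_k)` -/
def consUnit {k : ℕ} (g : Γ.Str k) : Γ.Str (k + 1) where
  obj := Fin.cons (g.obj 0) g.obj
  arr := Fin.cons (Γ.unit (g.obj 0)) g.arr
  tgt_arr i := by
    cases i using Fin.cases with
    | zero => exact Γ.tgt_unit _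
    | succ i => exact g.tgt_arr i
  src_arr i := by
    cases i using Fin.cases with
    | zero => exact Γ.src_unit _
    | succ i => exact g.src_arr i

theorem IsPlot.consUnit {k n : ℕ} {γ : EuclideanSpace ℝ (Fin n) → Γ.Str k} (h : IsPlot γ) :
    IsPlot fun z => (γ z).consUnit := by
  refine ⟨fun i => ?_, fun i => ?_⟩
  · cases i using Fin.cases with
    | zero => exact h.1 0
    | succ i => exact h.1 i
  · cases i using Fin.cases with
    | zero => exact Γ.unit_smooth.comp (h.1 0)
    | succ i => exact h.2 i

/-- Treating the omission of the last arrow as one more face puts all terms except the one from the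
tail into a single alternating sum over natural numbers. -/
theorem sum_faces {k : ℕ} {W : Type*} [AddCommGroup W] [Module ℝ W] (u : Γ.Str k → W)
    (g : Γ.Str (k + 1)) :
    ∑ j : Fin k, (-1 : ℝ) ^ (j.1 + 1) • u (g.comp j) + (-1 : ℝ) ^ (k + 1) • u g.init =
      ∑ j ∈ Finset.range (k + 1), (-1 : ℝ) ^ (j + 1) • u (g.face j) := by
  rw [Finset.sum_range_succ, face_self,
    Finset.sum_range fun j => (-1 : ℝ) ^ (j + 1) • u (g.face j)]
  simp only [face_fin]

theorem sum_faces_succ {k : ℕ} {W : Type*} [AddCommGroup W] [Module ℝ W] (u : Γ.Str (k + 1) → W)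
    (g : Γ.Str (k + 2)) :
    ∑ j : Fin k, (-1 : ℝ) ^ (j.1 + 2) • u (g.comp j.succ) + (-1 : ℝ) ^ (k + 2) • u g.init =
      ∑ j ∈ Finset.range (k + 1), (-1 : ℝ) ^ (j + 2) • u (g.face (j + 1)) := by
  rw [Finset.sum_range_succ, face_self,
    Finset.sum_range fun j => (-1 : ℝ) ^ (j + 2) • u (g.face (j + 1))]
  simp only [← face_fin, Fin.val_succ]

end Str

end Strings

end LieGroupoid

/-! ### The differentials in terms of the tangent groupoid -/

namespace LieGroupoid

section Formulas

variable {E F G M : Type*}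
  [NormedAddCommGroup E] [NormedSpace ℝ E] [NormedAddCommGroup F] [NormedSpace ℝ F]
  [TopologicalSpace G] [ChartedSpace E G] [TopologicalSpace M] [ChartedSpace F M]
  {Γ : LieGroupoid E F G M}

/-- Every tangent space is definitionally the model space, and on it transport along an equality of
base points is the identity. Cochains can thus be treated as maps into the model space. -/
theorem fcast_tangent_unit {x y : M} (h : x = y) (X : TangentSpace 𝓘(ℝ, E) (Γ.unit x)) :
    (fcast (fun x => TangentSpace 𝓘(ℝ, E) (Γ.unit x)) h X : E) = X := by
  subst h; rfl

theorem mem_isotropy {x : M} {a : E} : (a : TangentSpace 𝓘(ℝ, E) (Γ.unit x)) ∈ Γ.isotropy x ↔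
    Γ.ts (Γ.unit x) a = 0 ∧ Γ.tt (Γ.unit x) a = 0 := by
  have h : Γ.dTgtUnit x a = Γ.tt (Γ.unit x) a := fcast_tangent (E := F) (Γ.tgt_unit x) _
  constructor
  · rintro ⟨h1, h2⟩
    exact ⟨h1, h.symm.trans h2⟩
  · rintro ⟨h1, h2⟩
    exact ⟨h1, h.trans h2⟩

theorem isSProjection_iff {k : ℕ} {c : Γ.Str (k + 1) → E} {σ : Γ.Str k → F} :
    Γ.IsSProjection c σ ↔ ∀ g : Γ.Str (k + 1), Γ.ts (g.arr 0) (c g) = σ g.tail := by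
  refine forall_congr' fun g => ?_
  have h := fcast_tangent (E := F) g.obj_zero_tail (σ g.tail)
  constructor
  · intro h1; exact Eq.trans h1 h
  · intro h1; exact Eq.trans h1 h.symm

theorem dInvUnit_eq (x : M) (X : E) : (Γ.dInvUnit x X : E) = Γ.ti (Γ.unit x) X :=
  fcast_tangent (Γ.inv_unit x) _

theorem inclusion_zero_apply (u : Γ.Str 0 → E) (g : Γ.Str 0) : (Γ.inclusion u g : E) = u g :=
  fcast_tangent _ _

variable (Γ) in
/-- The projection `T_x M → ν_x`. -/
def normalMk (x : M) : F →ₗ[ℝ] Γ.Normal x := (Γ.imAnchor x).mkQ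

theorem normalMk_eq_zero {x : M} {v : F} : Γ.normalMk x v = 0 ↔
    ∃ a : E, Γ.ts (Γ.unit x) a = 0 ∧ Γ.tt (Γ.unit x) a = v :=
  (Submodule.Quotient.mk_eq_zero _).trans Γ.mem_imAnchor

theorem normalMk_fcast {x y : M} (h : x = y) (v : F) :
    fcast Γ.Normal h (Γ.normalMk x v) = Γ.normalMk y v := by
  subst h; rfl

variable [IsManifold 𝓘(ℝ, E) ∞ G]

theorem rUnit_eq (g : G) {X : E} (hX : Γ.ts (Γ.unit (Γ.tgt g)) X = 0) :
    (Γ.rUnit g X : E) = Γ.tm (Γ.unit (Γ.tgt g)) g (X, 0) :=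
  (fcast_tangent (Γ.unit_mul g) _).trans (dRight_eq (Γ.src_unit _) hX)

theorem lUnit_eq (g : G) {X : E} (hX : Γ.tt (Γ.unit (Γ.src g)) X = 0) :
    (Γ.lUnit g X : E) = Γ.tm g (Γ.unit (Γ.src g)) (0, X) :=
  (fcast_tangent (Γ.mul_unit g) _).trans (dLeft_eq (Γ.tgt_unit _).symm hX)

theorem tt_ti_unit (x : M) (X : E) : Γ.tt (Γ.unit x) (Γ.ti (Γ.unit x) X) = Γ.ts (Γ.unit x) X := by
  have h := tt_ti (Γ := Γ) (Γ.unit x) X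
  rwa [Γ.inv_unit] at h

theorem ts_ti_unit (x : M) (X : E) : Γ.ts (Γ.unit x) (Γ.ti (Γ.unit x) X) = Γ.tt (Γ.unit x) X := by
  have h := ts_ti (Γ := Γ) (Γ.unit x) X
  rwa [Γ.inv_unit] at h

theorem isotropyAct_eq (g : G) {X : E} (hX : Γ.ts (Γ.unit (Γ.src g)) X = 0)
    (hX' : Γ.tt (Γ.unit (Γ.src g)) X = 0) : (Γ.isotropyAct g X : E) =
      Γ.tm g (Γ.inv g) (Γ.tm g (Γ.unit (Γ.src g)) (0, X), 0) := by
  have h1 : (Γ.lUnit g X : E) = _ := Γ.lUnit_eq g hX'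
  have h2 : Γ.ts g (Γ.tm g (Γ.unit (Γ.src g)) (0, X)) = 0 := by
    have := ts_tm (Γ := Γ) (g := g) (X := 0) (Y := X) (Γ.tgt_unit (Γ.src g)).symm
      (by rw [hX', map_zero])
    rwa [Γ.mul_unit, hX] at this
  refine (fcast_tangent (Γ.mul_inv g) _).trans ?_
  change (Γ.dRight g (Γ.inv g) (Γ.lUnit g X) : E) = _
  rw [h1]
  exact dRight_eq (Γ.tgt_inv g).symm h2

theorem defDeltaZero_apply {α : Γ.Str 0 → E}
    (hα : ∀ g : Γ.Str 0, Γ.ts (Γ.unit (g.obj 0)) (α g) = 0) (g : Γ.Str 1) :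
    (Γ.defDeltaZero α g : E) =
      Γ.tm (Γ.unit (Γ.tgt (g.arr 0))) (g.arr 0) (α g.init, 0) +
      Γ.tm (g.arr 0) (Γ.unit (Γ.src (g.arr 0))) (0, Γ.ti (Γ.unit (Γ.src (g.arr 0))) (α g.tail)) := by
  have h1 := hα g.init
  have h2 := hα g.tail
  rw [g.obj_zero_init, ← g.tgt_arr_zero] at h1
  rw [g.obj_zero_tail] at h2
  refine (fcast_tangent g.head_succ.symm _).trans ?_
  refine congrArg₂ (fun X Y : E => X + Y) ?_ ?_
  · have e := fcast_tangent (E := E) g.head_init_one (α g.init)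
    exact (congrArg (fun X : E => (Γ.rUnit (g.arr 0) X : E)) e).trans (Γ.rUnit_eq _ h1)
  · have e := fcast_tangent (E := E) g.head_tail_one (α g.tail)
    refine (congrArg (fun X : E => (Γ.lUnit (g.arr 0) (Γ.dInvUnit _ X) : E)) e).trans ?_
    refine (congrArg (fun X : E => (Γ.lUnit (g.arr 0) X : E)) (Γ.dInvUnit_eq _ _)).trans ?_
    exact Γ.lUnit_eq _ ((Γ.tt_ti_unit _ _).trans h2)

/-- The s-projection makes the division term meaningful: the strings (g₁g₂, g₃, …) and (g₂, g₃, …)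
have the same tail, so the two values of c have the same image under ds. -/
theorem defDeltaSucc_apply {k : ℕ} {c : Γ.Str (k + 1) → E} {σ : Γ.Str k → F}
    (hc : ∀ g, Γ.ts (g.arr 0) (c g) = σ g.tail) (g : Γ.Str (k + 2)) :
    (Γ.defDeltaSucc k c g : E) =
      -Γ.td (Γ.mul (g.arr 0) (g.arr 1)) (g.arr 1) (c (g.face 0), c g.tail) +
        ∑ j ∈ Finset.range (k + 1), (-1 : ℝ) ^ (j + 2) • c (g.face (j + 1)) := by
  have h1 := hc (g.face 0)
  have h2 := hc g.tail
  rw [g.tail_face_zero] at h1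
  rw [← Str.sum_faces_succ c]
  rw [g.face_zero] at h1 ⊢
  refine (fcast_tangent g.head_succ.symm _).trans ?_
  have e1 := fcast_tangent (E := E) g.head_comp_zero (c (g.comp 0))
  have e2 := fcast_tangent (E := E) g.head_tail (c g.tail)
  have e3 := fcast_tangent (E := E) g.head_init (c g.init)
  have e4 := fun j : Fin k => fcast_tangent (E := E) (g.head_comp_succ j) (c (g.comp j.succ))
  rw [← add_assoc]
  refine congrArg₂ (fun X Y : E => X + Y) (congrArg₂ (fun X Y : E => X + Y) ?_ ?_) ?_
  · refine congrArg (fun X : E => -X) ?_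
    refine (fcast_tangent (E := E) (Γ.div_eq (g.arr 0) (g.arr 1) (g.composable 0)) _).trans ?_
    refine (congrArg₂ (fun X Y : E => (Γ.dDiv (Γ.mul (g.arr 0) (g.arr 1)) (g.arr 1) (X, Y) : E))
      e1 e2).trans ?_
    exact dDiv_eq (Γ.src_mul _ _ g.composable_zero) (h1.trans h2.symm)
  · exact Finset.sum_congr rfl fun j _ => congrArg (fun X : E => (-1 : ℝ) ^ (j.1 + 2) • X) (e4 j)
  · exact congrArg (fun X : E => (-1 : ℝ) ^ (k + 2) • X) e3

theorem inclusion_succ_apply {k : ℕ} {u : Γ.Str (k + 1) → E} {g : Γ.Str (k + 1)}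
    (hu : Γ.ts (Γ.unit (g.obj 0)) (u g) = 0) :
    (Γ.inclusion u g : E) = Γ.tm (Γ.unit (Γ.tgt (g.arr 0))) (g.arr 0) (u g, 0) := by
  rw [← g.tgt_arr_zero] at hu
  refine (fcast_tangent g.head_succ.symm _).trans ?_
  exact (congrArg (fun X : E => (Γ.rUnit (g.arr 0) X : E))
    (fcast_tangent_unit g.tgt_arr_zero.symm (u g))).trans (Γ.rUnit_eq _ hu)

theorem isotropyDelta_apply {k : ℕ} {u : Γ.Str k → E}
    (hu : ∀ g : Γ.Str k, Γ.ts (Γ.unit (g.obj 0)) (u g) = 0 ∧ Γ.tt (Γ.unit (g.obj 0)) (u g) = 0)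
    (g : Γ.Str (k + 1)) :
    (Γ.diffDelta (fun x => TangentSpace 𝓘(ℝ, E) (Γ.unit x)) Γ.isotropyAct k u g : E) =
      Γ.tm (g.arr 0) (Γ.inv (g.arr 0))
        (Γ.tm (g.arr 0) (Γ.unit (Γ.src (g.arr 0))) (0, u g.tail), 0) +
        ∑ j ∈ Finset.range (k + 1), (-1 : ℝ) ^ (j + 1) • u (g.face j) := by
  have h := hu g.tail
  rw [g.obj_zero_tail] at h
  rw [← Str.sum_faces u, ← add_assoc]
  refine congrArg₂ (fun X Y : E => X + Y) (congrArg₂ (fun X Y : E => X + Y) ?_ ?_) ?_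
  · refine (fcast_tangent_unit (Γ := Γ) g.tgt_arr_zero _).trans ?_
    exact (congrArg (fun X : E => (Γ.isotropyAct (g.arr 0) X : E))
      (fcast_tangent_unit g.obj_zero_tail (u g.tail))).trans (Γ.isotropyAct_eq _ h.1 h.2)
  · exact Finset.sum_congr rfl fun j _ => congrArg (fun X : E => (-1 : ℝ) ^ (j.1 + 1) • X)
      (fcast_tangent_unit (g.obj_zero_comp j) (u (g.comp j)))
  · exact congrArg (fun X : E => (-1 : ℝ) ^ (k + 1) • X)
      (fcast_tangent_unit g.obj_zero_init (u g.init))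

theorem normalAct_normalMk (g : G) (X : E) :
    Γ.normalAct g (Γ.normalMk _ (Γ.ts g X)) = Γ.normalMk _ (Γ.tt g X) :=
  Γ.normalAct_mk g X

/-- The action of g₁ sends the class of ds X to that of dt X, so any vector X at g₁ over the value
of σ on the tail computes the first term. Taking X = c(g) relates this differential to that of the
deformation complex. -/
theorem normalDelta_apply {k : ℕ} {σ : Γ.Str k → F} (g : Γ.Str (k + 1)) {X : E}
    (hX : Γ.ts (g.arr 0) X = σ g.tail) :
    Γ.diffDelta Γ.Normal Γ.normalAct k (Γ.normalClass σ) g = Γ.normalMk (g.obj 0)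
      (Γ.tt (g.arr 0) X + ∑ j ∈ Finset.range (k + 1), (-1 : ℝ) ^ (j + 1) • σ (g.face j)) := by
  rw [← Str.sum_faces σ, ← add_assoc, map_add, map_add, map_sum]
  simp only [map_smul]
  refine congrArg₂ (fun v w : Γ.Normal (g.obj 0) => v + w)
    (congrArg₂ (fun v w : Γ.Normal (g.obj 0) => v + w) ?_ ?_) ?_
  · have h1 : fcast Γ.Normal g.obj_zero_tail (Γ.normalClass σ g.tail) =
        Γ.normalMk _ (Γ.ts (g.arr 0) X) :=
      (normalMk_fcast g.obj_zero_tail _).trans (congrArg _ hX.symm)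
    rw [h1, normalAct_normalMk]
    exact normalMk_fcast g.tgt_arr_zero _
  · exact Finset.sum_congr rfl fun j _ => congrArg _ (normalMk_fcast (g.obj_zero_comp j) _)
  · exact congrArg _ (normalMk_fcast g.obj_zero_init _)

end Formulas

end LieGroupoid

/-! ### Smoothness along plots and membership in the complexes -/

namespace LieGroupoid

section PlotSmooth

variable {E F G M : Type*}
  [NormedAddCommGroup E] [NormedSpace ℝ E] [NormedAddCommGroup F] [NormedSpace ℝ F]
  [TopologicalSpace G] [ChartedSpace E G] [TopologicalSpace M] [ChartedSpace F M]
  {Γ : LieGroupoid E F G M}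
  {V B : Type*} [NormedAddCommGroup V] [NormedSpace ℝ V] [TopologicalSpace B] [ChartedSpace V B]
  [IsManifold 𝓘(ℝ, V) ∞ B]

/-- The map `g ↦ X g` on strings, with values tangent vectors at the points `b g`, is smooth along
all smooth families of strings. -/
def PlotSmooth {k : ℕ} (b : Γ.Str k → B) (X : Γ.Str k → V) : Prop :=
  ∀ (n : ℕ) (γ : EuclideanSpace ℝ (Fin n) → Γ.Str k), Str.IsPlot γ → ∀ z₀,
    SmoothVecAt (D := EuclideanSpace ℝ (Fin n)) (fun z => b (γ z)) (fun z => X (γ z)) z₀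

namespace PlotSmooth

variable {k : ℕ} {b : Γ.Str k → B} {X Y : Γ.Str k → V}

theorem congr {b' : Γ.Str k → B} {X' : Γ.Str k → V} (h : PlotSmooth b X)
    (hb : ∀ g, b' g = b g) (hX : ∀ g, X' g = X g) : PlotSmooth b' X' := fun n γ hγ z₀ =>
  (h n γ hγ z₀).congr (Filter.Eventually.of_forall fun _ => ⟨hb _, hX _⟩)

theorem comp (h : PlotSmooth b X) {l : ℕ} {φ : Γ.Str l → Γ.Str k}
    (hφ : ∀ (n : ℕ) (γ : EuclideanSpace ℝ (Fin n) → Γ.Str l), Str.IsPlot γ →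
      Str.IsPlot fun z => φ (γ z)) : PlotSmooth (fun g => b (φ g)) (fun g => X (φ g)) :=
  fun n _ hγ z₀ => h n _ (hφ n _ hγ) z₀

theorem tail {b : Γ.Str k → B} {X : Γ.Str k → V} (h : PlotSmooth b X) :
    PlotSmooth (fun g : Γ.Str (k + 1) => b g.tail) (fun g => X g.tail) :=
  h.comp fun _ _ hγ => hγ.tail

theorem face {b : Γ.Str k → B} {X : Γ.Str k → V} (h : PlotSmooth b X) (j : ℕ) :
    PlotSmooth (fun g : Γ.Str (k + 1) => b (g.face j)) (fun g => X (g.face j)) :=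
  h.comp fun _ _ hγ => hγ.face j

theorem consUnit {b : Γ.Str (k + 1) → B} {X : Γ.Str (k + 1) → V} (h : PlotSmooth b X) :
    PlotSmooth (fun g : Γ.Str k => b g.consUnit) (fun g => X g.consUnit) :=
  h.comp fun _ _ hγ => hγ.consUnit

theorem add (hX : PlotSmooth b X) (hY : PlotSmooth b Y) : PlotSmooth b (fun g => X g + Y g) :=
  fun n γ hγ z₀ => (hX n γ hγ z₀).add (hY n γ hγ z₀)

theorem sub (hX : PlotSmooth b X) (hY : PlotSmooth b Y) : PlotSmooth b (fun g => X g - Y g) :=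
  fun n γ hγ z₀ => (hX n γ hγ z₀).sub (hY n γ hγ z₀)

theorem neg (hX : PlotSmooth b X) : PlotSmooth b (fun g => -X g) :=
  fun n γ hγ z₀ => (hX n γ hγ z₀).neg

theorem const_smul (a : ℝ) (hX : PlotSmooth b X) : PlotSmooth b (fun g => a • X g) :=
  fun n γ hγ z₀ => (hX n γ hγ z₀).const_smul a

theorem zero (hb : ∀ (n : ℕ) (γ : EuclideanSpace ℝ (Fin n) → Γ.Str k), Str.IsPlot γ →
    ContMDiff (𝓡 n) 𝓘(ℝ, V) ∞ fun z => b (γ z)) : PlotSmooth b (fun _ => (0 : V)) :=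
  fun n γ hγ z₀ => SmoothVecAt.zero (hb n γ hγ z₀)

theorem base (h : PlotSmooth b X) (n : ℕ) (γ : EuclideanSpace ℝ (Fin n) → Γ.Str k)
    (hγ : Str.IsPlot γ) : ContMDiff (𝓡 n) 𝓘(ℝ, V) ∞ fun z => b (γ z) :=
  fun z₀ => (h n γ hγ z₀).base

theorem sum_range (N : ℕ) {Z : ℕ → Γ.Str k → V} (h : ∀ i, PlotSmooth b (Z i)) :
    PlotSmooth b (fun g => ∑ i ∈ Finset.range N, Z i g) :=
  fun n γ hγ z₀ => SmoothVecAt.sum _ ((h 0 n γ hγ z₀).base) fun i _ => h i n γ hγ z₀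

end PlotSmooth

variable [IsManifold 𝓘(ℝ, E) ∞ G]

theorem plotSmooth_arr_zero {k : ℕ} :
    PlotSmooth (fun g : Γ.Str (k + 1) => g.arr 0) (fun _ => (0 : E)) :=
  PlotSmooth.zero fun _ _ hγ => hγ.2 0

variable [IsManifold 𝓘(ℝ, F) ∞ M]
  {k : ℕ} {a b : Γ.Str k → G} {X Y : Γ.Str k → E}

theorem PlotSmooth.ts (h : PlotSmooth a X) :
    PlotSmooth (fun g => Γ.src (a g)) (fun g => Γ.ts (a g) (X g)) :=
  fun n γ hγ z₀ => smoothVecAt_ts (h n γ hγ z₀)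

theorem PlotSmooth.tt (h : PlotSmooth a X) :
    PlotSmooth (fun g => Γ.tgt (a g)) (fun g => Γ.tt (a g) (X g)) :=
  fun n γ hγ z₀ => smoothVecAt_tt (h n γ hγ z₀)

theorem PlotSmooth.ti (h : PlotSmooth a X) :
    PlotSmooth (fun g => Γ.inv (a g)) (fun g => Γ.ti (a g) (X g)) :=
  fun n γ hγ z₀ => smoothVecAt_ti (h n γ hγ z₀)

theorem PlotSmooth.tm (hX : PlotSmooth a X) (hY : PlotSmooth b Y)
    (hc : ∀ g, Γ.src (a g) = Γ.tgt (b g)) (hXY : ∀ g, Γ.ts (a g) (X g) = Γ.tt (b g) (Y g)) :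
    PlotSmooth (fun g => Γ.mul (a g) (b g)) (fun g => Γ.tm (a g) (b g) (X g, Y g)) :=
  fun n γ hγ z₀ => smoothVecAt_tm (hX n γ hγ z₀) (hY n γ hγ z₀) (fun _ => hc _) fun _ => hXY _

theorem PlotSmooth.td (hX : PlotSmooth a X) (hY : PlotSmooth b Y)
    (hc : ∀ g, Γ.src (a g) = Γ.src (b g)) (hXY : ∀ g, Γ.ts (a g) (X g) = Γ.ts (b g) (Y g)) :
    PlotSmooth (fun g => Γ.mul (a g) (Γ.inv (b g))) (fun g => Γ.td (a g) (b g) (X g, Y g)) :=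
  fun n γ hγ z₀ => smoothVecAt_td (hX n γ hγ z₀) (hY n γ hγ z₀) (fun _ => hc _) fun _ => hXY _

theorem PlotSmooth.hom {C P : Type*} [NormedAddCommGroup C] [NormedSpace ℝ C] [TopologicalSpace P]
    [ChartedSpace C P] {p : P → M} {q : P → G} {L : P → F →L[ℝ] E}
    (hL : SmoothHomOn (C := C) p q L univ) {β : Γ.Str k → P} {v : Γ.Str k → F}
    (hβ : ∀ (n : ℕ) (γ : EuclideanSpace ℝ (Fin n) → Γ.Str k), Str.IsPlot γ →
      ContMDiff (𝓡 n) 𝓘(ℝ, C) ∞ fun z => β (γ z)) (hv : PlotSmooth (fun g => p (β g)) v) :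
    PlotSmooth (fun g => q (β g)) (fun g => L (β g) (v g)) :=
  fun n γ hγ z₀ => hL n _ _ z₀ (mem_univ _) (hβ n γ hγ z₀) (hv n γ hγ z₀)

theorem mem_defComplex_zero {α : Γ.Str 0 → E} : α ∈ Γ.defComplex.C 0 ↔
    PlotSmooth (fun g => Γ.unit (g.obj 0)) α ∧ ∀ g : Γ.Str 0, Γ.ts (Γ.unit (g.obj 0)) (α g) = 0 :=
  Iff.rfl

theorem mem_defComplex_succ {c : Γ.Str (k + 1) → E} : c ∈ Γ.defComplex.C (k + 1) ↔
    PlotSmooth (fun g => g.arr 0) c ∧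
      ∃ σ : Γ.Str k → F, ∀ g : Γ.Str (k + 1), Γ.ts (g.arr 0) (c g) = σ g.tail :=
  and_congr Iff.rfl (exists_congr fun _ => isSProjection_iff)

theorem mem_isotropyComplex {u : Γ.Str k → E} : u ∈ Γ.isotropyComplex.C k ↔
    PlotSmooth (fun g => Γ.unit (g.obj 0)) u ∧
      ∀ g : Γ.Str k, Γ.ts (Γ.unit (g.obj 0)) (u g) = 0 ∧ Γ.tt (Γ.unit (g.obj 0)) (u g) = 0 :=
  and_congr Iff.rfl (forall_congr' fun g => mem_isotropy (x := g.obj 0) (a := u g))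

end PlotSmooth

/-! ### The deformation complex -/

section Differential

variable {E F G M : Type*}
  [NormedAddCommGroup E] [NormedSpace ℝ E] [NormedAddCommGroup F] [NormedSpace ℝ F]
  [TopologicalSpace G] [ChartedSpace E G] [TopologicalSpace M] [ChartedSpace F M]
  {Γ : LieGroupoid E F G M} {k : ℕ}

/-- The alternating sum over the faces of a string other than the tail. -/
def faceSum {W : Type*} [AddCommGroup W] [Module ℝ W] (u : Γ.Str k → W) (g : Γ.Str (k + 1)) : W :=
  ∑ j ∈ Finset.range (k + 1), (-1 : ℝ) ^ (j + 1) • u (g.face j)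

theorem faceSum_faceSum {W : Type*} [AddCommGroup W] [Module ℝ W] (u : Γ.Str k → W)
    (g : Γ.Str (k + 2)) : faceSum (faceSum u) g = 0 :=
  Finset.sum_alternating_eq_zero (fun j i => u ((g.face j).face i)) (k + 1)
    fun _ _ hij _ => congrArg u (g.face_face hij)

/-- The terms of the differential of the deformation complex, up to sign. -/
def dterm (c : Γ.Str (k + 1) → E) (g : Γ.Str (k + 2)) : ℕ → E
  | 0 => Γ.td (Γ.mul (g.arr 0) (g.arr 1)) (g.arr 1) (c (g.face 0), c g.tail)
  | j + 1 => c (g.face (j + 1))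

theorem dterm_sum {N : ℕ} (a : ℕ → ℝ) (c : ℕ → Γ.Str (k + 1) → E) (g : Γ.Str (k + 2)) (j : ℕ) :
    dterm (fun g => ∑ i ∈ Finset.range N, a i • c i g) g j =
      ∑ i ∈ Finset.range N, a i • dterm (c i) g j := by
  cases j with
  | zero =>
    simp only [dterm, ← map_smul, ← map_sum]
    congr 1
    simp [Prod.ext_iff, Prod.fst_sum, Prod.snd_sum]
  | succ j => rfl

theorem ts_mul_face {c : Γ.Str (k + 1) → E} {σ : Γ.Str k → F}
    (hc : ∀ g, Γ.ts (g.arr 0) (c g) = σ g.tail) (g : Γ.Str (k + 2)) :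
    Γ.ts (Γ.mul (g.arr 0) (g.arr 1)) (c (g.face 0)) = Γ.ts (g.arr 1) (c g.tail) := by
  have h1 := hc (g.face 0)
  have h2 := hc g.tail
  rw [g.tail_face_zero] at h1
  exact h1.trans h2.symm

theorem ts_dterm_succ {c : Γ.Str (k + 1) → E} {σ : Γ.Str k → F}
    (hc : ∀ g, Γ.ts (g.arr 0) (c g) = σ g.tail) (g : Γ.Str (k + 2)) (j : ℕ) :
    Γ.ts (g.arr 0) (dterm c g (j + 1)) = σ (g.tail.face j) := by
  rw [← g.tail_face_succ]
  exact hc (g.face (j + 1))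

theorem ts_init_zero {α : Γ.Str 0 → E}
    (hα : ∀ g : Γ.Str 0, Γ.ts (Γ.unit (g.obj 0)) (α g) = 0) (g : Γ.Str 1) :
    Γ.ts (Γ.unit (Γ.tgt (g.arr 0))) (α g.init) = 0 := by
  have h := hα g.init
  rwa [g.obj_zero_init, ← g.tgt_arr_zero] at h

theorem ts_tail_zero {α : Γ.Str 0 → E}
    (hα : ∀ g : Γ.Str 0, Γ.ts (Γ.unit (g.obj 0)) (α g) = 0) (g : Γ.Str 1) :
    Γ.ts (Γ.unit (Γ.src (g.arr 0))) (α g.tail) = 0 := by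
  have h := hα g.tail
  rwa [g.obj_zero_tail] at h

variable [IsManifold 𝓘(ℝ, E) ∞ G]

section Projection

variable {c : Γ.Str (k + 1) → E} {σ : Γ.Str k → F}

/-- With the division term as term 0, the differential has the shape of an alternating sum over
faces, to which the simplicial cancellation applies. -/
theorem defDeltaSucc_eq_sum (hc : ∀ g, Γ.ts (g.arr 0) (c g) = σ g.tail) (g : Γ.Str (k + 2)) :
    (Γ.defDeltaSucc k c g : E) = ∑ j ∈ Finset.range (k + 2), (-1 : ℝ) ^ (j + 1) • dterm c g j := by
  refine Eq.trans (α := E) (defDeltaSucc_apply hc g) ?_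
  rw [Finset.sum_range_succ' (fun j => (-1 : ℝ) ^ (j + 1) • dterm c g j) (k + 1), add_comm]
  simp [dterm]

theorem ts_dterm_zero (hc : ∀ g, Γ.ts (g.arr 0) (c g) = σ g.tail) (g : Γ.Str (k + 2)) :
    Γ.ts (g.arr 0) (dterm c g 0) = Γ.tt (g.tail.arr 0) (c g.tail) := by
  have h := ts_td (Γ.src_mul _ _ g.composable_zero) (ts_mul_face hc g)
  rwa [Γ.div_eq _ _ g.composable_zero] at h

theorem tt_dterm (hc : ∀ g, Γ.ts (g.arr 0) (c g) = σ g.tail) (g : Γ.Str (k + 2)) (j : ℕ) :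
    Γ.tt (g.arr 0) (dterm c g j) = Γ.tt ((g.face j).arr 0) (c (g.face j)) := by
  cases j with
  | zero =>
    have h := tt_td (Γ.src_mul _ _ g.composable_zero) (ts_mul_face hc g)
    rwa [Γ.div_eq _ _ g.composable_zero] at h
  | succ j => rfl

/-- The `s`-projection of the differential of a cochain. -/
theorem ts_defDeltaSucc (hc : ∀ g, Γ.ts (g.arr 0) (c g) = σ g.tail) (g : Γ.Str (k + 2)) :
    Γ.ts (g.arr 0) (Γ.defDeltaSucc k c g) =
      -(Γ.tt (g.tail.arr 0) (c g.tail) + faceSum σ g.tail) := by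
  refine (congrArg (Γ.ts (g.arr 0)) (defDeltaSucc_eq_sum hc g)).trans ?_
  rw [map_sum, Finset.sum_range_succ', map_smul, ts_dterm_zero hc, faceSum, neg_add,
    ← Finset.sum_neg_distrib, add_comm]
  congr 1
  · simp
  · refine Finset.sum_congr rfl fun j _ => ?_
    rw [map_smul, ts_dterm_succ hc, pow_succ, mul_neg_one, neg_smul]

/-- Since dt (dm̄ (X, Y)) = dt X, the division term also contributes dt c on its face, so dt turns δ
into the alternating sum over faces. -/
theorem tt_defDeltaSucc (hc : ∀ g, Γ.ts (g.arr 0) (c g) = σ g.tail) (g : Γ.Str (k + 2)) :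
    Γ.tt (g.arr 0) (Γ.defDeltaSucc k c g) =
      faceSum (fun g : Γ.Str (k + 1) => Γ.tt (g.arr 0) (c g)) g := by
  refine (congrArg (Γ.tt (g.arr 0)) (defDeltaSucc_eq_sum hc g)).trans ?_
  rw [map_sum]
  simp only [map_smul, tt_dterm hc]
  rfl

/-- The simplicial identity for the terms of δ. The case i = j = 0 is the relation (X Z⁻¹)(Y Z⁻¹)⁻¹
= X Y⁻¹ in the tangent groupoid. The other cases follow from the identities between faces. -/
theorem dterm_dterm (hc : ∀ g, Γ.ts (g.arr 0) (c g) = σ g.tail) (g : Γ.Str (k + 3)) {i j : ℕ}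
    (hij : i ≤ j) : dterm (fun g => dterm c g i) g (j + 1) = dterm (fun g => dterm c g j) g i := by
  cases i with
  | zero =>
    cases j with
    | zero =>
      have h1 : Γ.src (g.arr 0) = Γ.tgt (g.arr 1) := g.composable_zero
      have h2 : Γ.src (g.arr 1) = Γ.tgt (g.arr 2) := g.tail.composable_zero
      have e := Γ.mul_assoc _ _ _ h1 h2
      have hX := ts_mul_face hc (g.face 0)
      have hY := ts_mul_face hc g.tail
      change Γ.ts (Γ.mul (Γ.mul (g.arr 0) (g.arr 1)) (g.arr 2)) _ = Γ.ts (g.arr 2) _ at hX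
      rw [e] at hX
      rw [g.tail_face_zero] at hX
      have h := td_td h1 h2 hX hY
      change Γ.td (Γ.mul (g.arr 0) (Γ.mul (g.arr 1) (g.arr 2))) (Γ.mul (g.arr 1) (g.arr 2))
        (c ((g.face 1).face 0), c (g.face 1).tail) =
        Γ.td (Γ.mul (g.arr 0) (g.arr 1)) (g.arr 1)
          (Γ.td (Γ.mul (Γ.mul (g.arr 0) (g.arr 1)) (g.arr 2)) (g.arr 2)
            (c ((g.face 0).face 0), c (g.face 0).tail),
           Γ.td (Γ.mul (g.arr 1) (g.arr 2)) (g.arr 2) (c (g.tail.face 0), c g.tail.tail))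
      rw [e, g.face_face le_rfl, g.tail_face_succ, g.tail_face_zero]
      exact h.symm
    | succ j =>
      change Γ.td (Γ.mul (g.arr 0) (g.arr 1)) (g.arr 1)
        (c ((g.face (j + 2)).face 0), c (g.face (j + 2)).tail) =
        Γ.td (Γ.mul (g.arr 0) (g.arr 1)) (g.arr 1)
          (c ((g.face 0).face (j + 1)), c (g.tail.face (j + 1)))
      rw [g.face_face (Nat.zero_le _), g.tail_face_succ]
  | succ i =>
    obtain ⟨j, rfl⟩ : ∃ j', j = j' + 1 := ⟨j - 1, by omega⟩
    exact congrArg c (g.face_face hij)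

theorem defDeltaSucc_defDeltaSucc (hc : ∀ g, Γ.ts (g.arr 0) (c g) = σ g.tail) :
    Γ.defDeltaSucc (k + 1) (Γ.defDeltaSucc k c) = 0 := by
  funext g
  -- The outer differential can be expanded because δc is again s-projectable, with this explicit
  -- s-projection.
  refine (defDeltaSucc_eq_sum (σ := fun h => -(Γ.tt (h.arr 0) (c h) + faceSum σ h))
    (ts_defDeltaSucc hc) g).trans ?_
  have h : (Γ.defDeltaSucc k c : Γ.Str (k + 2) → E) =
      fun g => ∑ j ∈ Finset.range (k + 2), (-1 : ℝ) ^ (j + 1) • dterm c g j :=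
    funext (defDeltaSucc_eq_sum hc)
  rw [h]
  simp only [dterm_sum (fun i => (-1 : ℝ) ^ (i + 1)) (fun i g => dterm c g i)]
  exact Finset.sum_alternating_eq_zero (fun j i => dterm (fun g => dterm c g i) g j) (k + 2)
    fun i j hij _ => dterm_dterm hc g hij

theorem plotSmooth_dterm [IsManifold 𝓘(ℝ, F) ∞ M] (hc : ∀ g, Γ.ts (g.arr 0) (c g) = σ g.tail)
    (hs : PlotSmooth (fun g => g.arr 0) c) (j : ℕ) :
    PlotSmooth (fun g : Γ.Str (k + 2) => g.arr 0) (fun g => dterm c g j) := by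
  cases j with
  | zero =>
    exact ((hs.face 0).td hs.tail (fun g => Γ.src_mul _ _ g.composable_zero)
      (ts_mul_face hc)).congr (fun g => (Γ.div_eq _ _ g.composable_zero).symm) fun _ => rfl
  | succ j => exact hs.face (j + 1)

end Projection

theorem ts_rTranslate (g : G) {X : E} (hX : Γ.ts (Γ.unit (Γ.tgt g)) X = 0) :
    Γ.ts g (Γ.tm (Γ.unit (Γ.tgt g)) g (X, 0)) = 0 := by
  have h := ts_tm (Γ := Γ) (g := Γ.unit (Γ.tgt g)) (h := g) (X := X) (Y := 0) (Γ.src_unit _)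
    (by rw [hX, map_zero])
  rwa [Γ.unit_mul, map_zero] at h

theorem tt_rTranslate (g : G) {X : E} (hX : Γ.ts (Γ.unit (Γ.tgt g)) X = 0) :
    Γ.tt g (Γ.tm (Γ.unit (Γ.tgt g)) g (X, 0)) = Γ.tt (Γ.unit (Γ.tgt g)) X := by
  have h := tt_tm (Γ := Γ) (g := Γ.unit (Γ.tgt g)) (h := g) (X := X) (Y := 0) (Γ.src_unit _)
    (by rw [hX, map_zero])
  rwa [Γ.unit_mul] at h

theorem ts_lTranslate (g : G) {X : E} (hX : Γ.tt (Γ.unit (Γ.src g)) X = 0) :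
    Γ.ts g (Γ.tm g (Γ.unit (Γ.src g)) (0, X)) = Γ.ts (Γ.unit (Γ.src g)) X := by
  have h := ts_tm (Γ := Γ) (g := g) (h := Γ.unit (Γ.src g)) (X := 0) (Y := X) (Γ.tgt_unit _).symm
    (by rw [hX, map_zero])
  rwa [Γ.mul_unit] at h

theorem tt_lTranslate (g : G) {X : E} (hX : Γ.tt (Γ.unit (Γ.src g)) X = 0) :
    Γ.tt g (Γ.tm g (Γ.unit (Γ.src g)) (0, X)) = 0 := by
  have h := tt_tm (Γ := Γ) (g := g) (h := Γ.unit (Γ.src g)) (X := 0) (Y := X) (Γ.tgt_unit _).symm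
    (by rw [hX, map_zero])
  rwa [Γ.mul_unit, map_zero] at h

section DegreeZero

variable {α : Γ.Str 0 → E}

theorem ts_defDeltaZero (hα : ∀ g : Γ.Str 0, Γ.ts (Γ.unit (g.obj 0)) (α g) = 0) (g : Γ.Str 1) :
    Γ.ts (g.arr 0) (Γ.defDeltaZero α g) = Γ.tt (Γ.unit (g.tail.obj 0)) (α g.tail) := by
  refine (congrArg (Γ.ts (g.arr 0)) (defDeltaZero_apply hα g)).trans ?_
  rw [map_add, ts_rTranslate _ (ts_init_zero hα g), ts_lTranslate, ts_ti_unit, zero_add,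
    g.obj_zero_tail]
  rw [tt_ti_unit, ts_tail_zero hα]

theorem tt_defDeltaZero (hα : ∀ g : Γ.Str 0, Γ.ts (Γ.unit (g.obj 0)) (α g) = 0) (g : Γ.Str 1) :
    Γ.tt (g.arr 0) (Γ.defDeltaZero α g) = Γ.tt (Γ.unit (g.init.obj 0)) (α g.init) := by
  refine (congrArg (Γ.tt (g.arr 0)) (defDeltaZero_apply hα g)).trans ?_
  rw [map_add, tt_rTranslate _ (ts_init_zero hα g), tt_lTranslate, add_zero,
    g.obj_zero_init, ← g.tgt_arr_zero]
  rw [tt_ti_unit, ts_tail_zero hα]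

/-- The vector δα at g is the velocity of a curve a g b⁻¹, with a and b tangent to α. Such
expressions are multiplicative, so dm̄ of the values at g₁g₂ and g₂ is the value at g₁. -/
theorem defDeltaSucc_defDeltaZero (hα : ∀ g : Γ.Str 0, Γ.ts (Γ.unit (g.obj 0)) (α g) = 0) :
    Γ.defDeltaSucc 0 (Γ.defDeltaZero α) = 0 := by
  funext g
  refine (defDeltaSucc_apply (σ := fun h => Γ.tt (Γ.unit (h.obj 0)) (α h))
    (ts_defDeltaZero hα) g).trans ?_
  have h : (Γ.defDeltaZero α : Γ.Str 1 → E) = fun g =>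
      Γ.tm (Γ.unit (Γ.tgt (g.arr 0))) (g.arr 0) (α g.init, 0) +
      Γ.tm (g.arr 0) (Γ.unit (Γ.src (g.arr 0))) (0, Γ.ti (Γ.unit (Γ.src (g.arr 0))) (α g.tail)) :=
    funext (defDeltaZero_apply hα)
  rw [h]
  have hc := g.composable_zero
  have hX := ts_init_zero hα (g.face 1)
  have hY := ts_tail_zero hα (g.face 1)
  have hZ := ts_tail_zero hα g.tail
  have key := td_mul_mul_inv hc hX hY hZ
  have e1 : (g.face 0).init = (g.face 1).init := by
    rw [← Str.face_self, ← Str.face_self]; exact (g.face_face le_rfl).symm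
  have e2 : (g.face 1).tail = g.tail.init := by rw [← Str.face_self]; exact g.tail_face_succ 0
  have e3 : Γ.tgt (Γ.mul (g.arr 0) (g.arr 1)) = Γ.tgt (g.arr 0) := Γ.tgt_mul _ _ hc
  have e4 : Γ.src (Γ.mul (g.arr 0) (g.arr 1)) = Γ.src (g.arr 1) := Γ.src_mul _ _ hc
  simp only [zero_add, Finset.sum_range_one, g.arr_face_zero, g.arr_face_succ, e1, e3, e4,
    g.tail_face_zero, g.arr_tail, ← e2, ← hc]
  rw [key]
  change _ = (0 : E)
  simp

variable [IsManifold 𝓘(ℝ, F) ∞ M]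

theorem PlotSmooth.rTranslate {a : Γ.Str k → G} {X : Γ.Str k → E}
    (ha : PlotSmooth a fun _ => (0 : E)) (hX : PlotSmooth (fun g => Γ.unit (Γ.tgt (a g))) X)
    (h0 : ∀ g, Γ.ts (Γ.unit (Γ.tgt (a g))) (X g) = 0) :
    PlotSmooth a (fun g => Γ.tm (Γ.unit (Γ.tgt (a g))) (a g) (X g, 0)) :=
  (hX.tm ha (fun _ => Γ.src_unit _) fun g => by rw [h0, map_zero]).congr
    (fun _ => (Γ.unit_mul _).symm) fun _ => rfl

theorem PlotSmooth.lTranslate {a : Γ.Str k → G} {X : Γ.Str k → E}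
    (ha : PlotSmooth a fun _ => (0 : E)) (hX : PlotSmooth (fun g => Γ.unit (Γ.src (a g))) X)
    (h0 : ∀ g, Γ.tt (Γ.unit (Γ.src (a g))) (X g) = 0) :
    PlotSmooth a (fun g => Γ.tm (a g) (Γ.unit (Γ.src (a g))) (0, X g)) :=
  (ha.tm hX (fun _ => (Γ.tgt_unit _).symm) fun g => by rw [h0, map_zero]).congr
    (fun _ => (Γ.mul_unit _).symm) fun _ => rfl

theorem defDeltaZero_mem (hα : α ∈ Γ.defComplex.C 0) : Γ.defDeltaZero α ∈ Γ.defComplex.C 1 := by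
  rw [mem_defComplex_zero] at hα
  obtain ⟨hs, h0⟩ := hα
  refine mem_defComplex_succ.2 ⟨?_, fun h => Γ.tt (Γ.unit (h.obj 0)) (α h), ts_defDeltaZero h0⟩
  refine PlotSmooth.congr (b := fun g : Γ.Str 1 => g.arr 0) (PlotSmooth.add
    (PlotSmooth.rTranslate plotSmooth_arr_zero ?_ (ts_init_zero h0))
    (PlotSmooth.lTranslate plotSmooth_arr_zero ?_ ?_)) (fun _ => rfl) (defDeltaZero_apply h0)
  · exact (hs.face 0).congr (fun g => by rw [g.tgt_arr_zero, g.obj_face])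
      fun g => by rw [← g.face_self]
  · refine (hs.tail.ti).congr (fun g => ?_) fun g => ?_
    · rw [Γ.inv_unit, g.obj_zero_tail]
    · rw [g.obj_zero_tail]
  · intro g
    rw [tt_ti_unit, ts_tail_zero h0]

end DegreeZero

theorem defDeltaSucc_mem [IsManifold 𝓘(ℝ, F) ∞ M] {c : Γ.Str (k + 1) → E}
    (hc : c ∈ Γ.defComplex.C (k + 1)) : Γ.defDeltaSucc k c ∈ Γ.defComplex.C (k + 2) := by
  rw [mem_defComplex_succ] at hc
  obtain ⟨hs, σ, hσ⟩ := hc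
  refine mem_defComplex_succ.2 ⟨?_, fun h => -(Γ.tt (h.arr 0) (c h) + faceSum σ h),
    ts_defDeltaSucc hσ⟩
  exact (PlotSmooth.sum_range (k + 2) fun j => (plotSmooth_dterm hσ hs j).const_smul _).congr
    (fun _ => rfl) (defDeltaSucc_eq_sum hσ)

theorem isComplex_defComplex [IsManifold 𝓘(ℝ, F) ∞ M] : Γ.defComplex.IsComplex
  | 0, α, hα => ⟨defDeltaZero_mem hα, defDeltaSucc_defDeltaZero (mem_defComplex_zero.1 hα).2⟩
  | k + 1, c, hc => ⟨defDeltaSucc_mem hc, by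
      obtain ⟨σ, hσ⟩ := (mem_defComplex_succ.1 hc).2
      exact defDeltaSucc_defDeltaSucc hσ⟩

end Differential

end LieGroupoid

/-! ### The isotropy complex and its inclusion -/

namespace LieGroupoid

section Isotropy

variable {E F G M : Type*}
  [NormedAddCommGroup E] [NormedSpace ℝ E] [NormedAddCommGroup F] [NormedSpace ℝ F]
  [TopologicalSpace G] [ChartedSpace E G] [TopologicalSpace M] [ChartedSpace F M]
  {Γ : LieGroupoid E F G M}

variable (Γ) in
/-- Right translation by `g`, from the tangent space at the unit at `t(g)` to that at `g`. -/
def rT (g : G) : E →L[ℝ] E :=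
  (Γ.tm (Γ.unit (Γ.tgt g)) g).comp (ContinuousLinearMap.inl ℝ E E)

variable (Γ) in
/-- Left translation by `g`, from the tangent space at the unit at `s(g)` to that at `g`. -/
def lT (g : G) : E →L[ℝ] E :=
  (Γ.tm g (Γ.unit (Γ.src g))).comp (ContinuousLinearMap.inr ℝ E E)

variable (Γ) in
/-- Right translation by `g⁻¹`, from the tangent space at `g` to that at the unit at `t(g)`. -/
def rTInv (g : G) : E →L[ℝ] E :=
  (Γ.tm g (Γ.inv g)).comp (ContinuousLinearMap.inl ℝ E E)

theorem rT_apply (g : G) (X : E) : Γ.rT g X = Γ.tm (Γ.unit (Γ.tgt g)) g (X, 0) := rfl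

theorem lT_apply (g : G) (X : E) : Γ.lT g X = Γ.tm g (Γ.unit (Γ.src g)) (0, X) := rfl

variable {k : ℕ}

variable (Γ) in
/-- The condition that `u` takes values in the isotropy Lie algebras. -/
def IsIsotropic (u : Γ.Str k → E) : Prop :=
  ∀ g : Γ.Str k, Γ.ts (Γ.unit (g.obj 0)) (u g) = 0 ∧ Γ.tt (Γ.unit (g.obj 0)) (u g) = 0

theorem IsIsotropic.arr_zero {u : Γ.Str (k + 1) → E} (hu : Γ.IsIsotropic u) (g : Γ.Str (k + 1)) :
    Γ.ts (Γ.unit (Γ.tgt (g.arr 0))) (u g) = 0 ∧ Γ.tt (Γ.unit (Γ.tgt (g.arr 0))) (u g) = 0 := by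
  rw [g.tgt_arr_zero]; exact hu g

theorem IsIsotropic.tail {u : Γ.Str k → E} (hu : Γ.IsIsotropic u) (g : Γ.Str (k + 1)) :
    Γ.ts (Γ.unit (Γ.src (g.arr 0))) (u g.tail) = 0 ∧
      Γ.tt (Γ.unit (Γ.src (g.arr 0))) (u g.tail) = 0 := by
  rw [← g.obj_zero_tail]; exact hu g.tail

theorem IsIsotropic.face {u : Γ.Str k → E} (hu : Γ.IsIsotropic u) (g : Γ.Str (k + 1)) (j : ℕ) :
    Γ.ts (Γ.unit (Γ.tgt (g.arr 0))) (u (g.face j)) = 0 ∧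
      Γ.tt (Γ.unit (Γ.tgt (g.arr 0))) (u (g.face j)) = 0 := by
  have h := hu (g.face j)
  rwa [g.obj_face, ← g.tgt_arr_zero] at h

theorem inclusion_add (u v : ∀ g : Γ.Str k, TangentSpace 𝓘(ℝ, E) (Γ.unit (g.obj 0))) :
    Γ.inclusion (u + v) = Γ.inclusion u + Γ.inclusion v := by
  funext g
  cases k <;> simp only [inclusion, Pi.add_apply, map_add]

theorem inclusion_smul (a : ℝ) (u : ∀ g : Γ.Str k, TangentSpace 𝓘(ℝ, E) (Γ.unit (g.obj 0))) :
    Γ.inclusion (a • u) = a • Γ.inclusion u := by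
  funext g
  cases k <;> simp only [inclusion, Pi.smul_apply, map_smul]

variable [IsManifold 𝓘(ℝ, E) ∞ G]

theorem ts_rTInv {g : G} {X : E} (hX : Γ.ts g X = 0) :
    Γ.ts (Γ.unit (Γ.tgt g)) (Γ.rTInv g X) = 0 := by
  have h := ts_tm (Γ := Γ) (g := g) (X := X) (Y := 0) (Γ.tgt_inv g).symm (by rw [hX, map_zero])
  rwa [Γ.mul_inv, map_zero] at h

theorem tt_rTInv {g : G} {X : E} (hX : Γ.ts g X = 0) :
    Γ.tt (Γ.unit (Γ.tgt g)) (Γ.rTInv g X) = Γ.tt g X := by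
  have h := tt_tm (Γ := Γ) (g := g) (X := X) (Y := 0) (Γ.tgt_inv g).symm (by rw [hX, map_zero])
  rwa [Γ.mul_inv] at h

theorem rT_rTInv {g : G} {X : E} (hX : Γ.ts g X = 0) : Γ.rT g (Γ.rTInv g X) = X := by
  have h := tm_inv_tm (Γ := Γ) (p := g) (g := g) rfl hX
  rwa [Γ.mul_inv] at h

theorem rTInv_rT {g : G} {X : E} (hX : Γ.ts (Γ.unit (Γ.tgt g)) X = 0) :
    Γ.rTInv g (Γ.rT g X) = X := by
  have h := tm_tm_inv (Γ := Γ) (g := g) (Γ.src_unit (Γ.tgt g)) hX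
  rwa [Γ.unit_mul] at h

theorem PlotSmooth.rTInv [IsManifold 𝓘(ℝ, F) ∞ M] {a : Γ.Str k → G} {X : Γ.Str k → E}
    (hX : PlotSmooth a X) (h0 : ∀ g, Γ.ts (a g) (X g) = 0) :
    PlotSmooth (fun g => Γ.unit (Γ.tgt (a g))) (fun g => Γ.rTInv (a g) (X g)) :=
  (hX.tm (b := fun g => Γ.inv (a g)) (Y := fun _ => 0)
    (PlotSmooth.zero fun n γ hγ => Γ.inv_smooth.comp (hX.base n γ hγ)) (fun _ => (Γ.tgt_inv _).symm)
    fun g => by rw [h0, map_zero]).congr (fun _ => (Γ.mul_inv _).symm) fun _ => rfl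

variable (Γ) in
/-- The differential of isotropy-valued cochains. -/
def isotropyD (u : Γ.Str k → E) (g : Γ.Str (k + 1)) : E :=
  Γ.rTInv (g.arr 0) (Γ.lT (g.arr 0) (u g.tail)) + faceSum u g

theorem IsIsotropic.ts_lT {u : Γ.Str k → E} (hu : Γ.IsIsotropic u) (g : Γ.Str (k + 1)) :
    Γ.ts (g.arr 0) (Γ.lT (g.arr 0) (u g.tail)) = 0 :=
  (ts_lTranslate _ (hu.tail g).2).trans (hu.tail g).1

theorem IsIsotropic.isotropyD {u : Γ.Str k → E} (hu : Γ.IsIsotropic u) :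
    Γ.IsIsotropic (Γ.isotropyD u) := by
  intro g
  have h1 := hu.ts_lT g
  have h2 : Γ.tt (g.arr 0) (Γ.lT (g.arr 0) (u g.tail)) = 0 := tt_lTranslate _ (hu.tail g).2
  rw [← g.tgt_arr_zero]
  simp only [LieGroupoid.isotropyD, map_add, faceSum, map_sum, map_smul, ts_rTInv h1, tt_rTInv h1,
    h2, (hu.face g _).1, (hu.face g _).2, smul_zero, Finset.sum_const_zero, add_zero, and_self]

/-- Right translation by g₁ cancels the r_{g₁⁻¹} in the isotropy action. Only left and right
translations remain, ready to be compared with the differential of the included cochain. -/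
theorem rT_isotropyD {u : Γ.Str k → E} (hu : Γ.IsIsotropic u) (g : Γ.Str (k + 1)) :
    Γ.rT (g.arr 0) (Γ.isotropyD u g) = Γ.lT (g.arr 0) (u g.tail) +
      ∑ j ∈ Finset.range (k + 1), (-1 : ℝ) ^ (j + 1) • Γ.rT (g.arr 0) (u (g.face j)) := by
  simp only [isotropyD, map_add, rT_rTInv (hu.ts_lT g), faceSum, map_sum, map_smul]

theorem inclusion_eq_rT {u : Γ.Str (k + 1) → E} (hu : Γ.IsIsotropic u) :
    (Γ.inclusion u : Γ.Str (k + 1) → E) = fun g => Γ.rT (g.arr 0) (u g) :=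
  funext fun g => inclusion_succ_apply (hu g).1

theorem isotropyDelta_eq {u : Γ.Str k → E} (hu : Γ.IsIsotropic u) :
    Γ.diffDelta (fun x => TangentSpace 𝓘(ℝ, E) (Γ.unit x)) Γ.isotropyAct k u = Γ.isotropyD u :=
  funext fun g => isotropyDelta_apply hu g

/-- Inversion acts by -1 on the isotropy, so δu is the right translate of u at the target minus the
left translate of u at the source. This is the opposite of the isotropy differential and the source
of the sign in degree 0. -/
theorem defDeltaZero_inclusion {u : Γ.Str 0 → E} (hu : Γ.IsIsotropic u) (g : Γ.Str 1) :
    (Γ.defDeltaZero u g : E) = -Γ.rT (g.arr 0) (Γ.isotropyD u g) := by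
  refine Eq.trans (α := E) (defDeltaZero_apply (fun g => (hu g).1) g) ?_
  rw [rT_isotropyD hu, ti_of_ts_eq_zero _ (hu.tail g).1 (hu.tail g).2, ← Str.face_self,
    show ((0 : E), -u g.tail) = -(0, u g.tail) by simp, map_neg, ← lT_apply, ← rT_apply]
  simp

/-- Split dm̄ by linearity. As di = -1 on the isotropy, dm̄ (r_{g₁g₂} X, r_{g₂} Y) = r_{g₁} X -
l_{g₁} Y. With the minus sign of δ, these are the right translates of the first two terms of the
isotropy differential. -/
theorem defDeltaSucc_inclusion {u : Γ.Str (k + 1) → E} (hu : Γ.IsIsotropic u) (g : Γ.Str (k + 2)) :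
    (Γ.defDeltaSucc k (fun g : Γ.Str (k + 1) => Γ.rT (g.arr 0) (u g)) g : E) =
      Γ.rT (g.arr 0) (Γ.isotropyD u g) := by
  refine Eq.trans (α := E) (defDeltaSucc_apply (σ := 0)
    (fun g => ts_rTranslate _ (hu.arr_zero g).1) g) ?_
  have hc := g.composable_zero
  have h1 := td_rTranslate_left hc (hu.face g 0).1
  have h2 := td_rTranslate_right hc (hu.arr_zero g.tail).1
  have e1 : Γ.tm (Γ.unit (Γ.tgt ((g.face 0).arr 0))) ((g.face 0).arr 0) (u (g.face 0), 0) =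
      Γ.tm (Γ.unit (Γ.tgt (g.arr 0))) (Γ.mul (g.arr 0) (g.arr 1)) (u (g.face 0), 0) := by
    rw [g.arr_face_zero, Γ.tgt_mul _ _ hc]
  have e2 : ∀ X Y : E, (X, Y) = (X, 0) + (0, Y) := fun X Y => by simp
  have e3 : ((0 : E), -u g.tail) = -(0, u g.tail) := by simp
  rw [rT_isotropyD hu, e1, e2, map_add, h1, g.arr_tail, h2,
    ti_of_ts_eq_zero _ (hu.tail g).1 (hu.tail g).2, e3, map_neg, ← lT_apply, ← rT_apply,
    Finset.sum_range_succ' _ (k + 1)]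
  simp only [g.arr_face_succ]
  simp
  abel

variable [IsManifold 𝓘(ℝ, F) ∞ M]

theorem isotropyD_mem {u : Γ.Str k → E} (hu : u ∈ Γ.isotropyComplex.C k) :
    Γ.isotropyD u ∈ Γ.isotropyComplex.C (k + 1) := by
  rw [mem_isotropyComplex] at hu ⊢
  obtain ⟨hs, hu⟩ := hu
  have hu : Γ.IsIsotropic u := hu
  refine ⟨?_, hu.isotropyD⟩
  refine PlotSmooth.add ?_ ?_
  · refine (PlotSmooth.rTInv (a := fun g : Γ.Str (k + 1) => g.arr 0) (PlotSmooth.lTranslate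
      plotSmooth_arr_zero (hs.tail.congr (fun g => ?_) fun _ => rfl) fun g => (hu.tail g).2)
      hu.ts_lT).congr (fun g => ?_) fun _ => rfl
    · rw [g.obj_zero_tail]
    · rw [g.tgt_arr_zero]
  · exact PlotSmooth.sum_range (k + 1) fun j => ((hs.face j).congr (fun g => by rw [g.obj_face])
      fun _ => rfl).const_smul _

theorem isotropyComplex_d_mem {u : Γ.Str k → E} (hu : u ∈ Γ.isotropyComplex.C k) :
    Γ.isotropyComplex.d k u ∈ Γ.isotropyComplex.C (k + 1) := by
  have h := isotropyD_mem hu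
  rwa [← isotropyDelta_eq (mem_isotropyComplex.1 hu).2] at h

variable (Γ) in
/-- The inclusion of isotropy-valued cochains, as a linear map. -/
def inclusionₗ (k : ℕ) : Γ.isotropyComplex.X k →ₗ[ℝ] Γ.defComplex.X k where
  toFun u := Γ.inclusion u
  map_add' u v := inclusion_add u v
  map_smul' a u := inclusion_smul a u

theorem inclusion_injOn : ∀ k, Set.InjOn (Γ.inclusionₗ k)
    (Γ.isotropyComplex.C k : Set (Γ.isotropyComplex.X k))
  | 0, u, _, v, _, h => funext fun g => by
      have h1 : (Γ.inclusion u g : E) = Γ.inclusion v g := congrFun h g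
      exact (inclusion_zero_apply u g).symm.trans (h1.trans (inclusion_zero_apply v g))
  | k + 1, u, hu, v, hv, h => funext fun g => by
      have hu : Γ.IsIsotropic u := (mem_isotropyComplex.1 hu).2
      have hv : Γ.IsIsotropic v := (mem_isotropyComplex.1 hv).2
      have h1 : Γ.inclusion u = Γ.inclusion v := h
      have h2 : (fun g : Γ.Str (k + 1) => Γ.rT (g.arr 0) (u g)) =
        fun g => Γ.rT (g.arr 0) (v g) := (inclusion_eq_rT hu).symm.trans (h1.trans (inclusion_eq_rT hv))
      have h3 := congrArg (Γ.rTInv (g.arr 0)) (congrFun h2 g)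
      rwa [rTInv_rT (hu.arr_zero g).1, rTInv_rT (hv.arr_zero g).1] at h3

theorem inclusion_mem : ∀ k, ∀ u ∈ Γ.isotropyComplex.C k, Γ.inclusionₗ k u ∈ Γ.defComplex.C k
  | 0, u, hu => by
      have h := mem_isotropyComplex.1 hu
      exact mem_defComplex_zero.2 ⟨h.1, fun g => (h.2 g).1⟩
  | k + 1, u, hu => by
      have h := mem_isotropyComplex.1 hu
      have h2 : Γ.IsIsotropic u := h.2
      have h3 : (fun g : Γ.Str (k + 1) => Γ.rT (g.arr 0) (u g)) ∈ Γ.defComplex.C (k + 1) :=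
        mem_defComplex_succ.2 ⟨PlotSmooth.rTranslate plotSmooth_arr_zero
          (h.1.congr (fun g => by rw [g.tgt_arr_zero]) fun _ => rfl) fun g => (h2.arr_zero g).1,
          0, fun g => ts_rTranslate _ (h2.arr_zero g).1⟩
      have e : (Γ.inclusionₗ (k + 1) u : Γ.Str (k + 1) → E) = _ := inclusion_eq_rT h2
      rw [e]
      exact h3

theorem d_inclusion : ∀ k, ∀ u ∈ Γ.isotropyComplex.C k, Γ.defComplex.d k (Γ.inclusionₗ k u) =
    (if k = 0 then (-1 : ℝ) else 1) • Γ.inclusionₗ (k + 1) (Γ.isotropyComplex.d k u)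
  | 0, u, hu => by
      have h2 : Γ.IsIsotropic u := (mem_isotropyComplex.1 hu).2
      rw [if_pos rfl, neg_one_smul]
      have h3 : (Γ.inclusion (Γ.isotropyD u) : Γ.Str 1 → E) = _ := inclusion_eq_rT h2.isotropyD
      funext g
      refine Eq.trans (α := E) (defDeltaZero_inclusion h2 g) ?_
      have h4 : Γ.isotropyComplex.d 0 u = Γ.isotropyD u := isotropyDelta_eq h2
      rw [h4]
      exact (congrArg (fun X : E => -X) (congrFun h3 g)).symm
  | k + 1, u, hu => by
      have h2 : Γ.IsIsotropic u := (mem_isotropyComplex.1 hu).2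
      rw [if_neg (Nat.succ_ne_zero k), one_smul]
      have h3 : (Γ.inclusion (Γ.isotropyD u) : Γ.Str (k + 2) → E) = _ := inclusion_eq_rT h2.isotropyD
      have h4 : Γ.isotropyComplex.d (k + 1) u = Γ.isotropyD u := isotropyDelta_eq h2
      have h5 : (Γ.inclusionₗ (k + 1) u : Γ.Str (k + 1) → E) = _ := inclusion_eq_rT h2
      rw [h4, h5]
      refine Eq.trans ?_ h3.symm
      exact funext (defDeltaSucc_inclusion h2)

theorem exists_eq_inclusion_zero {α : Γ.Str 0 → E} (hα : α ∈ Γ.defComplex.C 0)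
    (ht : ∀ g : Γ.Str 0, Γ.tt (Γ.unit (g.obj 0)) (α g) = 0) :
    ∃ u ∈ Γ.isotropyComplex.C 0, α = Γ.inclusionₗ 0 u :=
  ⟨α, mem_isotropyComplex.2 ⟨hα.1, fun g => ⟨hα.2 g, ht g⟩⟩, rfl⟩

/-- Translate c back to the units by r_{g₁⁻¹}. The result is smooth, and it lies in the isotropy
because ds and dt vanish on c. -/
theorem exists_eq_inclusion_succ {c : Γ.Str (k + 1) → E}
    (hs : PlotSmooth (fun g => g.arr 0) c) (h0 : ∀ g, Γ.ts (g.arr 0) (c g) = 0)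
    (ht : ∀ g, Γ.tt (g.arr 0) (c g) = 0) :
    ∃ u ∈ Γ.isotropyComplex.C (k + 1), c = Γ.inclusionₗ (k + 1) u := by
  have h1 : Γ.IsIsotropic fun g : Γ.Str (k + 1) => Γ.rTInv (g.arr 0) (c g) := fun g => by
    rw [← g.tgt_arr_zero]
    exact ⟨ts_rTInv (h0 g), (tt_rTInv (h0 g)).trans (ht g)⟩
  refine ⟨fun g => Γ.rTInv (g.arr 0) (c g), mem_isotropyComplex.2 ⟨?_, h1⟩, ?_⟩
  · exact (hs.rTInv h0).congr (fun g => by rw [g.tgt_arr_zero]) fun _ => rfl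
  · refine Eq.trans ?_ (inclusion_eq_rT h1).symm
    exact funext fun g => (rT_rTInv (h0 g)).symm

theorem isComplex_isotropyComplex : Γ.isotropyComplex.IsComplex :=
  CochainData.isComplex_of_injective isComplex_defComplex Γ.inclusionₗ
    (fun k => if k = 0 then -1 else 1) inclusion_injOn (fun k => by split_ifs <;> norm_num)
    inclusion_mem (fun _ _ hu => isotropyComplex_d_mem hu) d_inclusion

end Isotropy

end LieGroupoid

/-! ### The projection to the normal complex -/

namespace LieGroupoid

section Projection

variable {E F G M : Type*}
  [NormedAddCommGroup E] [NormedSpace ℝ E] [NormedAddCommGroup F] [NormedSpace ℝ F]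
  [TopologicalSpace G] [ChartedSpace E G] [TopologicalSpace M] [ChartedSpace F M]
  {Γ : LieGroupoid E F G M} {k : ℕ}

variable (Γ) in
/-- The `s`-projection of an `s`-projectable cochain, computed on strings starting with a unit. -/
def sProj (c : Γ.Str (k + 1) → E) (h : Γ.Str k) : F := Γ.ts (Γ.unit (h.obj 0)) (c h.consUnit)

/-- Every string is the tail of one beginning with a unit, so an s-projection is unique and can be
read off there. -/
theorem sProj_eq {c : Γ.Str (k + 1) → E} {σ : Γ.Str k → F}
    (hc : ∀ g, Γ.ts (g.arr 0) (c g) = σ g.tail) : Γ.sProj c = σ :=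
  funext fun h => hc h.consUnit

theorem ts_eq_sProj {c : Γ.Str (k + 1) → E} (hc : ∃ σ : Γ.Str k → F,
    ∀ g : Γ.Str (k + 1), Γ.ts (g.arr 0) (c g) = σ g.tail) (g : Γ.Str (k + 1)) :
    Γ.ts (g.arr 0) (c g) = Γ.sProj c g.tail := by
  obtain ⟨σ, hσ⟩ := hc
  rw [sProj_eq hσ, hσ]

theorem normalClass_eq_zero {σ : Γ.Str k → F} : Γ.normalClass σ = 0 ↔
    ∀ g : Γ.Str k, ∃ a : E, Γ.ts (Γ.unit (g.obj 0)) a = 0 ∧ Γ.tt (Γ.unit (g.obj 0)) a = σ g :=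
  funext_iff.trans (forall_congr' fun _ => normalMk_eq_zero)

theorem normalClass_neg (σ : Γ.Str k → F) :
    Γ.normalClass (fun g => -σ g) = -Γ.normalClass σ :=
  funext fun g => map_neg (Γ.normalMk (g.obj 0)) (σ g)

theorem PlotSmooth.faceSum {V B : Type*} [NormedAddCommGroup V] [NormedSpace ℝ V]
    [TopologicalSpace B] [ChartedSpace V B] [IsManifold 𝓘(ℝ, V) ∞ B] {f : M → B} {X : Γ.Str k → V}
    (h : PlotSmooth (fun g => f (g.obj 0)) X) :
    PlotSmooth (fun g : Γ.Str (k + 1) => f (g.obj 0)) (faceSum X) :=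
  PlotSmooth.sum_range (k + 1) fun j =>
    ((h.face j).congr (fun g => by rw [g.obj_face]) fun _ => rfl).const_smul _

variable [IsManifold 𝓘(ℝ, E) ∞ G] [IsManifold 𝓘(ℝ, F) ∞ M]

variable (Γ) in
/-- The projection of deformation cochains to cochains with values in the normal representation. -/
def normalProj (k : ℕ) : Γ.defComplex.X (k + 1) →ₗ[ℝ] Γ.normalComplex.X k where
  toFun c := Γ.normalClass (Γ.sProj c)
  map_add' c c' := funext fun h => (congrArg (Γ.normalMk (h.obj 0))
    (map_add (Γ.ts (Γ.unit (h.obj 0))) (c h.consUnit : E) (c' h.consUnit : E))).trans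
      (map_add (Γ.normalMk (h.obj 0)) _ _)
  map_smul' a c := funext fun h => (congrArg (Γ.normalMk (h.obj 0))
    (map_smul (Γ.ts (Γ.unit (h.obj 0))) a (c h.consUnit : E))).trans
      (map_smul (Γ.normalMk (h.obj 0)) _ _)

theorem normalProj_apply {c : Γ.Str (k + 1) → E} {σ : Γ.Str k → F}
    (hc : ∀ g, Γ.ts (g.arr 0) (c g) = σ g.tail) : Γ.normalProj k c = Γ.normalClass σ :=
  congrArg (fun σ : Γ.Str k → F => Γ.normalClass σ) (sProj_eq hc)

theorem PlotSmooth.sProj {c : Γ.Str (k + 1) → E} (hs : PlotSmooth (fun g => g.arr 0) c) :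
    PlotSmooth (fun h : Γ.Str k => h.obj 0) (Γ.sProj c) :=
  hs.consUnit.ts.congr (fun _ => (Γ.src_unit _).symm) fun _ => rfl

theorem normalClass_mem {σ : Γ.Str k → F} (hσ : PlotSmooth (fun h : Γ.Str k => h.obj 0) σ) :
    Γ.normalClass σ ∈ Γ.normalComplex.C k :=
  fun n γ hγ _ => ⟨univ, fun z => σ (γ z), isOpen_univ, mem_univ _,
    fun z _ => (hσ n γ hγ z).contMDiffWithinAt, fun _ _ => rfl⟩

theorem normalProj_mem (k : ℕ) (c : Γ.defComplex.X (k + 1)) (hc : c ∈ Γ.defComplex.C (k + 1)) :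
    Γ.normalProj k c ∈ Γ.normalComplex.C k :=
  normalClass_mem (PlotSmooth.sProj (mem_defComplex_succ.1 hc).1)

theorem normalD_apply {c : Γ.Str (k + 1) → E} {σ : Γ.Str k → F}
    (hc : ∀ g, Γ.ts (g.arr 0) (c g) = σ g.tail) :
    Γ.normalComplex.d k (Γ.normalClass σ) =
      Γ.normalClass fun h : Γ.Str (k + 1) => Γ.tt (h.arr 0) (c h) + faceSum σ h :=
  funext fun h => normalDelta_apply h (hc h)

/-- The s-projection of δc is minus dt c + ∂σ, with ∂ the sum over the faces other than the tail.
The class of dt c + ∂σ is the normal differential of [σ], because c itself is a lift of σ along ds.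
-/
theorem normalProj_d (k : ℕ) (c : Γ.defComplex.X (k + 1)) (hc : c ∈ Γ.defComplex.C (k + 1)) :
    Γ.normalProj (k + 1) (Γ.defComplex.d (k + 1) c) = -Γ.normalComplex.d k (Γ.normalProj k c) := by
  obtain ⟨σ, hσ⟩ := (mem_defComplex_succ.1 hc).2
  rw [normalProj_apply hσ, normalD_apply hσ]
  exact (normalProj_apply (σ := fun h => -(Γ.tt (h.arr 0) (c h : E) + faceSum σ h))
    (ts_defDeltaSucc hσ)).trans (normalClass_neg _)

theorem normalProj_d_zero (α : Γ.defComplex.X 0) (hα : α ∈ Γ.defComplex.C 0) :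
    Γ.normalProj 0 (Γ.defComplex.d 0 α) = 0 := by
  have h := (mem_defComplex_zero.1 hα).2
  refine (normalProj_apply (σ := fun g => Γ.tt (Γ.unit (g.obj 0)) (α g : E))
    (ts_defDeltaZero h)).trans ?_
  exact normalClass_eq_zero.2 fun g => ⟨α g, h g, rfl⟩

theorem ts_inclusion {u : Γ.Str (k + 1) → E} (hu : u ∈ Γ.isotropyComplex.C (k + 1))
    (g : Γ.Str (k + 1)) : Γ.ts (g.arr 0) (Γ.inclusionₗ (k + 1) u g : E) = 0 := by
  have h : Γ.IsIsotropic u := (mem_isotropyComplex.1 hu).2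
  refine (congrArg (Γ.ts (g.arr 0)) (congrFun (inclusion_eq_rT h) g)).trans ?_
  exact ts_rTranslate _ (h.arr_zero g).1

theorem normalProj_inclusion (k : ℕ) (u : Γ.isotropyComplex.X (k + 1))
    (hu : u ∈ Γ.isotropyComplex.C (k + 1)) : Γ.normalProj k (Γ.inclusionₗ (k + 1) u) = 0 :=
  (normalProj_apply (σ := 0) (ts_inclusion hu)).trans
    (normalClass_eq_zero.2 fun _ => ⟨0, map_zero _, map_zero _⟩)

/-- The s-projection of δα is ρ(α), while that of an included cochain is zero. Hence ρ(α) = 0. -/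
theorem exists_eq_inclusion_of_d_eq (α : Γ.defComplex.X 0) (hα : α ∈ Γ.defComplex.C 0)
    (u : Γ.isotropyComplex.X 1) (hu : u ∈ Γ.isotropyComplex.C 1)
    (h : Γ.defComplex.d 0 α = Γ.inclusionₗ 1 u) :
    ∃ u' ∈ Γ.isotropyComplex.C 0, α = Γ.inclusionₗ 0 u' := by
  refine exists_eq_inclusion_zero hα fun g => ?_
  have h1 := ts_defDeltaZero (mem_defComplex_zero.1 hα).2 g.consUnit
  refine h1.symm.trans ?_
  refine (congrArg (Γ.ts (g.consUnit.arr 0)) (congrFun h g.consUnit)).trans ?_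
  exact ts_inclusion hu g.consUnit

/-- If the differential of `c` is isotropy-valued, then `dt ∘ c` is determined by the
`s`-projection of `c`. -/
theorem tt_eq_neg_faceSum {c : Γ.Str (k + 1) → E} {σ : Γ.Str k → F}
    (hc : ∀ g, Γ.ts (g.arr 0) (c g) = σ g.tail) {w : Γ.Str (k + 2) → E}
    (hw : w ∈ Γ.isotropyComplex.C (k + 2)) (h : Γ.defComplex.d (k + 1) c = Γ.inclusionₗ (k + 2) w)
    (g : Γ.Str (k + 1)) : Γ.tt (g.arr 0) (c g) = -faceSum σ g := by
  have h1 := ts_defDeltaSucc hc g.consUnit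
  have h2 := (congrArg (Γ.ts (g.consUnit.arr 0)) (congrFun h g.consUnit)).trans
    (ts_inclusion hw g.consUnit)
  exact eq_neg_of_add_eq_zero_left (neg_eq_zero.1 (h1.symm.trans h2))

/-! ### Lifting normal cocycles, and cochains with trivial projection -/

section Splittings

variable (Γ) in
/-- A smooth family of linear maps `κ x : T_x M → A_x` with `ρ (κ x v) = v` for `v ∈ Im ρ`. -/
structure AnchorSplitting (κ : M → F →L[ℝ] E) : Prop where
  ts : ∀ x v, Γ.ts (Γ.unit x) (κ x v) = 0
  tt : ∀ x (v : F), (v : TangentSpace 𝓘(ℝ, F) x) ∈ Γ.imAnchor x → Γ.tt (Γ.unit x) (κ x v) = v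
  smooth : SmoothHomOn (C := F) id Γ.unit κ univ

variable (Γ) in
/-- A smooth family of linear right inverses of `ds`. -/
structure SrcSplitting (τ : G → F →L[ℝ] E) : Prop where
  ts : ∀ g v, Γ.ts g (τ g v) = v
  smooth : SmoothHomOn (C := E) Γ.src id τ univ

variable {κ : M → F →L[ℝ] E} {τ : G → F →L[ℝ] E}

theorem PlotSmooth.splitting_anchor (hκ : Γ.AnchorSplitting κ) {σ : Γ.Str k → F}
    (hσ : PlotSmooth (fun h : Γ.Str k => h.obj 0) σ) :
    PlotSmooth (fun h : Γ.Str k => Γ.unit (h.obj 0)) (fun h => κ (h.obj 0) (σ h)) :=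
  PlotSmooth.hom (C := F) hκ.smooth (fun _ _ hγ => hγ.1 0) hσ

/-- Smoothness of v provides only local smooth representatives along plots. The map ρκ is a
projection onto Im ρ, so 1 - ρκ applied to a representative depends only on its class. This selects
one global representative, which is smooth because it can be computed from the local ones. -/
theorem exists_plotSmooth_normalClass_eq (hκ : Γ.AnchorSplitting κ)
    {v : Γ.normalComplex.X k} (hv : v ∈ Γ.normalComplex.C k) :
    ∃ σ : Γ.Str k → F, PlotSmooth (fun h : Γ.Str k => h.obj 0) σ ∧ Γ.normalClass σ = v := by
  have hrep : ∀ h : Γ.Str k, ∃ w : F, Γ.normalMk (h.obj 0) w = v h := fun h =>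
    Submodule.mkQ_surjective _ (v h)
  choose r hr using hrep
  have hker : ∀ x (w : F), Γ.normalMk x (Γ.tt (Γ.unit x) (κ x w)) = 0 := fun x w =>
    normalMk_eq_zero.2 ⟨κ x w, hκ.ts x w, rfl⟩
  refine ⟨fun h => r h - Γ.tt (Γ.unit (h.obj 0)) (κ (h.obj 0) (r h)), ?_, ?_⟩
  · intro n γ hγ z₀
    obtain ⟨U, V, hU, hz, hV, hVv⟩ := hv n γ hγ z₀
    let W : EuclideanSpace ℝ (Fin n) → F := V
    have h1 : SmoothVecAt (D := EuclideanSpace ℝ (Fin n)) (fun z => (γ z).obj 0) W z₀ :=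
      hV.contMDiffAt (hU.mem_nhds hz)
    have h2 := smoothVecAt_tt (Γ := Γ) (hκ.smooth n (fun z => (γ z).obj 0) W z₀ (mem_univ _)
      (hγ.1 0).contMDiffAt h1)
    have h3 := h1.sub (h2.congr (Filter.Eventually.of_forall fun z =>
      ⟨(Γ.tgt_unit ((γ z).obj 0)).symm, rfl⟩))
    refine h3.congr ?_
    filter_upwards [hU.mem_nhds hz] with z hzU
    refine ⟨rfl, ?_⟩
    -- The arbitrary representative `r` and the smooth one `W` differ by an element of Im ρ, which 1
    -- - ρκ kills.
    have h4 : Γ.normalMk ((γ z).obj 0) (r (γ z) - W z) = 0 := by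
      rw [map_sub, hr, sub_eq_zero]
      exact hVv z hzU
    have h5 := hκ.tt _ _ ((Submodule.Quotient.mk_eq_zero _).1 h4)
    rw [map_sub, map_sub] at h5
    rw [sub_eq_sub_iff_sub_eq_sub, ← h5]
  · funext h
    refine Eq.trans (b := Γ.normalMk (h.obj 0) _) rfl ?_
    rw [map_sub, hker, sub_zero, hr]

theorem splitting_src_mem (hτ : Γ.SrcSplitting τ) {σ : Γ.Str k → F}
    (hσ : PlotSmooth (fun h : Γ.Str k => h.obj 0) σ) :
    PlotSmooth (fun g : Γ.Str (k + 1) => g.arr 0) (fun g => τ (g.arr 0) (σ g.tail)) :=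
  PlotSmooth.hom (C := E) hτ.smooth (fun _ _ hγ => hγ.2 0)
    (hσ.tail.congr (fun g => g.obj_zero_tail.symm) fun _ => rfl)

theorem normalProj_surjOn (hκ : Γ.AnchorSplitting κ)
    (hτ : Γ.SrcSplitting τ)
    (k : ℕ) (v : Γ.normalComplex.X k) (hv : v ∈ Γ.normalComplex.C k) :
    ∃ c ∈ Γ.defComplex.C (k + 1), Γ.normalProj k c = v := by
  obtain ⟨σ, hσ, rfl⟩ := exists_plotSmooth_normalClass_eq hκ hv
  have h : ∀ g : Γ.Str (k + 1), Γ.ts (g.arr 0) (τ (g.arr 0) (σ g.tail)) = σ g.tail :=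
    fun g => hτ.ts _ _
  exact ⟨fun g => τ (g.arr 0) (σ g.tail),
    mem_defComplex_succ.2 ⟨splitting_src_mem hτ hσ, σ, h⟩, normalProj_apply h⟩

/-- Start from any lift c₀ of a representative σ. That [σ] is a cocycle says exactly that dt c₀ + ∂σ
has values in Im ρ, with ∂ the sum over the faces other than the tail. Removing this defect by a
right-translated lift along the anchor gives dt c = -∂σ, and then ds and dt both kill δc, the latter
by ∂∂ = 0. -/
theorem exists_lift_isotropic (hκ : Γ.AnchorSplitting κ)
    (hτ : Γ.SrcSplitting τ)
    (k : ℕ) (v : Γ.normalComplex.X k) (hv : v ∈ Γ.normalComplex.Z k) :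
    ∃ c ∈ Γ.defComplex.C (k + 1), Γ.normalProj k c = v ∧
      ∃ w ∈ Γ.isotropyComplex.C (k + 2), Γ.defComplex.d (k + 1) c = Γ.inclusionₗ (k + 2) w := by
  obtain ⟨σ, hσ, rfl⟩ := exists_plotSmooth_normalClass_eq hκ hv.1
  let c₀ : Γ.Str (k + 1) → E := fun g => τ (g.arr 0) (σ g.tail)
  have h0 : ∀ g, Γ.ts (g.arr 0) (c₀ g) = σ g.tail := fun g => hτ.ts _ _
  have hs0 : PlotSmooth (fun g : Γ.Str (k + 1) => g.arr 0) c₀ := splitting_src_mem hτ hσ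
  let s : Γ.Str (k + 1) → F := fun g => Γ.tt (g.arr 0) (c₀ g) + faceSum σ g
  have hs : PlotSmooth (fun g : Γ.Str (k + 1) => g.obj 0) s :=
    (hs0.tt.congr (fun g => g.tgt_arr_zero.symm) fun _ => rfl).add (PlotSmooth.faceSum (f := id) hσ)
  have hsz : Γ.normalClass s = 0 := (normalD_apply h0).symm.trans hv.2
  have hst : ∀ g : Γ.Str (k + 1), Γ.tt (Γ.unit (g.obj 0)) (κ (g.obj 0) (s g)) = s g := fun g =>
    hκ.tt _ _ (Γ.mem_imAnchor.2 (normalClass_eq_zero.1 hsz g))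
  -- Right translates of elements of A are killed by ds, so the s-projection stays σ, while dt
  -- changes by -s.
  let c : Γ.Str (k + 1) → E := fun g => c₀ g - Γ.rT (g.arr 0) (κ (g.obj 0) (s g))
  have hκg : ∀ g : Γ.Str (k + 1), Γ.ts (Γ.unit (Γ.tgt (g.arr 0))) (κ (g.obj 0) (s g)) = 0 :=
    fun g => by rw [g.tgt_arr_zero]; exact hκ.ts _ _
  have hc : ∀ g, Γ.ts (g.arr 0) (c g) = σ g.tail := fun g => by
    simp only [c, map_sub, rT_apply, ts_rTranslate _ (hκg g), sub_zero, h0]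
  have hct : ∀ g, Γ.tt (g.arr 0) (c g) = -faceSum σ g := fun g => by
    simp only [c, map_sub, rT_apply, tt_rTranslate _ (hκg g)]
    rw [g.tgt_arr_zero, hst]
    simp [s]
  have hcs : PlotSmooth (fun g : Γ.Str (k + 1) => g.arr 0) c :=
    hs0.sub (PlotSmooth.rTranslate plotSmooth_arr_zero
      ((PlotSmooth.splitting_anchor hκ hs).congr (fun g => by rw [g.tgt_arr_zero]) fun _ => rfl) hκg)
  have hcm : c ∈ Γ.defComplex.C (k + 1) := mem_defComplex_succ.2 ⟨hcs, σ, hc⟩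
  refine ⟨c, hcm, normalProj_apply hc, ?_⟩
  refine exists_eq_inclusion_succ (k := k + 1) (mem_defComplex_succ.1 (defDeltaSucc_mem hcm)).1
    (fun g => ?_) fun g => ?_
  · refine (ts_defDeltaSucc hc g).trans ?_
    rw [hct, neg_add_cancel, neg_zero]
  · refine (tt_defDeltaSucc hc g).trans ?_
    have : (fun g : Γ.Str (k + 1) => Γ.tt (g.arr 0) (c g)) = fun g => -faceSum σ g := funext hct
    have h2 := faceSum_faceSum σ g
    rw [this]
    rw [faceSum] at h2 ⊢
    simp only [smul_neg, Finset.sum_neg_distrib, h2, neg_zero]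

/-- This carries the acyclicity of the kernel of the projection modulo isotropy-valued cochains:
when σ is tangent to the orbits, a coboundary realizes it as s-projection, together with the value
of dt forced by δδ = 0. The sign of e depends on the degree: ds (δα) is ρ(α) in degree 0, but for
higher-degree e with ds e = 0 it is -dt e on the tail. -/
theorem exists_primitive (hκ : Γ.AnchorSplitting κ) : ∀ {k : ℕ} {σ : Γ.Str k → F},
    PlotSmooth (fun h : Γ.Str k => h.obj 0) σ → Γ.normalClass σ = 0 → ∃ e ∈ Γ.defComplex.C k,
      (∀ g : Γ.Str (k + 1), Γ.ts (g.arr 0) (Γ.defComplex.d k e g : E) = σ g.tail) ∧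
      ∀ g : Γ.Str (k + 1), Γ.tt (g.arr 0) (Γ.defComplex.d k e g : E) = -faceSum σ g
  | 0, σ, hσ, h0 => by
    have hκσ : ∀ g : Γ.Str 0, Γ.tt (Γ.unit (g.obj 0)) (κ (g.obj 0) (σ g)) = σ g := fun g =>
      hκ.tt _ _ (Γ.mem_imAnchor.2 (normalClass_eq_zero.1 h0 g))
    have hs : ∀ g : Γ.Str 0, Γ.ts (Γ.unit (g.obj 0)) (κ (g.obj 0) (σ g)) = 0 := fun g => hκ.ts _ _
    refine ⟨fun g => κ (g.obj 0) (σ g), mem_defComplex_zero.2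
      ⟨PlotSmooth.splitting_anchor hκ hσ, hs⟩, fun g => ?_, fun g => ?_⟩
    · exact (ts_defDeltaZero hs g).trans (hκσ _)
    · refine (tt_defDeltaZero hs g).trans ((hκσ _).trans ?_)
      -- In degree 0 the face sum has the single term -σ on the string without its last arrow.
      rw [← g.face_self]
      simp [faceSum]
  | k + 1, σ, hσ, h0 => by
    have hκσ : ∀ g : Γ.Str (k + 1), Γ.tt (Γ.unit (g.obj 0)) (κ (g.obj 0) (σ g)) = σ g := fun g =>
      hκ.tt _ _ (Γ.mem_imAnchor.2 (normalClass_eq_zero.1 h0 g))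
    have hs : ∀ g : Γ.Str (k + 1), Γ.ts (Γ.unit (Γ.tgt (g.arr 0))) (κ (g.obj 0) (σ g)) = 0 :=
      fun g => by rw [g.tgt_arr_zero]; exact hκ.ts _ _
    let e : Γ.Str (k + 1) → E := fun g => -Γ.rT (g.arr 0) (κ (g.obj 0) (σ g))
    have he : ∀ g, Γ.ts (g.arr 0) (e g) = (0 : Γ.Str k → F) g.tail := fun g => by
      simp only [e, map_neg, rT_apply, ts_rTranslate _ (hs g), neg_zero, Pi.zero_apply]
    have het : ∀ g, Γ.tt (g.arr 0) (e g) = -σ g := fun g => by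
      simp only [e, map_neg, rT_apply, tt_rTranslate _ (hs g)]
      rw [g.tgt_arr_zero, hκσ]
    refine ⟨e, mem_defComplex_succ.2 ⟨PlotSmooth.neg (PlotSmooth.rTranslate plotSmooth_arr_zero
      ((PlotSmooth.splitting_anchor hκ hσ).congr (fun g => by rw [g.tgt_arr_zero]) fun _ => rfl) hs),
      0, he⟩, fun g => ?_, fun g => ?_⟩
    · refine (ts_defDeltaSucc he g).trans ?_
      rw [het]
      simp [faceSum]
    · refine (tt_defDeltaSucc he g).trans ?_
      simp only [het, faceSum, smul_neg, Finset.sum_neg_distrib]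

/-- As δc is isotropy-valued, dt c is determined by the s-projection. The primitive e of that
s-projection has the same ds and dt after applying δ, so the difference c - δe is killed by both. -/
theorem exists_sub_d_eq_inclusion (hκ : Γ.AnchorSplitting κ) (k : ℕ) (c : Γ.defComplex.X (k + 1))
    (hc : c ∈ Γ.defComplex.C (k + 1)) (h0 : Γ.normalProj k c = 0)
    (w : Γ.isotropyComplex.X (k + 2)) (hw : w ∈ Γ.isotropyComplex.C (k + 2))
    (h : Γ.defComplex.d (k + 1) c = Γ.inclusionₗ (k + 2) w) :
    ∃ e ∈ Γ.defComplex.C k, ∃ u ∈ Γ.isotropyComplex.C (k + 1),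
      c - Γ.defComplex.d k e = Γ.inclusionₗ (k + 1) u := by
  obtain ⟨hs, hσ⟩ := mem_defComplex_succ.1 hc
  have hcσ := ts_eq_sProj hσ
  obtain ⟨e, he, hes, het⟩ := exists_primitive hκ hs.sProj h0
  refine ⟨e, he, ?_⟩
  have hde := mem_defComplex_succ.1 (isComplex_defComplex k e he).1
  refine exists_eq_inclusion_succ (hs.sub hde.1) (fun g => ?_) fun g => ?_
  · refine (map_sub (Γ.ts (g.arr 0)) (c g : E) (Γ.defComplex.d k e g : E)).trans ?_
    exact sub_eq_zero.2 ((hcσ g).trans (hes g).symm)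
  · refine (map_sub (Γ.tt (g.arr 0)) (c g : E) (Γ.defComplex.d k e g : E)).trans ?_
    exact sub_eq_zero.2 ((tt_eq_neg_faceSum hcσ hw h g).trans (het g).symm)

end Splittings

end Projection

end LieGroupoid

end

/-! ### The long exact sequence -/

theorem mainTheorem5 {E F G M : Type*}
    [NormedAddCommGroup E] [NormedSpace ℝ E] [FiniteDimensional ℝ E]
    [NormedAddCommGroup F] [NormedSpace ℝ F] [FiniteDimensional ℝ F]
    [TopologicalSpace G] [ChartedSpace E G] [IsManifold 𝓘(ℝ, E) ∞ G]
    [T2Space G] [SecondCountableTopology G]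
    [TopologicalSpace M] [ChartedSpace F M] [IsManifold 𝓘(ℝ, F) ∞ M]
    [T2Space M] [SecondCountableTopology M]
    (Γ : LieGroupoid E F G M) (hΓ : Γ.IsRegular) :
    -- `C^*_def(G)`, `C^*(G, 𝔦)` and `C^*(G, ν)` are cochain complexes
    Γ.defComplex.IsComplex ∧ Γ.isotropyComplex.IsComplex ∧ Γ.normalComplex.IsComplex ∧
    ∃ (r : ∀ k, Γ.isotropyComplex.H k →ₗ[ℝ] Γ.defComplex.H k)
      (π : ∀ k, Γ.defComplex.H (k + 1) →ₗ[ℝ] Γ.normalComplex.H k)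
      (K : ∀ k, Γ.normalComplex.H k →ₗ[ℝ] Γ.isotropyComplex.H (k + 2)),
      -- `r` is induced by the inclusion `u ↦ c_u`
      (∀ k, ∀ u (hu : u ∈ Γ.isotropyComplex.Z k), ∃ hc : Γ.inclusion u ∈ Γ.defComplex.Z k,
        r k (Γ.isotropyComplex.cls u hu) = Γ.defComplex.cls (Γ.inclusion u) hc) ∧
      -- `π` sends the class of `c` to the class of its `s`-projection modulo `Im ρ`
      (∀ k, ∀ c (hc : c ∈ Γ.defComplex.Z (k + 1)), ∀ σ, Γ.IsSProjection c σ →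
        ∃ hv : Γ.normalClass σ ∈ Γ.normalComplex.Z k,
          π k (Γ.defComplex.cls c hc) = Γ.normalComplex.cls (Γ.normalClass σ) hv) ∧
      -- `K` is the connecting map: every cocycle `v` is the class modulo `Im ρ` of the
      -- `s`-projection of a cochain `c` with `δc` isotropy-valued, and `K [v] = [δc]` for any such `c`
      (∀ k, ∀ v ∈ Γ.normalComplex.Z k, ∃ c ∈ Γ.defComplex.C (k + 1), ∃ σ, Γ.IsSProjection c σ ∧
        Γ.normalClass σ = v ∧
        ∃ w ∈ Γ.isotropyComplex.Z (k + 2), Γ.defComplex.d (k + 1) c = Γ.inclusion w) ∧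
      (∀ k, ∀ c ∈ Γ.defComplex.C (k + 1), ∀ σ, Γ.IsSProjection c σ →
        ∀ w ∈ Γ.isotropyComplex.C (k + 2), Γ.defComplex.d (k + 1) c = Γ.inclusion w →
        ∃ (hv : Γ.normalClass σ ∈ Γ.normalComplex.Z k) (hw : w ∈ Γ.isotropyComplex.Z (k + 2)),
          K k (Γ.normalComplex.cls (Γ.normalClass σ) hv) = Γ.isotropyComplex.cls w hw) ∧
      -- exactness; as `H^{-2}(G, ν) = H^{-1}(G, ν) = 0`, the sequence starts with
      -- `0 → H^0(G, 𝔦) → H^0_def(G) → 0 → H^1(G, 𝔦) → H^1_def(G) → H^0(G, ν) → H^2(G, 𝔦) → ⋯`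
      Function.Bijective (r 0) ∧ Function.Injective (r 1) ∧
      ∀ k, Function.Exact (r (k + 1)) (π k) ∧ Function.Exact (π k) (K k) ∧
        Function.Exact (K k) (r (k + 2)) := by
  obtain ⟨τ, hτ, hτ'⟩ := Γ.exists_splitting_src
  obtain ⟨κ, hκs, hκt, hκ'⟩ := Γ.exists_splitting_anchor hΓ
  have hτ : Γ.SrcSplitting τ := ⟨hτ, hτ'⟩
  have hκ : Γ.AnchorSplitting κ := ⟨hκs, hκt, hκ'⟩
  have hσ : ∀ (k : ℕ) (c : Γ.defComplex.X (k + 1)) (σ : Γ.Str k → F), Γ.IsSProjection c σ →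
      Γ.normalProj k c = Γ.normalClass σ := fun k c σ h =>
    LieGroupoid.normalProj_apply (LieGroupoid.isSProjection_iff.1 h)
  obtain ⟨r, π, K, hr, hπ, hK, h0, h1, hex⟩ := CochainData.exists_long_exact_sequence
    LieGroupoid.isComplex_defComplex Γ.inclusionₗ Γ.normalProj (fun k => if k = 0 then -1 else 1)
    LieGroupoid.inclusion_injOn (fun k => by split_ifs <;> norm_num) LieGroupoid.inclusion_mem
    (fun _ _ hu => LieGroupoid.isotropyComplex_d_mem hu) LieGroupoid.d_inclusion
    LieGroupoid.normalProj_mem LieGroupoid.normalProj_d LieGroupoid.normalProj_d_zero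
    LieGroupoid.normalProj_inclusion (LieGroupoid.normalProj_surjOn hκ hτ)
    (LieGroupoid.exists_lift_isotropic hκ hτ) LieGroupoid.exists_eq_inclusion_of_d_eq
    (LieGroupoid.exists_sub_d_eq_inclusion hκ)
  refine ⟨LieGroupoid.isComplex_defComplex, LieGroupoid.isComplex_isotropyComplex,
    CochainData.isComplex_of_surjective LieGroupoid.isComplex_defComplex Γ.normalProj
      LieGroupoid.normalProj_mem LieGroupoid.normalProj_d (LieGroupoid.normalProj_surjOn hκ hτ),
    r, π, K, hr, fun k c hc σ hcσ => ?_, fun k v hv => ?_, fun k c hc σ hcσ w hw h => ?_, h0, h1, hex⟩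
  · obtain ⟨hv, h⟩ := hπ k c hc
    have e := hσ k c σ hcσ
    exact e ▸ ⟨hv, h⟩
  · obtain ⟨c, hc, hcv, w, hw, h⟩ := LieGroupoid.exists_lift_isotropic hκ hτ k v hv
    obtain ⟨σ, hcσ⟩ := hc.2
    obtain ⟨-, hw', -⟩ := hK k c hc w hw h
    exact ⟨c, hc, σ, hcσ, (hσ k c σ hcσ).symm.trans hcv, w, hw', h⟩
  · obtain ⟨hv, hw', h'⟩ := hK k c hc w hw h
    have e := hσ k c σ hcσ
    exact e ▸ ⟨hv, hw', h'⟩
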